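/- Let $\mathbb T=\mathbb R/\mathbb Z$, let $H^m=H^m(\mathbb T,\mathbb R)$ ($m\in\mathbb Z_{\ge 0}$) be the real Sobolev spaces and $H^m_0\subset H^m$ the subspace of functions of mean zero; let $\partial_x^{-1}:H_0^m\to H_0^{m+1}$ be the mean-zero antiderivative, and let $$M_{\sinh}^{m}=\Big\{u\in H^{m}:\ \int_{\mathbb T}\sinh(u)\,dx=0\Big\}.$$ For a $C^1$ functional $F:H_0^m\to\mathbb R$ that has an $L^2$-gradient in $H^1$ at every point, $\partial_vF\in H^1$ denotes this gradient at $v$, normalized to have mean zero (gradients on $H_0^m$ being unique up to an additive constant). For two such functionals, the Gardner bracket is $\{F,G\}(v)=\int_{\mathbb T}\partial_vF\;\partial_x\partial_vG\,dx$, and the Hamiltonian equation with Hamiltonian $F$ is $v_t=\partial_x\partial_vF$. For $v\in H_0^m$ let $L_M(v)=-\partial_x^2-2v\,\partial_x$ be the Lax operator of the defocusing mKdV equation $v_t+v_{xxx}-6v^2v_x=0$, considered on $L^2((0,1),\mathbb C)$ with domain the periodic, respectively anti-periodic, functions in $H^2$; its spectrum is then called the periodic, respectively anti-periodic, spectrum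 of $L_M(v)$. A Hamiltonian $F$ as above is in the *Poisson algebra* of the defocusing mKdV equation if the periodic and the anti-periodic spectra of $L_M(v)$ (with multiplicities) are constants of motion under the flow of $F$, i.e. are constant along every $C^1$ solution $v:J\to H_0^m$, $J\subset\mathbb R$ an interval, of $v_t=\partial_x\partial_vF$. **Theorem.** For every integer $m\ge 0$ the following holds. (i) $M_{\sinh}^{m+1}$ is a real-analytic submanifold of $H^{m+1}$ of codimension one, and the map $$\Psi_{sh}:H_0^m\to M_{\sinh}^{m+1},\quad v\mapsto 2\partial_x^{-1}v+c_{sh}(v),\qquad c_{sh}(v)=-\operatorname{artanh}\left(\frac{\int_{\mathbb T}\sinh(2\partial_x^{-1}v)\,dx}{\int_{\mathbb T}\cosh(2\partial_x^{-1}v)\,dx}\right),$$ is a real-analytic diffeomorphism. It transforms the sinh-Gordon equation $u_{xt}=\sinh(u)$ into $$v_t=\tfrac12\sinh\big(2\partial_x^{-1}v+c_{sh}(v)\big),\qquad(*)$$ that is, for every non-degenerate interval $J\subset\mathbb R$, a curve $v:J\to H_0^m$ is a $C^1$ solution of $(*)$ if and only if $u=\Psi_{sh}\circ v:J\to M_{\sinh}^{m+1}$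 is a $C^1$ solution of the sinh-Gordon equation. For every $v\in H_0^m$, $\tfrac12\sinh(2\partial_x^{-1}v+c_{sh}(v))$ is in $H_0^{m+1}$. (ii) Equation $(*)$ is Hamiltonian with respect to the Gardner bracket, with Hamiltonian $$H_{sh}:H_0^m\to\mathbb R,\qquad H_{sh}(v)=-\tfrac14\int_{\mathbb T}\cosh\big(2\partial_x^{-1}v+c_{sh}(v)\big)\,dx.$$ That is, $H_{sh}$ is $C^1$ with $L^2$-gradients in $H^1$, one has $\partial_x\partial_vH_{sh}=\tfrac12\sinh(2\partial_x^{-1}v+c_{sh}(v))$ for all $v\in H_0^m$, and $\frac{d}{dt}F(v(t))=\{F,H_{sh}\}(v(t))$ for every $C^1$ solution $v$ of $(*)$ on a non-degenerate interval and every $C^1$ functional $F:H_0^m\to\mathbb R$ with $L^2$-gradients in $H^1$. (iii) $H_{sh}$ is in the Poisson algebra of the defocusing mKdV equation; in this sense $(*)$ is an integrable PDE on $H_0^m$. -/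

import Mathlib

open MeasureTheory Set Function
open scoped ContDiff

namespace SinhGordon

noncomputable section

/-! ### Functions on the circle `𝕋 = ℝ/ℤ` and their weak derivatives -/

/-- Lebesgue measure on the fundamental domain `(0, 1]` of `𝕋 = ℝ/ℤ`. -/
abbrev circleMeasure : Measure ℝ := volume.restrict (Ioc (0 : ℝ) 1)

/-- `L²(𝕋, 𝕜)`, functions on `𝕋` being identified with functions on the fundamental domain. -/
abbrev L2 (𝕜 : Type) [RCLike 𝕜] : Type := Lp 𝕜 2 circleMeasure

/-- For `σ = 1`: `g` is the weak derivative of `f` on the circle, tested against all smooth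
`1`-periodic functions. For `σ = -1`: the same for anti-periodic functions, that is, for functions
extended to `ℝ` by `f (x + 1) = -f x`, tested against smooth anti-periodic functions. -/
def IsWeakDeriv {𝕜 : Type} [RCLike 𝕜] (σ : ℝ) (f g : L2 𝕜) : Prop :=
  ∀ φ : ℝ → ℝ, ContDiff ℝ ∞ φ → (∀ x, φ (x + 1) = σ * φ x) →
    ∫ x, deriv φ x • f x ∂circleMeasure = -∫ x, φ x • g x ∂circleMeasure

theorem integrable_of_L2 {𝕜 : Type} [RCLike 𝕜] (f : L2 𝕜) : Integrable f circleMeasure :=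
  (Lp.memLp f).integrable (by norm_num)

theorem integrable_smul {𝕜 : Type} [RCLike 𝕜] {φ : ℝ → ℝ} (hφ : Continuous φ) (f : L2 𝕜) :
    Integrable (fun x => φ x • f x) circleMeasure := by
  have hf := integrable_of_L2 f
  obtain ⟨C, hC⟩ := (isCompact_Icc (a := (0 : ℝ)) (b := 1)).exists_bound_of_continuousOn
    hφ.continuousOn
  refine hf.bdd_smul C hφ.aestronglyMeasurable ?_
  filter_upwards [ae_restrict_mem measurableSet_Ioc] with x hx
  exact hC x (Ioc_subset_Icc_self hx)

theorem isWeakDeriv_zero {𝕜 : Type} [RCLike 𝕜] (σ : ℝ) :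
    IsWeakDeriv σ (0 : L2 𝕜) 0 := by
  intro φ _ _
  have h : ((0 : L2 𝕜) : ℝ → 𝕜) =ᵐ[circleMeasure] 0 := Lp.coeFn_zero _ _ _
  have h1 : ∫ x, deriv φ x • (0 : L2 𝕜) x ∂circleMeasure = 0 := by
    rw [integral_eq_zero_of_ae]
    filter_upwards [h] with x hx
    rw [hx]; simp
  have h2 : ∫ x, φ x • (0 : L2 𝕜) x ∂circleMeasure = 0 := by
    rw [integral_eq_zero_of_ae]
    filter_upwards [h] with x hx
    rw [hx]; simp
  rw [h1, h2, neg_zero]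

theorem IsWeakDeriv.add {𝕜 : Type} [RCLike 𝕜] {σ : ℝ} {f g f' g' : L2 𝕜}
    (h : IsWeakDeriv σ f g) (h' : IsWeakDeriv σ f' g') :
    IsWeakDeriv σ (f + f') (g + g') := by
  intro φ hφ hp
  have hc : Continuous (deriv φ) := hφ.continuous_deriv (by simp)
  have e1 : ∫ x, deriv φ x • (f + f' : L2 𝕜) x ∂circleMeasure
      = ∫ x, (deriv φ x • f x + deriv φ x • f' x) ∂circleMeasure := by
    apply integral_congr_ae
    filter_upwards [Lp.coeFn_add f f'] with x hx
    rw [hx, Pi.add_apply, smul_add]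
  have e2 : ∫ x, φ x • (g + g' : L2 𝕜) x ∂circleMeasure
      = ∫ x, (φ x • g x + φ x • g' x) ∂circleMeasure := by
    apply integral_congr_ae
    filter_upwards [Lp.coeFn_add g g'] with x hx
    rw [hx, Pi.add_apply, smul_add]
  rw [e1, e2, integral_add (integrable_smul hc f) (integrable_smul hc f'),
    integral_add (integrable_smul hφ.continuous g) (integrable_smul hφ.continuous g'),
    h φ hφ hp, h' φ hφ hp, neg_add]

theorem IsWeakDeriv.smul {𝕜 : Type} [RCLike 𝕜] {σ : ℝ} {f g : L2 𝕜} (c : 𝕜)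
    (h : IsWeakDeriv σ f g) : IsWeakDeriv σ (c • f) (c • g) := by
  intro φ hφ hp
  have e1 : ∫ x, deriv φ x • (c • f : L2 𝕜) x ∂circleMeasure
      = ∫ x, c • (deriv φ x • f x) ∂circleMeasure := by
    apply integral_congr_ae
    filter_upwards [Lp.coeFn_smul c f] with x hx
    rw [hx, Pi.smul_apply, smul_comm]
  have e2 : ∫ x, φ x • (c • g : L2 𝕜) x ∂circleMeasure
      = ∫ x, c • (φ x • g x) ∂circleMeasure := by
    apply integral_congr_ae
    filter_upwards [Lp.coeFn_smul c g] with x hx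
    rw [hx, Pi.smul_apply, smul_comm]
  rw [e1, e2, integral_smul, integral_smul, h φ hφ hp, smul_neg]

/-! ### Sobolev spaces `H^m(𝕋, ℝ)` -/

/-- The real Sobolev space `H^m(𝕋, ℝ)`: a function `u ∈ L²` having weak derivatives up to order `m`
in `L²` is represented by the (uniquely determined) tuple `(u, ∂ₓu, …, ∂ₓᵐu)`; the norm is
`‖u‖² = ∑_{j ≤ m} ‖∂ₓʲu‖²_{L²}`. -/
def H (m : ℕ) : Submodule ℝ (PiLp 2 (fun _ : Fin (m + 1) => L2 ℝ)) where
  carrier := {w | ∀ i : Fin m, IsWeakDeriv 1 (w i.castSucc) (w i.succ)}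
  zero_mem' := fun _ => isWeakDeriv_zero 1
  add_mem' := fun ha hb i => (ha i).add (hb i)
  smul_mem' := fun c _ ha i => (ha i).smul c

/-- The `L²` class underlying an element of `H^m`. -/
def toL2 {m : ℕ} (u : H m) : L2 ℝ := (u : PiLp 2 (fun _ : Fin (m + 1) => L2 ℝ)) 0

/-- The function underlying an element of `H^m` (defined almost everywhere on `(0, 1]`). -/
def fn {m : ℕ} (u : H m) : ℝ → ℝ := toL2 u

/-- The derivative `∂ₓ : H^{m+1} → H^m`. -/
def dx {m : ℕ} (u : H (m + 1)) : H m :=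
  ⟨WithLp.toLp 2 (fun i : Fin (m + 1) =>
      (u : PiLp 2 (fun _ : Fin (m + 1 + 1) => L2 ℝ)) i.succ),
    fun i => u.2 i.succ⟩

/-- The subspace `H₀^m` of elements of `H^m` with mean zero. -/
def H0 (m : ℕ) : Submodule ℝ (H m) where
  carrier := {u | ∫ x, fn u x ∂circleMeasure = 0}
  zero_mem' := by
    change ∫ x, fn (0 : H m) x ∂circleMeasure = 0
    rw [integral_eq_zero_of_ae]
    exact Lp.coeFn_zero _ _ _
  add_mem' := by
    intro a b ha hb
    change ∫ x, fn (a + b) x ∂circleMeasure = 0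
    change ∫ x, fn a x ∂circleMeasure = 0 at ha
    change ∫ x, fn b x ∂circleMeasure = 0 at hb
    have e : ∫ x, fn (a + b) x ∂circleMeasure
        = ∫ x, (fn a x + fn b x) ∂circleMeasure :=
      integral_congr_ae (Lp.coeFn_add _ _)
    rw [e, integral_add (integrable_of_L2 _) (integrable_of_L2 _), ha, hb, add_zero]
  smul_mem' := by
    intro c a ha
    change ∫ x, fn (c • a) x ∂circleMeasure = 0
    change ∫ x, fn a x ∂circleMeasure = 0 at ha
    have e : ∫ x, fn (c • a) x ∂circleMeasure = ∫ x, c • fn a x ∂circleMeasure :=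
      integral_congr_ae (Lp.coeFn_smul _ _)
    rw [e, integral_smul, ha, smul_zero]

/-- The underlying function of an element of `H₀^m`. -/
def fn0 {m : ℕ} (v : H0 m) : ℝ → ℝ := fn (v : H m)

/-! ### Constants and the mean-zero antiderivative -/

theorem integral_deriv_of_periodic {φ : ℝ → ℝ} (hφ : ContDiff ℝ ∞ φ)
    (hp : ∀ x, φ (x + 1) = 1 * φ x) : ∫ x, deriv φ x ∂circleMeasure = 0 := by
  have h := intervalIntegral.integral_deriv_eq_sub (f := φ) (a := 0) (b := 1)
    (fun x _ => (hφ.differentiable (by simp)) x)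
    ((hφ.continuous_deriv (by simp)).intervalIntegrable 0 1)
  rw [intervalIntegral.integral_of_le zero_le_one] at h
  have h1 := hp 0
  rw [zero_add, one_mul] at h1
  rw [h, h1, sub_self]

theorem isWeakDeriv_const (c : ℝ) : IsWeakDeriv 1 (Lp.const 2 circleMeasure c : L2 ℝ) 0 := by
  intro φ hφ hp
  have e1 : ∫ x, deriv φ x • (Lp.const 2 circleMeasure c : L2 ℝ) x ∂circleMeasure
      = ∫ x, deriv φ x * c ∂circleMeasure := by
    apply integral_congr_ae
    filter_upwards [Lp.coeFn_const (p := 2) (μ := circleMeasure) c] with x hx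
    rw [hx, smul_eq_mul, const_apply]
  have e2 : ∫ x, φ x • (0 : L2 ℝ) x ∂circleMeasure = 0 := by
    rw [integral_eq_zero_of_ae]
    filter_upwards [Lp.coeFn_zero ℝ 2 circleMeasure] with x hx
    rw [hx]; simp
  rw [e1, e2, integral_mul_const, integral_deriv_of_periodic hφ hp]
  simp

/-- The constant function `c` as an element of `H^m`. -/
def constH (m : ℕ) (c : ℝ) : H m :=
  ⟨WithLp.toLp 2 (Fin.cases (motive := fun _ => L2 ℝ) (Lp.const 2 circleMeasure c) (fun _ => 0)), by
    intro i
    cases m with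
    | zero => exact i.elim0
    | succ n =>
      refine Fin.cases ?_ (fun j => ?_) i
      · exact isWeakDeriv_const c
      · exact isWeakDeriv_zero 1⟩

/-- The antiderivative `x ↦ ∫₀ˣ v(y) dy - ∫₀¹ ∫₀ˢ v(y) dy ds` with mean zero. -/
def primFn (v : ℝ → ℝ) (x : ℝ) : ℝ :=
  (∫ y in (0 : ℝ)..x, v y) - ∫ s, (∫ y in (0 : ℝ)..s, v y) ∂circleMeasure

theorem intervalIntegrable_of_L2 (v : L2 ℝ) : IntervalIntegrable v volume 0 1 :=
  (intervalIntegrable_iff_integrableOn_Ioc_of_le zero_le_one).2 (integrable_of_L2 v)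

theorem continuousOn_primitive (v : L2 ℝ) :
    ContinuousOn (fun x => ∫ y in (0 : ℝ)..x, v y) (Icc 0 1) := by
  have h := ((intervalIntegrable_of_L2 v).absolutelyContinuousOnInterval_intervalIntegral
    (c := 0) (by simp)).continuousOn
  rwa [uIcc_of_le zero_le_one] at h

theorem memLp_primFn (v : L2 ℝ) : MemLp (primFn v) 2 circleMeasure := by
  have hc : ContinuousOn (primFn v) (Icc 0 1) := (continuousOn_primitive v).sub continuousOn_const
  obtain ⟨C, hC⟩ := isCompact_Icc.exists_bound_of_continuousOn hc
  refine MemLp.of_bound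
    ((hc.mono Ioc_subset_Icc_self).aestronglyMeasurable measurableSet_Ioc) C ?_
  filter_upwards [ae_restrict_mem measurableSet_Ioc] with x hx
  exact hC x (Ioc_subset_Icc_self hx)

theorem integral_primFn (v : L2 ℝ) : ∫ x, primFn v x ∂circleMeasure = 0 := by
  have hi : Integrable (fun x => ∫ y in (0 : ℝ)..x, v y) circleMeasure :=
    ((continuousOn_primitive v).integrableOn_Icc).mono_set Ioc_subset_Icc_self
  simp only [primFn]
  rw [integral_sub hi (integrable_const _)]
  simp

theorem isWeakDeriv_primFn (v : L2 ℝ) (hv : ∫ x, v x ∂circleMeasure = 0) :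
    IsWeakDeriv 1 ((memLp_primFn v).toLp (primFn v)) v := by
  intro φ hφ hp
  have hvi := intervalIntegrable_of_L2 v
  have hAC : AbsolutelyContinuousOnInterval (fun x => ∫ y in (0 : ℝ)..x, v y) 0 1 :=
    hvi.absolutelyContinuousOnInterval_intervalIntegral (c := 0) (by simp)
  have hφAC : AbsolutelyContinuousOnInterval φ 0 1 :=
    (hφ.of_le (by simp)).contDiffOn.absolutelyContinuousOnInterval
  have key := hAC.integral_mul_deriv_eq_deriv_mul hφAC
  have hv1 : ∫ y in (0 : ℝ)..1, v y = 0 := by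
    rw [intervalIntegral.integral_of_le zero_le_one]; exact hv
  have hd : ∫ x in (0 : ℝ)..1, deriv (fun x => ∫ y in (0 : ℝ)..x, v y) x * φ x
      = ∫ x in (0 : ℝ)..1, φ x * v x := by
    apply intervalIntegral.integral_congr_ae
    filter_upwards [hvi.ae_hasDerivAt_integral] with x hx hx'
    rw [(hx (uIoc_subset_uIcc hx') 0 (by simp)).deriv, mul_comm]
  rw [hd, hv1] at key
  simp only [zero_mul, intervalIntegral.integral_same, sub_self, zero_sub] at key
  rw [intervalIntegral.integral_of_le zero_le_one, intervalIntegral.integral_of_le zero_le_one]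
    at key
  set k : ℝ := ∫ s, (∫ y in (0 : ℝ)..s, v y) ∂circleMeasure with hk
  have hdc : Continuous (deriv φ) := hφ.continuous_deriv (by simp)
  have hdi : Integrable (deriv φ) circleMeasure :=
    (hdc.continuousOn.integrableOn_Icc).mono_set Ioc_subset_Icc_self
  have hpi : Integrable (fun x => (∫ y in (0 : ℝ)..x, v y) * deriv φ x) circleMeasure :=
    (((continuousOn_primitive v).mul hdc.continuousOn).integrableOn_Icc).mono_set
      Ioc_subset_Icc_self
  have e1 : ∫ x, deriv φ x • ((memLp_primFn v).toLp (primFn v) : L2 ℝ) x ∂circleMeasure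
      = ∫ x, ((∫ y in (0 : ℝ)..x, v y) * deriv φ x - k * deriv φ x) ∂circleMeasure := by
    apply integral_congr_ae
    filter_upwards [(memLp_primFn v).coeFn_toLp] with x hx
    rw [hx, smul_eq_mul, primFn, ← hk]
    ring
  rw [e1, integral_sub hpi (hdi.const_mul k), integral_const_mul,
    integral_deriv_of_periodic hφ hp, mul_zero, sub_zero, key]
  simp only [smul_eq_mul]

/-- The mean-zero antiderivative `∂ₓ⁻¹ : H₀^m → H₀^{m+1}`. -/
def dxInv {m : ℕ} (v : H0 m) : H0 (m + 1) :=
  ⟨⟨WithLp.toLp 2 (Fin.cons (α := fun _ => L2 ℝ)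
      ((memLp_primFn (toL2 (v : H m))).toLp (primFn (toL2 (v : H m))))
      (fun i => ((v : H m) : PiLp 2 (fun _ : Fin (m + 1) => L2 ℝ)) i)), by
      intro i
      refine Fin.cases ?_ (fun j => ?_) i
      · exact isWeakDeriv_primFn _ v.2
      · exact (v : H m).2 j⟩, by
    change ∫ x, ((memLp_primFn (toL2 (v : H m))).toLp (primFn (toL2 (v : H m))) : L2 ℝ) x
      ∂circleMeasure = 0
    rw [integral_congr_ae (memLp_primFn (toL2 (v : H m))).coeFn_toLp]
    exact integral_primFn _⟩

/-! ### The phase space of the sinh-Gordon equation and the map `Ψ` -/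

/-- `M_sinh^m = {u ∈ H^m : ∫ sinh u = 0}`. -/
def Msinh (m : ℕ) : Set (H m) :=
  {u | Integrable (fun x => Real.sinh (fn u x)) circleMeasure ∧
    ∫ x, Real.sinh (fn u x) ∂circleMeasure = 0}

/-- `c_sh(v) = - artanh (∫ sinh(2 ∂ₓ⁻¹ v) / ∫ cosh(2 ∂ₓ⁻¹ v))`. -/
def csh {m : ℕ} (v : H0 m) : ℝ :=
  -Real.artanh ((∫ x, Real.sinh (2 * fn0 (dxInv v) x) ∂circleMeasure) /
    ∫ x, Real.cosh (2 * fn0 (dxInv v) x) ∂circleMeasure)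

/-- `Ψ_sh(v) = 2 ∂ₓ⁻¹ v + c_sh(v) ∈ H^{m+1}`. -/
def Psi {m : ℕ} (v : H0 m) : H (m + 1) :=
  (2 : ℝ) • (dxInv v : H (m + 1)) + constH (m + 1) (csh v)

/-- `H_sh(v) = -1/4 ∫ cosh(2 ∂ₓ⁻¹ v + c_sh(v))`. -/
def Hsh {m : ℕ} (v : H0 m) : ℝ :=
  -(1 / 4) * ∫ x, Real.cosh (2 * fn0 (dxInv v) x + csh v) ∂circleMeasure

/-- `M` is a real-analytic (embedded) submanifold of codimension one: near each of its points it
is the zero set of a real-analytic function whose differential at that point is nonzero. -/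
def IsAnalyticHypersurface {F : Type} [NormedAddCommGroup F] [NormedSpace ℝ F]
    (M : Set F) : Prop :=
  ∀ u ∈ M, ∃ W : Set F, IsOpen W ∧ u ∈ W ∧ ∃ g : F → ℝ, AnalyticOnNhd ℝ g W ∧
    fderiv ℝ g u ≠ 0 ∧ M ∩ W = {w ∈ W | g w = 0}

/-- `f` is a real-analytic diffeomorphism from the space `E` onto the real-analytic hypersurface
`M` of `F`: it is real analytic and maps `E` bijectively onto `M`, and its inverse `M → E` is real
analytic, that is, locally the restriction of a real-analytic map defined on an open set of `F`. -/
def IsAnalyticDiffeoOnto {E F : Type} [NormedAddCommGroup E] [NormedSpace ℝ E]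
    [NormedAddCommGroup F] [NormedSpace ℝ F] (f : E → F) (M : Set F) : Prop :=
  IsAnalyticHypersurface M ∧ AnalyticOnNhd ℝ f univ ∧ BijOn f univ M ∧
    ∀ u ∈ M, ∃ W : Set F, IsOpen W ∧ u ∈ W ∧ ∃ g : F → E, AnalyticOnNhd ℝ g W ∧
      ∀ v : E, f v ∈ W → g (f v) = v

/-! ### Solutions of the evolution equations -/

/-- `v` is a `C¹` curve `J → E` with derivative `v'`. -/
def IsC1Curve {E : Type} [NormedAddCommGroup E] [NormedSpace ℝ E] (J : Set ℝ)
    (v v' : ℝ → E) : Prop :=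
  ContinuousOn v' J ∧ ∀ t ∈ J, HasDerivWithinAt v (v' t) J t

/-- `u` is a `C¹` solution `J → M_sinh^m`, `m = k + 1`, of the sinh-Gordon equation
`u_{xt} = sinh u`. -/
def SolvesSinhGordon {k : ℕ} (J : Set ℝ) (u : ℝ → H (k + 1)) : Prop :=
  ∃ u' : ℝ → H (k + 1), IsC1Curve J u u' ∧ ∀ t ∈ J, u t ∈ Msinh (k + 1) ∧
    fn (dx (u' t)) =ᵐ[circleMeasure] fun x => Real.sinh (fn (u t) x)

/-- `v` is a `C¹` solution `J → H₀^m` of `v_t = ½ sinh(2 ∂ₓ⁻¹ v + c_sh(v))`. -/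
def SolvesReduced {m : ℕ} (J : Set ℝ) (v : ℝ → H0 m) : Prop :=
  ∃ v' : ℝ → H0 m, IsC1Curve J v v' ∧ ∀ t ∈ J,
    fn0 (v' t) =ᵐ[circleMeasure]
      fun x => 1 / 2 * Real.sinh (2 * fn0 (dxInv (v t)) x + csh (v t))

/-! ### The Gardner bracket -/

/-- `g ∈ H¹`, normalized to have mean zero, is the `L²`-gradient of `F : H₀^m → ℝ` at `v`. (On
`H₀^m`, gradients are unique up to constants, which the Gardner bracket does not see.) -/
def IsL2Gradient {m : ℕ} (F : H0 m → ℝ) (v : H0 m) (g : H0 1) : Prop :=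
  ∃ F' : H0 m →L[ℝ] ℝ, HasFDerivAt F F' v ∧
    ∀ h : H0 m, F' h = ∫ x, fn0 g x * fn0 h x ∂circleMeasure

/-- `F` is a `C¹` functional on `H₀^m` with `L²`-gradients in `H¹`. -/
def IsAdmissible {m : ℕ} (F : H0 m → ℝ) : Prop :=
  ContDiff ℝ 1 F ∧ ∀ v, ∃ g, IsL2Gradient F v g

open Classical in
/-- The `L²`-gradient `∂_v F` in `H¹` (for admissible `F`). -/
def l2Gradient {m : ℕ} (F : H0 m → ℝ) (v : H0 m) : H0 1 :=
  if h : ∃ g, IsL2Gradient F v g then h.choose else 0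

/-- The Hamiltonian vector field `∂ₓ ∂_v F` of `F` with respect to the Gardner bracket. -/
def hamVectorField {m : ℕ} (F : H0 m → ℝ) (v : H0 m) : H 0 :=
  dx (l2Gradient F v : H 1)

/-- The Gardner bracket `{F, G}(v) = ∫ ∂_v F ∂ₓ ∂_v G dx`. -/
def gardner {m : ℕ} (F G : H0 m → ℝ) (v : H0 m) : ℝ :=
  ∫ x, fn0 (l2Gradient F v) x * fn (hamVectorField G v) x ∂circleMeasure

/-- `v : J → H₀^m` is a `C¹` trajectory of the Hamiltonian flow `v_t = ∂ₓ ∂_v F` of `F`. -/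
def SolvesHamiltonian {m : ℕ} (F : H0 m → ℝ) (J : Set ℝ) (v : ℝ → H0 m) : Prop :=
  ∃ v' : ℝ → H0 m, IsC1Curve J v v' ∧ ∀ t ∈ J,
    fn0 (v' t) =ᵐ[circleMeasure] fn (hamVectorField F (v t))

/-! ### The Lax operator of the defocusing mKdV equation -/

/-- The graph of the Lax operator `L_M(v) = -∂ₓ² - 2 v ∂ₓ` of the defocusing mKdV equation
`v_t + v_xxx - 6 v² v_x = 0` on `L²((0, 1), ℂ)`, with periodic (`σ = 1`) or anti-periodic
(`σ = -1`) boundary conditions. Its domain consists of the (anti-)periodic functions in `H²`. -/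
def laxGraph {m : ℕ} (v : H0 m) (σ : ℝ) : Submodule ℂ (L2 ℂ × L2 ℂ) where
  carrier := {p | ∃ f₁ f₂ : L2 ℂ, IsWeakDeriv σ p.1 f₁ ∧ IsWeakDeriv σ f₁ f₂ ∧
    p.2 =ᵐ[circleMeasure] fun x => -f₂ x - 2 * (fn0 v x : ℂ) * f₁ x}
  zero_mem' := by
    refine ⟨0, 0, isWeakDeriv_zero σ, isWeakDeriv_zero σ, ?_⟩
    filter_upwards [Lp.coeFn_zero ℂ 2 circleMeasure] with x hx
    simp only [Prod.snd_zero, hx, Pi.zero_apply]; simp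
  add_mem' := by
    rintro p q ⟨f₁, f₂, h₁, h₂, h⟩ ⟨g₁, g₂, k₁, k₂, k⟩
    refine ⟨f₁ + g₁, f₂ + g₂, h₁.add k₁, h₂.add k₂, ?_⟩
    filter_upwards [h, k, Lp.coeFn_add p.2 q.2, Lp.coeFn_add f₁ g₁, Lp.coeFn_add f₂ g₂]
      with x a b c d e
    rw [Prod.snd_add, c, d, e, Pi.add_apply, Pi.add_apply, Pi.add_apply, a, b]
    ring
  smul_mem' := by
    rintro c p ⟨f₁, f₂, h₁, h₂, h⟩
    refine ⟨c • f₁, c • f₂, h₁.smul c, h₂.smul c, ?_⟩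
    filter_upwards [h, Lp.coeFn_smul c p.2, Lp.coeFn_smul c f₁, Lp.coeFn_smul c f₂]
      with x a b d e
    rw [Prod.smul_snd, b, d, e, Pi.smul_apply, Pi.smul_apply, Pi.smul_apply, a]
    simp only [smul_eq_mul]
    ring

/-- The spectrum of `L_M(v)`: those `lam` for which `L_M(v) - lam` is not a bijection from the
domain onto `L²`. -/
def laxSpectrum {m : ℕ} (v : H0 m) (σ : ℝ) : Set ℂ :=
  {lam | ¬ ∀ h : L2 ℂ, ∃! f : L2 ℂ, (f, lam • f + h) ∈ laxGraph v σ}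

/-- The kernel of `(L_M(v) - lam)^k`. -/
def laxKer {m : ℕ} (v : H0 m) (σ : ℝ) (lam : ℂ) : ℕ → Submodule ℂ (L2 ℂ)
  | 0 => ⊥
  | k + 1 =>
    { carrier := {f | ∃ h ∈ laxKer v σ lam k, (f, lam • f + h) ∈ laxGraph v σ}
      zero_mem' := ⟨0, zero_mem _, by
        rw [smul_zero, add_zero]; exact (laxGraph v σ).zero_mem⟩
      add_mem' := by
        rintro a b ⟨h, hh, ha⟩ ⟨h', hh', hb⟩
        refine ⟨h + h', add_mem hh hh', ?_⟩
        have e : (a + b, lam • (a + b) + (h + h')) = (a, lam • a + h) + (b, lam • b + h') := by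
          rw [Prod.mk_add_mk, smul_add]
          congr 1
          abel
        rw [e]
        exact add_mem ha hb
      smul_mem' := by
        rintro c a ⟨h, hh, ha⟩
        refine ⟨c • h, Submodule.smul_mem _ c hh, ?_⟩
        have e : (c • a, lam • (c • a) + c • h) = c • (a, lam • a + h) := by
          rw [Prod.smul_mk, smul_add, smul_comm]
        rw [e]
        exact Submodule.smul_mem _ c ha }

/-- The algebraic multiplicity of `lam` as an eigenvalue of `L_M(v)`: the dimension of the
generalized eigenspace. -/
def laxMultiplicity {m : ℕ} (v : H0 m) (σ : ℝ) (lam : ℂ) : Cardinal :=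
  Module.rank ℂ (⨆ k : ℕ, laxKer v σ lam k : Submodule ℂ (L2 ℂ))

/-- The Hamiltonian `F` on `H₀^m` is in the Poisson algebra of the defocusing mKdV equation: the
periodic and the anti-periodic spectrum of `L_M`, counted with multiplicities, are constants of
motion under the Hamiltonian flow of `F`. -/
def InPoissonAlgebraMKdV {m : ℕ} (F : H0 m → ℝ) : Prop :=
  IsAdmissible F ∧
    ∀ (J : Set ℝ) (v : ℝ → H0 m), J.OrdConnected → SolvesHamiltonian F J v →
      ∀ σ : ℝ, (σ = 1 ∨ σ = -1) → ∀ s ∈ J, ∀ t ∈ J,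
        laxSpectrum (v s) σ = laxSpectrum (v t) σ ∧
          ∀ lam : ℂ, laxMultiplicity (v s) σ lam = laxMultiplicity (v t) σ lam

end

end SinhGordon

open SinhGordon

/-!
The map `Ψ(v) = 2 ∂ₓ⁻¹ v + c_sh(v)` has the linear left inverse `u ↦ ½ ∂ₓ u`, and `c_sh(v)` is the
unique constant which puts `Ψ(v)` on `M_sinh` (`Psi_mem_Msinh`, `bijOn_Psi`). Analyticity comes from
the Sobolev embedding `evalC` of `H^{m+1}` into the Banach algebra of bounded continuous functions,
on which `sinh` and `cosh` are given by power series. Applying `½ ∂ₓ` to the sinh-Gordon equation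
gives the reduced equation, and conversely (`solvesSinhGordon_iff`).

The derivative of `H_sh` at `v` in the direction `h` is
`-¼ ∫ sinh (Ψ(v)) (2 ∂ₓ⁻¹ h + dc_sh(h)) = -½ ∫ sinh (Ψ(v)) ∂ₓ⁻¹ h`, the constant being invisible as
`∫ sinh (Ψ(v)) = 0`. Integration by parts turns this into `∫ (½ ∂ₓ⁻¹ sinh (Ψ(v))) h`, so that the
Hamiltonian vector field of `H_sh` is `½ sinh (Ψ(v))` (`exists_gradient_Hsh`).

For the isospectrality put `a = Ψ(v)`. Since `∂ₓ a = 2 v`, the Lax operator has the divergence form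
`L_M(v) = -e^{-a} ∂ₓ e^a ∂ₓ`. It is symmetric for the weight `e^a`, so that generalized
eigenfunctions are eigenfunctions (`iSup_laxKer`), and its resolvent equation at `λ` amounts to the
first order system `P(f, g) = (f' - e^{-a} g, g' + λ e^a f)`, whose bijectivity and kernel determine
the spectrum and the multiplicities (`notMem_laxSpectrum_iff`, `rank_laxKer_eq`). Along a solution
`u_{xt} = sinh u` this operator satisfies, for `λ ≠ 0`, the Lax equation `∂ₜ P + P T = T P` with
`T(f, g) = (-½ u_t f - g / (4 λ), ¼ f + ½ u_t g)`. In contrast to the Lax operator itself, `T` is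
bounded, on `L² × L²` as well as on `H¹ × H¹`, where `P` is defined; thus linear ordinary differential
equations in spaces of bounded operators yield `P(t) U = V P(s)` with invertible `U` and `V`
(`exists_lax_intertwining`, `exists_laxOp_intertwining`). At `λ = 0` the eigenspace consists of the
functions with `f' = 0`, whatever the potential is.

Weak derivatives are handled through absolutely continuous representatives on `[0, 1]` with periodic
or anti-periodic boundary values (`PerAC`, `IsWeakDeriv.exists_perAC`).
-/

namespace SinhGordon

noncomputable section

open scoped BoundedContinuousFunction Topology

/-! ### Absolutely continuous functions on `[0, 1]` -/

/-- `F` is absolutely continuous on `[0, 1]` with almost everywhere derivative `G ∈ L²(0, 1)`. -/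
structure ACPair {𝕜 : Type} [RCLike 𝕜] (F G : ℝ → 𝕜) : Prop where
  ac : AbsolutelyContinuousOnInterval F 0 1
  hasDeriv : ∀ᵐ x, x ∈ uIcc (0 : ℝ) 1 → HasDerivAt F (G x) x
  memLp : MemLp G 2 circleMeasure

section ACPair

variable {𝕜 : Type} [RCLike 𝕜]

theorem intervalIntegrable_of_memLp {G : ℝ → 𝕜} (hG : MemLp G 2 circleMeasure) :
    IntervalIntegrable G volume 0 1 :=
  (intervalIntegrable_iff_integrableOn_Ioc_of_le zero_le_one).2 (hG.integrable (by norm_num))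

theorem absolutelyContinuous_primitive {G : ℝ → 𝕜} (hG : IntervalIntegrable G volume 0 1) :
    AbsolutelyContinuousOnInterval (fun x => ∫ y in (0 : ℝ)..x, G y) 0 1 := by
  have hn := hG.norm.absolutelyContinuousOnInterval_intervalIntegral (c := 0) (by simp)
  unfold AbsolutelyContinuousOnInterval at hn ⊢
  refine squeeze_zero' (Filter.Eventually.of_forall fun _ => Finset.sum_nonneg
    fun _ _ => dist_nonneg) ?_ hn
  rw [Filter.eventually_inf_principal]
  filter_upwards with E hE
  refine Finset.sum_le_sum fun i hi => ?_
  have h0 : (0 : ℝ) ∈ uIcc (0 : ℝ) 1 := by simp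
  have hsub : ∀ x ∈ uIcc (0 : ℝ) 1, uIcc 0 x ⊆ uIcc (0 : ℝ) 1 := fun x hx =>
    uIcc_subset_uIcc h0 hx
  have a1 := hE.1 i hi
  have i1 := hG.mono_set (hsub _ a1.1)
  have i2 := hG.mono_set (hsub _ a1.2)
  rw [dist_eq_norm, dist_eq_norm, intervalIntegral.integral_interval_sub_left i1 i2,
    intervalIntegral.integral_interval_sub_left i1.norm i2.norm]
  exact intervalIntegral.norm_integral_le_abs_integral_norm

theorem acPair_primitive {G : ℝ → 𝕜} (hG : MemLp G 2 circleMeasure) (c : 𝕜) :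
    ACPair (fun x => c + ∫ y in (0 : ℝ)..x, G y) G where
  ac := by
    have hc : AbsolutelyContinuousOnInterval (fun _ : ℝ => c) 0 1 :=
      contDiffOn_const.absolutelyContinuousOnInterval
    exact hc.fun_add (absolutelyContinuous_primitive (intervalIntegrable_of_memLp hG))
  hasDeriv := by
    filter_upwards [(intervalIntegrable_of_memLp hG).ae_hasDerivAt_integral] with x hx hx'
    exact (hx hx' 0 (by simp)).const_add c
  memLp := hG

namespace ACPair

variable {F G F' G' : ℝ → 𝕜}

theorem continuousOn (h : ACPair F G) : ContinuousOn F (Icc 0 1) := by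
  have := h.ac.continuousOn
  rwa [uIcc_of_le zero_le_one] at this

theorem exists_bound (h : ACPair F G) : ∃ C, ∀ x ∈ Icc (0 : ℝ) 1, ‖F x‖ ≤ C :=
  isCompact_Icc.exists_bound_of_continuousOn h.continuousOn

theorem memLp_top (h : ACPair F G) : MemLp F ⊤ circleMeasure := by
  obtain ⟨C, hC⟩ := h.exists_bound
  refine memLp_top_of_bound
    ((h.continuousOn.mono Ioc_subset_Icc_self).aestronglyMeasurable measurableSet_Ioc) C ?_
  filter_upwards [ae_restrict_mem measurableSet_Ioc] with x hx
  exact hC x (Ioc_subset_Icc_self hx)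

theorem memLp_fun (h : ACPair F G) : MemLp F 2 circleMeasure :=
  h.memLp_top.mono_exponent le_top

theorem integral_eq (h : ACPair F G) {x : ℝ} (hx : x ∈ Icc (0 : ℝ) 1) :
    ∫ y in (0 : ℝ)..x, G y = F x - F 0 := by
  have hG := intervalIntegrable_of_memLp h.memLp
  have hD := h.ac.fun_sub (absolutelyContinuous_primitive hG)
  obtain ⟨C, hC⟩ := hD.const_of_ae_hasDerivAt_zero (by
    filter_upwards [h.hasDeriv, hG.ae_hasDerivAt_integral] with y h1 h2 hy
    simpa using! (h1 hy).sub (h2 hy 0 (by simp)))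
  have e0 := hC 0 (by simp)
  have e1 := hC x (by rwa [uIcc_of_le zero_le_one])
  rw [← e0] at e1
  simp only [intervalIntegral.integral_same, sub_zero] at e1
  rw [← e1]; ring

theorem integral_eq_sub (h : ACPair F G) : ∫ x, G x ∂circleMeasure = F 1 - F 0 := by
  rw [← h.integral_eq (right_mem_Icc.2 zero_le_one), intervalIntegral.integral_of_le zero_le_one]

theorem mul (h : ACPair F G) (h' : ACPair F' G') :
    ACPair (fun x => F x * F' x) (fun x => G x * F' x + F x * G' x) where
  ac := h.ac.fun_smul h'.ac
  hasDeriv := by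
    filter_upwards [h.hasDeriv, h'.hasDeriv] with x h1 h2 hx
    exact (h1 hx).mul (h2 hx)
  memLp := by
    have m1 : MemLp (fun x => G x * F' x) 2 circleMeasure :=
      MemLp.mul' (p := 2) (q := ⊤) h'.memLp_top h.memLp
    have m2 : MemLp (fun x => F x * G' x) 2 circleMeasure :=
      MemLp.mul' (p := ⊤) (q := 2) h'.memLp h.memLp_top
    exact m1.add m2

theorem add (h : ACPair F G) (h' : ACPair F' G') :
    ACPair (fun x => F x + F' x) (fun x => G x + G' x) where
  ac := h.ac.fun_add h'.ac
  hasDeriv := by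
    filter_upwards [h.hasDeriv, h'.hasDeriv] with x h1 h2 hx
    exact (h1 hx).add (h2 hx)
  memLp := h.memLp.add h'.memLp

theorem const_smul (h : ACPair F G) (c : ℝ) :
    ACPair (fun x => c • F x) (fun x => c • G x) where
  ac := h.ac.const_smul c
  hasDeriv := by
    filter_upwards [h.hasDeriv] with x h1 hx
    exact (h1 hx).const_smul c
  memLp := h.memLp.const_smul c

theorem clm {𝕜' : Type} [RCLike 𝕜'] (h : ACPair F G) (T : 𝕜 →L[ℝ] 𝕜') :
    ACPair (fun x => T (F x)) (fun x => T (G x)) where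
  ac := by
    have h1 := h.ac
    unfold AbsolutelyContinuousOnInterval at h1 ⊢
    have h2 := h1.const_mul ‖T‖
    rw [mul_zero] at h2
    refine squeeze_zero (fun _ => Finset.sum_nonneg fun _ _ => dist_nonneg) (fun E => ?_) h2
    rw [Finset.mul_sum]
    exact Finset.sum_le_sum fun i _ => T.dist_le_opNorm _ _
  hasDeriv := by
    filter_upwards [h.hasDeriv] with x h1 hx
    exact T.hasFDerivAt.comp_hasDerivAt x (h1 hx)
  memLp := T.comp_memLp' h.memLp

theorem congr_right (h : ACPair F G) (hG : G =ᵐ[circleMeasure] G') : ACPair F G' where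
  ac := h.ac
  hasDeriv := by
    have h2 := (ae_restrict_iff' measurableSet_Ioc).1 hG
    have h3 : ∀ᵐ x : ℝ, x ≠ 0 := by simp [ae_iff]
    filter_upwards [h.hasDeriv, h2, h3] with x h1 h2 h3 hx
    rw [← h2]
    · exact h1 hx
    · rw [uIcc_of_le zero_le_one] at hx
      exact ⟨lt_of_le_of_ne hx.1 (Ne.symm h3), hx.2⟩
  memLp := h.memLp.ae_eq hG

theorem exp {F G : ℝ → ℝ} (h : ACPair F G) :
    ACPair (fun x => Real.exp (F x)) (fun x => G x * Real.exp (F x)) := by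
  obtain ⟨C, hC⟩ := h.exists_bound
  have hL : LipschitzOnWith (Real.toNNReal (Real.exp C)) Real.exp (Iic C) := by
    refine Convex.lipschitzOnWith_of_nnnorm_deriv_le (fun x _ => Real.differentiableAt_exp)
      (fun x hx => ?_) (convex_Iic C)
    rw [Real.deriv_exp, ← NNReal.coe_le_coe, coe_nnnorm, Real.norm_of_nonneg (Real.exp_pos _).le,
      Real.coe_toNNReal _ (Real.exp_pos _).le]
    exact Real.exp_le_exp.2 hx
  have hac : AbsolutelyContinuousOnInterval (fun x => Real.exp (F x)) 0 1 := by
    have h1 := h.ac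
    unfold AbsolutelyContinuousOnInterval at h1 ⊢
    have h2 := h1.const_mul (Real.exp C)
    rw [mul_zero] at h2
    refine squeeze_zero' (Filter.Eventually.of_forall fun _ => Finset.sum_nonneg
      fun _ _ => dist_nonneg) ?_ h2
    rw [Filter.eventually_inf_principal]
    filter_upwards with E hE
    rw [Finset.mul_sum]
    refine Finset.sum_le_sum fun i hi => ?_
    have a1 := hE.1 i hi
    rw [uIcc_of_le zero_le_one] at a1
    have := hL.dist_le_mul (F (E.2 i).1) ((le_abs_self _).trans (hC _ a1.1)) (F (E.2 i).2)
      ((le_abs_self _).trans (hC _ a1.2))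
    rwa [Real.coe_toNNReal _ (Real.exp_pos _).le] at this
  refine ⟨hac, ?_, ?_⟩
  · filter_upwards [h.hasDeriv] with x h1 hx
    have := (h1 hx).exp
    rwa [mul_comm] at this
  · have hc : ContinuousOn (fun x => Real.exp (F x)) (Icc 0 1) :=
      Real.continuous_exp.comp_continuousOn h.continuousOn
    obtain ⟨D, hD⟩ := isCompact_Icc.exists_bound_of_continuousOn hc
    have : MemLp (fun x => Real.exp (F x)) ⊤ circleMeasure := by
      refine memLp_top_of_bound
        ((hc.mono Ioc_subset_Icc_self).aestronglyMeasurable measurableSet_Ioc) D ?_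
      filter_upwards [ae_restrict_mem measurableSet_Ioc] with x hx
      exact hD x (Ioc_subset_Icc_self hx)
    exact MemLp.mul' (p := 2) (q := ⊤) this h.memLp

end ACPair

theorem acPair_of_contDiff {φ : ℝ → ℝ} (hφ : ContDiff ℝ ∞ φ) : ACPair φ (deriv φ) where
  ac := (hφ.of_le (by simp)).contDiffOn.absolutelyContinuousOnInterval
  hasDeriv := Filter.Eventually.of_forall fun x _ =>
    ((hφ.differentiable (by simp)) x).hasDerivAt
  memLp := by
    have hc : Continuous (deriv φ) := hφ.continuous_deriv (by simp)
    obtain ⟨C, hC⟩ := (isCompact_Icc (a := (0 : ℝ)) (b := 1)).exists_bound_of_continuousOn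
      hc.continuousOn
    refine MemLp.of_bound hc.aestronglyMeasurable C ?_
    filter_upwards [ae_restrict_mem measurableSet_Ioc] with x hx
    exact hC x (Ioc_subset_Icc_self hx)

end ACPair

/-! ### The fundamental lemma of the calculus of variations on the circle -/

/-- Parseval's identity: an `L²` function orthogonal to `cos ((2πn + τ) x)` and `sin ((2πn + τ) x)`
for all `n ∈ ℤ` vanishes. For `τ = 0` these are the periodic trigonometric functions, for `τ = π`
the anti-periodic ones. -/
theorem ae_eq_zero_of_trig {g : ℝ → ℝ} (hg : MemLp g 2 circleMeasure) (τ : ℝ)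
    (hc : ∀ n : ℤ, ∫ x, Real.cos ((2 * Real.pi * n + τ) * x) * g x ∂circleMeasure = 0)
    (hs : ∀ n : ℤ, ∫ x, Real.sin ((2 * Real.pi * n + τ) * x) * g x ∂circleMeasure = 0) :
    g =ᵐ[circleMeasure] 0 := by
  have hgi : Integrable g circleMeasure := hg.integrable (by norm_num)
  -- The shift `τ` of the frequencies is absorbed into the unimodular factor `e`.
  set e : ℝ → ℂ := fun x => Complex.exp (-(τ * x : ℝ) * Complex.I) with he
  have hen : ∀ x, ‖e x‖ = 1 := fun x => by
    rw [he]; simp only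
    rw [show (-((τ * x : ℝ) : ℂ) * Complex.I) = ((-(τ * x) : ℝ) : ℂ) * Complex.I by push_cast; ring]
    exact Complex.norm_exp_ofReal_mul_I _
  have hec : Continuous e := by rw [he]; fun_prop
  set f : ℝ → ℂ := fun x => e x * (g x : ℂ) with hf
  have hfn : ∀ x, ‖f x‖ = ‖g x‖ := fun x => by
    rw [hf]; simp only; rw [norm_mul, hen, one_mul, Complex.norm_real]
  have hfL : MemLp f 2 circleMeasure := by
    refine hg.of_le (hec.aestronglyMeasurable.mul
      (Complex.continuous_ofReal.comp_aestronglyMeasurable hg.1)) ?_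
    exact Filter.Eventually.of_forall fun x => (hfn x).le
  have hsum := hasSum_sq_fourierCoeffOn (a := 0) (b := 1) zero_lt_one hfL
  have hz : ∀ n : ℤ, fourierCoeffOn (zero_lt_one (α := ℝ)) f n = 0 := by
    intro n
    rw [fourierCoeffOn_eq_integral, intervalIntegral.integral_of_le zero_le_one]
    have key : ∀ x : ℝ, fourier (-n) (x : AddCircle ((1 : ℝ) - 0)) • f x
        = ((Real.cos ((2 * Real.pi * n + τ) * x) * g x : ℝ) : ℂ)
          - ((Real.sin ((2 * Real.pi * n + τ) * x) * g x : ℝ) : ℂ) * Complex.I := by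
      intro x
      rw [fourier_coe_apply, hf, he]
      simp only [smul_eq_mul]
      rw [← mul_assoc, ← Complex.exp_add]
      have : 2 * (Real.pi : ℂ) * Complex.I * ((-n : ℤ) : ℂ) * (x : ℂ) / ((1 - 0 : ℝ) : ℂ)
          + -((τ * x : ℝ) : ℂ) * Complex.I
          = ((-((2 * Real.pi * n + τ) * x) : ℝ) : ℂ) * Complex.I := by
        push_cast; ring
      rw [this, Complex.exp_mul_I, ← Complex.ofReal_cos, ← Complex.ofReal_sin, Real.cos_neg,
        Real.sin_neg]
      push_cast; ring
    have i1 : Integrable (fun x => Real.cos ((2 * Real.pi * n + τ) * x) * g x) circleMeasure :=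
      hgi.bdd_mul (c := 1) (by fun_prop)
        (Filter.Eventually.of_forall fun x => by simpa using Real.abs_cos_le_one _)
    have i2 : Integrable (fun x => Real.sin ((2 * Real.pi * n + τ) * x) * g x) circleMeasure :=
      hgi.bdd_mul (c := 1) (by fun_prop)
        (Filter.Eventually.of_forall fun x => by simpa using Real.abs_sin_le_one _)
    simp_rw [key]
    rw [integral_sub i1.ofReal (i2.ofReal.mul_const _), integral_mul_const,
      integral_complex_ofReal, integral_complex_ofReal, hc n, hs n]
    simp
  simp only [hz, norm_zero, ne_eq, OfNat.ofNat_ne_zero, not_false_eq_true, zero_pow] at hsum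
  have h0 : (0 : ℝ) = (1 - 0 : ℝ)⁻¹ • ∫ x in (0 : ℝ)..1, ‖f x‖ ^ 2 :=
    HasSum.unique hasSum_zero hsum
  rw [intervalIntegral.integral_of_le zero_le_one] at h0
  simp only [hfn, sub_zero, inv_one, one_smul] at h0
  have hi : Integrable (fun x => ‖g x‖ ^ 2) circleMeasure := hg.integrable_norm_pow (by norm_num)
  have := (integral_eq_zero_iff_of_nonneg (fun x => by positivity) hi).1 h0.symm
  filter_upwards [this] with x hx
  simpa using hx

/-- A real function whose weak derivative (with periodic, `σ = 1`, or anti-periodic, `σ = -1`,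
boundary conditions) vanishes is constant, and the constant is compatible with the boundary
conditions. -/
theorem ae_const_of_weakDeriv_zero {σ : ℝ} (hσ : σ = 1 ∨ σ = -1) {f : ℝ → ℝ}
    (hf : MemLp f 2 circleMeasure)
    (h : ∀ φ : ℝ → ℝ, ContDiff ℝ ∞ φ → (∀ x, φ (x + 1) = σ * φ x) →
      ∫ x, deriv φ x * f x ∂circleMeasure = 0) :
    ∃ c : ℝ, c = σ * c ∧ f =ᵐ[circleMeasure] fun _ => c := by
  have hfi : Integrable f circleMeasure := hf.integrable (by norm_num)
  have trig : ∀ k : ℝ, k ≠ 0 → Real.cos k = σ → Real.sin k = 0 →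
      ∫ x, Real.cos (k * x) * f x ∂circleMeasure = 0 ∧
      ∫ x, Real.sin (k * x) * f x ∂circleMeasure = 0 := by
    intro k hk c1 s1
    have d1 : ∀ x, HasDerivAt (fun x => Real.sin (k * x) / k) (Real.cos (k * x)) x := fun x => by
      have := ((Real.hasDerivAt_sin (k * x)).comp x ((hasDerivAt_id x).const_mul k)).div_const k
      refine this.congr_deriv ?_
      field_simp
    have d2 : ∀ x, HasDerivAt (fun x => -(Real.cos (k * x) / k)) (Real.sin (k * x)) x := fun x => by
      have := (((Real.hasDerivAt_cos (k * x)).comp x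
        ((hasDerivAt_id x).const_mul k)).div_const k).neg
      refine this.congr_deriv ?_
      field_simp
    refine ⟨?_, ?_⟩
    · have := h (fun x => Real.sin (k * x) / k) (by fun_prop) (fun x => by
        rw [mul_add, mul_one, Real.sin_add, c1, s1]; ring)
      simpa only [(d1 _).deriv] using this
    · have := h (fun x => -(Real.cos (k * x) / k)) (by fun_prop) (fun x => by
        rw [mul_add, mul_one, Real.cos_add, c1, s1]; ring)
      simpa only [(d2 _).deriv] using this
  -- `f` is tested against the antiderivatives of the trigonometric functions; in the periodic case
  -- the frequency zero has none, and it is removed by subtracting the mean value `c`.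
  rcases hσ with rfl | rfl
  · refine ⟨∫ x, f x ∂circleMeasure, by ring, ?_⟩
    set c := ∫ x, f x ∂circleMeasure with hcdef
    have hconst : ∀ k : ℝ, k ≠ 0 → Real.cos k = 1 → Real.sin k = 0 →
        ∫ x, Real.cos (k * x) ∂circleMeasure = 0 ∧
        ∫ x, Real.sin (k * x) ∂circleMeasure = 0 := by
      intro k hk c1 s1
      rw [← intervalIntegral.integral_of_le zero_le_one,
        ← intervalIntegral.integral_of_le zero_le_one,
        intervalIntegral.integral_comp_mul_left _ hk, intervalIntegral.integral_comp_mul_left _ hk,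
        integral_cos, integral_sin]
      simp [c1, s1]
    have hg : MemLp (fun x => f x - c) 2 circleMeasure := hf.sub (memLp_const c)
    have split : ∀ w : ℝ → ℝ, Continuous w → (∀ x, |w x| ≤ 1) →
        ∫ x, w x * (f x - c) ∂circleMeasure
          = ∫ x, w x * f x ∂circleMeasure - (∫ x, w x ∂circleMeasure) * c := by
      intro w hw hb
      have hwi : Integrable w circleMeasure :=
        (integrable_const (1 : ℝ)).mono' hw.aestronglyMeasurable
          (Filter.Eventually.of_forall hb)
      have hwf : Integrable (fun x => w x * f x) circleMeasure :=
        hfi.bdd_mul (c := 1) hw.aestronglyMeasurable (Filter.Eventually.of_forall hb)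
      simp only [mul_sub]
      rw [integral_sub hwf (hwi.mul_const c), integral_mul_const]
    have := ae_eq_zero_of_trig hg 0 (fun n => ?_) (fun n => ?_)
    · filter_upwards [this] with x hx
      have : f x - c = 0 := hx
      linarith
    all_goals
      rw [split _ (by fun_prop) (fun x => by
        first | exact Real.abs_cos_le_one _ | exact Real.abs_sin_le_one _)]
      rcases eq_or_ne n 0 with rfl | hn
      · simp [hcdef]
      · have hk : 2 * Real.pi * (n : ℝ) + 0 ≠ 0 := by
          rw [add_zero]
          exact mul_ne_zero (by positivity) (by exact_mod_cast hn)
        have c1 : Real.cos (2 * Real.pi * (n : ℝ) + 0) = 1 := by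
          rw [add_zero, mul_comm]; exact Real.cos_int_mul_two_pi n
        have s1 : Real.sin (2 * Real.pi * (n : ℝ) + 0) = 0 := by
          have := Real.sin_int_mul_pi (2 * n)
          refine Eq.trans ?_ this; congr 1; push_cast; ring
        first
          | rw [(trig _ hk c1 s1).1, (hconst _ hk c1 s1).1]; ring
          | rw [(trig _ hk c1 s1).2, (hconst _ hk c1 s1).2]; ring
  · refine ⟨0, by ring, ?_⟩
    have hk : ∀ n : ℤ, 2 * Real.pi * (n : ℝ) + Real.pi ≠ 0 := fun n => by
      have : (2 * n + 1 : ℤ) ≠ 0 := by omega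
      have h2 : ((2 * n + 1 : ℤ) : ℝ) * Real.pi ≠ 0 :=
        mul_ne_zero (by exact_mod_cast this) Real.pi_ne_zero
      intro h3; apply h2; rw [← h3]; push_cast; ring
    have c1 : ∀ n : ℤ, Real.cos (2 * Real.pi * (n : ℝ) + Real.pi) = -1 := fun n => by
      rw [Real.cos_add_pi, mul_comm, Real.cos_int_mul_two_pi n]
    have s1 : ∀ n : ℤ, Real.sin (2 * Real.pi * (n : ℝ) + Real.pi) = 0 := fun n => by
      have := Real.sin_int_mul_pi (2 * n + 1)
      refine Eq.trans ?_ this; congr 1; push_cast; ring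
    exact ae_eq_zero_of_trig hf Real.pi (fun n => (trig _ (hk n) (c1 n) (s1 n)).1)
      (fun n => (trig _ (hk n) (c1 n) (s1 n)).2)

/-! ### Weak derivatives and absolutely continuous representatives -/

/-- `F` is absolutely continuous on `[0, 1]` with derivative `G ∈ L²` and satisfies the periodic
(`σ = 1`) or anti-periodic (`σ = -1`) boundary condition. -/
structure PerAC {𝕜 : Type} [RCLike 𝕜] (σ : ℝ) (F G : ℝ → 𝕜) : Prop extends ACPair F G where
  bdry : F 1 = σ • F 0

instance : IsProbabilityMeasure circleMeasure := ⟨by simp⟩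

section PerAC

variable {𝕜 : Type} [RCLike 𝕜] {σ τ : ℝ} {F G F' G' : ℝ → 𝕜}

namespace PerAC

theorem mul (h : PerAC σ F G) (h' : PerAC τ F' G') :
    PerAC (σ * τ) (fun x => F x * F' x) (fun x => G x * F' x + F x * G' x) where
  toACPair := h.toACPair.mul h'.toACPair
  bdry := by
    simp only [h.bdry, h'.bdry]
    rw [smul_mul_smul_comm]

theorem add (h : PerAC σ F G) (h' : PerAC σ F' G') :
    PerAC σ (fun x => F x + F' x) (fun x => G x + G' x) where
  toACPair := h.toACPair.add h'.toACPair
  bdry := by rw [h.bdry, h'.bdry, smul_add]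

theorem const_smul (h : PerAC σ F G) (c : ℝ) :
    PerAC σ (fun x => c • F x) (fun x => c • G x) where
  toACPair := h.toACPair.const_smul c
  bdry := by rw [h.bdry, smul_comm]

theorem clm {𝕜' : Type} [RCLike 𝕜'] (h : PerAC σ F G) (T : 𝕜 →L[ℝ] 𝕜') :
    PerAC σ (fun x => T (F x)) (fun x => T (G x)) where
  toACPair := h.toACPair.clm T
  bdry := by rw [h.bdry, map_smul]

theorem congr_right (h : PerAC σ F G) (hG : G =ᵐ[circleMeasure] G') : PerAC σ F G' where
  toACPair := h.toACPair.congr_right hG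
  bdry := h.bdry

theorem exp {F G : ℝ → ℝ} (h : PerAC 1 F G) :
    PerAC 1 (fun x => Real.exp (F x)) (fun x => G x * Real.exp (F x)) where
  toACPair := h.toACPair.exp
  bdry := by rw [h.bdry, one_smul, one_smul]

theorem of_eq (h : PerAC σ F G) (e : σ = τ) : PerAC τ F G := e ▸ h

theorem integral_eq_zero (h : PerAC 1 F G) : ∫ x, G x ∂circleMeasure = 0 := by
  rw [h.toACPair.integral_eq_sub, h.bdry, one_smul, sub_self]

theorem const (c : 𝕜) (hc : c = σ • c) : PerAC σ (fun _ => c) (fun _ => 0) where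
  ac := contDiffOn_const.absolutelyContinuousOnInterval
  hasDeriv := Filter.Eventually.of_forall fun x _ => hasDerivAt_const x c
  memLp := memLp_const 0
  bdry := hc

theorem isWeakDeriv (h : PerAC σ F G) (hσ : σ * σ = 1) {f g : L2 𝕜}
    (hf : f =ᵐ[circleMeasure] F) (hg : g =ᵐ[circleMeasure] G) : IsWeakDeriv σ f g := by
  intro φ hφ hp
  have hφ' : PerAC σ φ (deriv φ) :=
    ⟨acPair_of_contDiff hφ, by have := hp 0; rwa [zero_add] at this⟩
  have key := (((hφ'.clm (𝕜' := 𝕜) RCLike.ofRealCLM).mul h).of_eq hσ).integral_eq_zero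
  have e1 : ∫ x, deriv φ x • f x ∂circleMeasure = ∫ x, deriv φ x • F x ∂circleMeasure := by
    apply integral_congr_ae
    filter_upwards [hf] with x hx
    rw [hx]
  have e2 : ∫ x, φ x • g x ∂circleMeasure = ∫ x, φ x • G x ∂circleMeasure := by
    apply integral_congr_ae
    filter_upwards [hg] with x hx
    rw [hx]
  have i1 : Integrable (fun x => deriv φ x • F x) circleMeasure := by
    refine (integrable_smul (hφ.continuous_deriv (by simp)) f).congr ?_
    filter_upwards [hf] with x hx
    rw [hx]
  have i2 : Integrable (fun x => φ x • G x) circleMeasure := by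
    refine (integrable_smul hφ.continuous g).congr ?_
    filter_upwards [hg] with x hx
    rw [hx]
  rw [e1, e2, eq_neg_iff_add_eq_zero, ← integral_add i1 i2]
  rw [← key]
  simp only [RCLike.ofRealCLM_apply, RCLike.real_smul_eq_coe_mul]

end PerAC

theorem sigma_sq (hσ : σ = 1 ∨ σ = -1) : σ * σ = 1 := by rcases hσ with rfl | rfl <;> norm_num

/-- Antiderivatives with the prescribed boundary conditions. In the anti-periodic case the constant
of integration is determined by the boundary condition. -/
theorem exists_perAC (hσ : σ = 1 ∨ σ = -1) (hG : MemLp G 2 circleMeasure)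
    (h1 : σ = 1 → ∫ x, G x ∂circleMeasure = 0) : ∃ F, PerAC σ F G := by
  rcases hσ with rfl | rfl
  · refine ⟨_, acPair_primitive hG 0, ?_⟩
    rw [intervalIntegral.integral_of_le zero_le_one]
    rw [h1 rfl]; simp
  · refine ⟨_, acPair_primitive hG (-((1 / 2 : ℝ) • ∫ x in (0 : ℝ)..1, G x)), ?_⟩
    simp only [intervalIntegral.integral_same, add_zero]
    module

theorem IsWeakDeriv.integral_eq_zero {f g : L2 𝕜} (h : IsWeakDeriv 1 f g) :
    ∫ x, g x ∂circleMeasure = 0 := by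
  have := h (fun _ => 1) contDiff_const (fun x => by ring)
  simpa using this

/-- A function with weak derivative zero is a constant compatible with the boundary conditions. -/
theorem IsWeakDeriv.ae_const (hσ : σ = 1 ∨ σ = -1) {f : L2 𝕜} (h : IsWeakDeriv σ f 0) :
    ∃ c : 𝕜, c = σ • c ∧ f =ᵐ[circleMeasure] fun _ => c := by
  have hz : ∀ φ : ℝ → ℝ, ContDiff ℝ ∞ φ → (∀ x, φ (x + 1) = σ * φ x) →
      ∫ x, deriv φ x • f x ∂circleMeasure = 0 := by
    intro φ hφ hp
    rw [h φ hφ hp, neg_eq_zero, integral_eq_zero_of_ae]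
    filter_upwards [Lp.coeFn_zero 𝕜 2 circleMeasure] with x hx
    rw [hx]; simp
  have hT : ∀ T : 𝕜 →L[ℝ] ℝ, ∃ c : ℝ, c = σ * c ∧ (fun x => T (f x)) =ᵐ[circleMeasure] fun _ => c := by
    intro T
    refine ae_const_of_weakDeriv_zero hσ (T.comp_memLp' (Lp.memLp f)) fun φ hφ hp => ?_
    have e := T.integral_comp_comm (integrable_smul (hφ.continuous_deriv (by simp)) f)
    rw [hz φ hφ hp, map_zero] at e
    simpa only [map_smul, smul_eq_mul] using e
  obtain ⟨a, ha, ha'⟩ := hT RCLike.reCLM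
  obtain ⟨b, hb, hb'⟩ := hT RCLike.imCLM
  refine ⟨(a : 𝕜) + (b : 𝕜) * RCLike.I, ?_, ?_⟩
  · rw [RCLike.real_smul_eq_coe_mul]
    conv_lhs => rw [ha, hb]
    push_cast; ring
  · filter_upwards [ha', hb'] with x h1 h2
    simp only [RCLike.reCLM_apply, RCLike.imCLM_apply] at h1 h2
    rw [← h1, ← h2, RCLike.re_add_im]

/-- Functions with a weak derivative in `L²` are, almost everywhere, equal to absolutely continuous
functions satisfying the boundary conditions. -/
theorem IsWeakDeriv.exists_perAC (hσ : σ = 1 ∨ σ = -1) {f g : L2 𝕜} (h : IsWeakDeriv σ f g) :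
    ∃ F, PerAC σ F g ∧ f =ᵐ[circleMeasure] F := by
  obtain ⟨F, hF⟩ := SinhGordon.exists_perAC hσ (Lp.memLp g) (by
    rintro rfl; exact h.integral_eq_zero)
  have hFL := hF.memLp_fun
  have hw : IsWeakDeriv σ (hFL.toLp F) g :=
    hF.isWeakDeriv (sigma_sq hσ) hFL.coeFn_toLp Filter.EventuallyEq.rfl
  have hd : IsWeakDeriv σ (f - hFL.toLp F) 0 := by
    have := h.add (hw.smul (-1))
    simpa [sub_eq_add_neg] using this
  obtain ⟨c, hc, hc'⟩ := hd.ae_const hσ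
  refine ⟨fun x => F x + c, ?_, ?_⟩
  · have := hF.add (PerAC.const c hc)
    simpa using this
  · filter_upwards [hc', Lp.coeFn_sub f (hFL.toLp F), hFL.coeFn_toLp] with x h1 h2 h3
    rw [h2, Pi.sub_apply, h3] at h1
    rw [← h1]; ring

theorem IsWeakDeriv.unique (hσ : σ = 1 ∨ σ = -1) {f g g' : L2 𝕜} (h : IsWeakDeriv σ f g)
    (h' : IsWeakDeriv σ f g') : g = g' := by
  obtain ⟨F, hF, hF'⟩ := h.exists_perAC hσ
  obtain ⟨K, hK, hK'⟩ := h'.exists_perAC hσ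
  have e : EqOn F K (Icc 0 1) :=
    Measure.eqOn_Icc_of_ae_eq volume (zero_ne_one)
      (by rw [← Measure.restrict_congr_set Ioc_ae_eq_Icc]; exact hF'.symm.trans hK')
      hF.continuousOn hK.continuousOn
  apply Lp.ext
  have hio : (Ioo (0 : ℝ) 1 : Set ℝ) =ᵐ[volume] Ioc 0 1 := Ioo_ae_eq_Ioc
  have hm : circleMeasure = volume.restrict (Ioo (0 : ℝ) 1) := (Measure.restrict_congr_set hio).symm
  have hIoo : ∀ᵐ x ∂circleMeasure, x ∈ Ioo (0 : ℝ) 1 := by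
    rw [hm]; exact ae_restrict_mem measurableSet_Ioo
  filter_upwards [hIoo, ae_restrict_of_ae hF.hasDeriv, ae_restrict_of_ae hK.hasDeriv] with x hx h1 h2
  have hx' : x ∈ uIcc (0 : ℝ) 1 := by
    rw [uIcc_of_le zero_le_one]; exact Ioo_subset_Icc_self hx
  refine (h1 hx').unique ((h2 hx').congr_of_eventuallyEq ?_)
  filter_upwards [Ioo_mem_nhds hx.1 hx.2] with y hy
  exact e (Ioo_subset_Icc_self hy)

theorem L2_integral_norm_le (f : L2 𝕜) : ∫ x, ‖f x‖ ∂circleMeasure ≤ ‖f‖ := by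
  have h1 : (eLpNorm f 1 circleMeasure).toReal = ∫ x, ‖f x‖ ∂circleMeasure := by
    rw [eLpNorm_one_eq_lintegral_enorm, ← integral_norm_eq_lintegral_enorm (Lp.aestronglyMeasurable f)]
  rw [← h1, Lp.norm_def]
  refine ENNReal.toReal_mono (Lp.eLpNorm_ne_top f) ?_
  exact eLpNorm_le_eLpNorm_of_exponent_le (by norm_num) (Lp.aestronglyMeasurable f)

/-- The Sobolev inequality `H¹ ⊂ L^∞` in one dimension. -/
theorem ACPair.norm_le (h : ACPair F G) {f g : L2 𝕜} (hf : f =ᵐ[circleMeasure] F)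
    (hg : g =ᵐ[circleMeasure] G) {x : ℝ} (hx : x ∈ Icc (0 : ℝ) 1) : ‖F x‖ ≤ ‖f‖ + ‖g‖ := by
  have hGi := intervalIntegrable_of_memLp h.memLp
  have hnG : ∫ y, ‖G y‖ ∂circleMeasure ≤ ‖g‖ := by
    refine le_trans (le_of_eq ?_) (L2_integral_norm_le g)
    apply integral_congr_ae
    filter_upwards [hg] with y hy
    rw [hy]
  have key : ∀ y ∈ Icc (0 : ℝ) 1, ‖F x‖ ≤ ‖F y‖ + ‖g‖ := by
    intro y hy
    have h0 : (0 : ℝ) ∈ uIcc (0 : ℝ) 1 := by simp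
    have hxu : x ∈ uIcc (0 : ℝ) 1 := by rwa [uIcc_of_le zero_le_one]
    have hyu : y ∈ uIcc (0 : ℝ) 1 := by rwa [uIcc_of_le zero_le_one]
    have e : F x - F y = ∫ z in y..x, G z := by
      rw [← intervalIntegral.integral_interval_sub_left
        (hGi.mono_set (uIcc_subset_uIcc h0 hxu)) (hGi.mono_set (uIcc_subset_uIcc h0 hyu)),
        h.integral_eq hx, h.integral_eq hy]
      ring
    have e2 : ‖∫ z in y..x, G z‖ ≤ ∫ z, ‖G z‖ ∂circleMeasure := by
      refine intervalIntegral.norm_integral_le_integral_norm_uIoc.trans ?_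
      refine setIntegral_mono_set (intervalIntegrable_iff_integrableOn_Ioc_of_le zero_le_one |>.1
        hGi.norm) (Filter.Eventually.of_forall fun _ => norm_nonneg _) ?_
      refine LE.le.eventuallyLE (show uIoc y x ≤ Ioc 0 1 from fun z hz => ?_)
      rw [mem_uIoc] at hz
      rcases hz with hz | hz
      · exact ⟨hy.1.trans_lt hz.1, hz.2.trans hx.2⟩
      · exact ⟨hx.1.trans_lt hz.1, hz.2.trans hy.2⟩
    have : F x = F y + (F x - F y) := by ring
    rw [this]
    refine (norm_add_le _ _).trans ?_
    rw [e]
    linarith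
  have hFi : Integrable F circleMeasure := h.memLp_fun.integrable (by norm_num)
  have hint : ∫ _y, ‖F x‖ ∂circleMeasure ≤ ∫ y, (‖F y‖ + ‖g‖) ∂circleMeasure := by
    refine integral_mono_ae (integrable_const _) (hFi.norm.add (integrable_const _)) ?_
    filter_upwards [ae_restrict_mem measurableSet_Ioc] with y hy
    exact key y (Ioc_subset_Icc_self hy)
  rw [integral_add hFi.norm (integrable_const _)] at hint
  have hnF : ∫ y, ‖F y‖ ∂circleMeasure ≤ ‖f‖ := by
    refine le_trans (le_of_eq ?_) (L2_integral_norm_le f)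
    apply integral_congr_ae
    filter_upwards [hf] with y hy
    rw [hy]
  simp at hint
  linarith

theorem continuous_integral_smul {w : ℝ → ℝ} (hw : Continuous w) :
    Continuous fun f : L2 𝕜 => ∫ x, w x • f x ∂circleMeasure := by
  obtain ⟨C, hC⟩ := (isCompact_Icc (a := (0 : ℝ)) (b := 1)).exists_bound_of_continuousOn
    hw.continuousOn
  have hC0 : 0 ≤ C := (norm_nonneg _).trans (hC 0 (by simp))
  refine (LipschitzWith.of_dist_le_mul (K := Real.toNNReal C) fun f g => ?_).continuous
  rw [Real.coe_toNNReal _ hC0, dist_eq_norm, dist_eq_norm,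
    ← integral_sub (integrable_smul hw f) (integrable_smul hw g)]
  refine (norm_integral_le_integral_norm _).trans ?_
  refine le_trans ?_ (mul_le_mul_of_nonneg_left (L2_integral_norm_le (f - g)) hC0)
  rw [← integral_const_mul]
  refine integral_mono_ae ((integrable_smul hw f).sub (integrable_smul hw g)).norm
    ((integrable_of_L2 (f - g)).norm.const_mul C) ?_
  filter_upwards [ae_restrict_mem measurableSet_Ioc, Lp.coeFn_sub f g] with x hx h2
  rw [h2, Pi.sub_apply, ← smul_sub, norm_smul]
  exact mul_le_mul_of_nonneg_right (hC x (Ioc_subset_Icc_self hx)) (norm_nonneg _)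

end PerAC

theorem ACPair.congr_left {𝕜 : Type} [RCLike 𝕜] {F K G : ℝ → 𝕜} (h : ACPair F G)
    (e : EqOn F K (Icc 0 1)) : ACPair K G where
  ac := by
    have h1 := h.ac
    unfold AbsolutelyContinuousOnInterval at h1 ⊢
    refine h1.congr' ?_
    rw [Filter.EventuallyEq, Filter.eventually_inf_principal]
    filter_upwards with E hE
    refine Finset.sum_congr rfl fun i hi => ?_
    have a1 := hE.1 i hi
    rw [uIcc_of_le zero_le_one] at a1
    rw [e a1.1, e a1.2]
  hasDeriv := by
    have h0 : ∀ᵐ x : ℝ, x ≠ 0 := by simp [ae_iff]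
    have h1 : ∀ᵐ x : ℝ, x ≠ 1 := by simp [ae_iff]
    filter_upwards [h.hasDeriv, h0, h1] with x hx h0 h1 hI
    refine (hx hI).congr_of_eventuallyEq ?_
    rw [uIcc_of_le zero_le_one] at hI
    filter_upwards [Ioo_mem_nhds (lt_of_le_of_ne hI.1 (Ne.symm h0)) (lt_of_le_of_ne hI.2 h1)]
      with y hy
    exact (e (Ioo_subset_Icc_self hy)).symm
  memLp := h.memLp

theorem PerAC.congr_left {𝕜 : Type} [RCLike 𝕜] {σ : ℝ} {F K G : ℝ → 𝕜} (h : PerAC σ F G)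
    (e : EqOn F K (Icc 0 1)) : PerAC σ K G where
  toACPair := h.toACPair.congr_left e
  bdry := by rw [← e (by simp), ← e (by simp)]; exact h.bdry

theorem eqOn_of_ae_eq {𝕜 : Type} [RCLike 𝕜] {F K : ℝ → 𝕜} (h : F =ᵐ[circleMeasure] K)
    (hF : ContinuousOn F (Icc 0 1)) (hK : ContinuousOn K (Icc 0 1)) : EqOn F K (Icc 0 1) :=
  Measure.eqOn_Icc_of_ae_eq volume (zero_ne_one)
    (by rw [← Measure.restrict_congr_set Ioc_ae_eq_Icc]; exact h) hF hK

/-! ### Elements of the Sobolev spaces and their derivatives -/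

theorem norm_toL2_le {m : ℕ} (u : H m) : ‖toL2 u‖ ≤ ‖u‖ :=
  PiLp.norm_apply_le (u : PiLp 2 (fun _ : Fin (m + 1) => L2 ℝ)) 0

/-- The derivative `∂ₓ : H^{m+1} → H^m` as a continuous linear map. -/
def dxL (m : ℕ) : H (m + 1) →L[ℝ] H m where
  toFun := dx
  map_add' _ _ := rfl
  map_smul' _ _ := rfl
  cont := by
    refine Continuous.subtype_mk ?_ _
    refine (PiLp.continuous_toLp 2 _).comp (continuous_pi fun i => ?_)
    exact (PiLp.proj (𝕜 := ℝ) 2 (fun _ : Fin (m + 1 + 1) => L2 ℝ) i.succ).continuous.comp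
      continuous_subtype_val

theorem dxL_apply {m : ℕ} (u : H (m + 1)) : dxL m u = dx u := rfl

theorem H_ext {m : ℕ} {u w : H (m + 1)} (h0 : toL2 u = toL2 w) (h1 : dx u = dx w) : u = w := by
  apply Subtype.ext
  apply PiLp.ext
  intro i
  refine Fin.cases h0 (fun j => ?_) i
  exact congrArg (fun z : H m => (z : PiLp 2 (fun _ : Fin (m + 1) => L2 ℝ)) j) h1

theorem H_zero_ext {u w : H 0} (h0 : toL2 u = toL2 w) : u = w := by
  apply Subtype.ext
  apply PiLp.ext
  intro i
  obtain rfl : i = 0 := Fin.ext (by omega)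
  exact h0

theorem isWeakDeriv_dx {m : ℕ} (u : H (m + 1)) : IsWeakDeriv 1 (toL2 u) (toL2 (dx u)) := u.2 0

/-- An element of `H^{m+1}` is given by an `L²` function and its weak derivative in `H^m`. -/
theorem exists_H_succ {m : ℕ} (f : L2 ℝ) (w : H m) (h : IsWeakDeriv 1 f (toL2 w)) :
    ∃ u : H (m + 1), toL2 u = f ∧ dx u = w :=
  ⟨⟨WithLp.toLp 2 (Fin.cons (α := fun _ => L2 ℝ) f
      (fun i => (w : PiLp 2 (fun _ : Fin (m + 1) => L2 ℝ)) i)), by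
      intro i
      refine Fin.cases ?_ (fun j => ?_) i
      · exact h
      · exact w.2 j⟩, rfl, rfl⟩

/-- An element of `H^m` is determined by its `L²` class. -/
theorem H_ext_toL2 {m : ℕ} {u w : H m} (h : toL2 u = toL2 w) : u = w := by
  induction m with
  | zero => exact H_zero_ext h
  | succ n ih =>
    refine H_ext h (ih ?_)
    refine IsWeakDeriv.unique (Or.inl rfl) (isWeakDeriv_dx u) ?_
    rw [h]; exact isWeakDeriv_dx w

theorem H_ext_fn {m : ℕ} {u w : H m} (h : fn u =ᵐ[circleMeasure] fn w) : u = w :=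
  H_ext_toL2 (Lp.ext h)

theorem fn_add {m : ℕ} (u w : H m) : fn (u + w) =ᵐ[circleMeasure] fun x => fn u x + fn w x :=
  Lp.coeFn_add (toL2 u) (toL2 w)

theorem fn_smul {m : ℕ} (c : ℝ) (u : H m) : fn (c • u) =ᵐ[circleMeasure] fun x => c * fn u x :=
  Lp.coeFn_smul c (toL2 u)

theorem fn_constH (m : ℕ) (c : ℝ) : fn (constH m c) =ᵐ[circleMeasure] fun _ => c :=
  Lp.coeFn_const (p := 2) (μ := circleMeasure) c

theorem constH_eq_smul (m : ℕ) (c : ℝ) : constH m c = c • constH m 1 := by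
  apply H_ext_fn
  filter_upwards [fn_constH m c, fn_constH m 1, fn_smul c (constH m 1)] with x h1 h2 h3
  rw [h1, h3, h2, mul_one]

/-- Constant functions, as a continuous linear map `ℝ → H^m`. -/
def constL (m : ℕ) : ℝ →L[ℝ] H m := ContinuousLinearMap.toSpanSingleton ℝ (constH m 1)

theorem constL_apply (m : ℕ) (c : ℝ) : constL m c = constH m c := by
  rw [constH_eq_smul]; rfl

theorem dx_constH (m : ℕ) (c : ℝ) : dx (constH (m + 1) c) = 0 := by
  apply H_ext_toL2
  rfl

theorem fn_memLp {m : ℕ} (u : H m) : MemLp (fn u) 2 circleMeasure := Lp.memLp _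

/-! ### The embedding of `H^{m+1}` into the bounded continuous functions -/

theorem exists_rep {m : ℕ} (u : H (m + 1)) :
    ∃ F, PerAC 1 F (fn (dx u)) ∧ fn u =ᵐ[circleMeasure] F :=
  (isWeakDeriv_dx u).exists_perAC (Or.inl rfl)

/-- The absolutely continuous representative of an element of `H^{m+1}`. -/
def rep {m : ℕ} (u : H (m + 1)) : ℝ → ℝ := (exists_rep u).choose

theorem perAC_rep {m : ℕ} (u : H (m + 1)) : PerAC 1 (rep u) (fn (dx u)) :=
  (exists_rep u).choose_spec.1

theorem fn_ae_rep {m : ℕ} (u : H (m + 1)) : fn u =ᵐ[circleMeasure] rep u :=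
  (exists_rep u).choose_spec.2

/-- Uniqueness of the continuous representative. -/
theorem rep_eq {m : ℕ} (u : H (m + 1)) {F : ℝ → ℝ} (hF : ContinuousOn F (Icc 0 1))
    (h : fn u =ᵐ[circleMeasure] F) {x : ℝ} (hx : x ∈ Icc (0 : ℝ) 1) : rep u x = F x :=
  eqOn_of_ae_eq ((fn_ae_rep u).symm.trans h) (perAC_rep u).continuousOn hF hx

theorem abs_rep_le {m : ℕ} (u : H (m + 1)) {x : ℝ} (hx : x ∈ Icc (0 : ℝ) 1) :
    ‖rep u x‖ ≤ ‖toL2 u‖ + ‖toL2 (dx u)‖ :=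
  (perAC_rep u).norm_le (fn_ae_rep u) Filter.EventuallyEq.rfl hx

theorem norm_dx_le {m : ℕ} (u : H (m + 1)) : ‖toL2 (dx u)‖ ≤ ‖u‖ :=
  PiLp.norm_apply_le (u : PiLp 2 (fun _ : Fin (m + 1 + 1) => L2 ℝ)) 1

theorem abs_rep_le' {m : ℕ} (u : H (m + 1)) {x : ℝ} (hx : x ∈ Icc (0 : ℝ) 1) :
    ‖rep u x‖ ≤ 2 * ‖u‖ := by
  have := abs_rep_le u hx
  have := norm_toL2_le u
  have := norm_dx_le u
  linarith

/-- The continuous representative of `u ∈ H^{m+1}` on `[0, 1]`, extended to the line by its values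
at the endpoints. -/
def evalFun {m : ℕ} (u : H (m + 1)) : ℝ →ᵇ ℝ :=
  BoundedContinuousFunction.ofNormedAddCommGroup
    (IccExtend (zero_le_one (α := ℝ)) (fun x : Icc (0 : ℝ) 1 => rep u x))
    (continuousOn_iff_continuous_domRestrict.1 (perAC_rep u).continuousOn).Icc_extend'
    (2 * ‖u‖) (fun x => abs_rep_le' u (projIcc (0 : ℝ) 1 zero_le_one x).2)

theorem evalFun_apply {m : ℕ} (u : H (m + 1)) (x : ℝ) :
    evalFun u x = rep u (projIcc (0 : ℝ) 1 zero_le_one x) := rfl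

theorem evalFun_of_mem {m : ℕ} (u : H (m + 1)) {x : ℝ} (hx : x ∈ Icc (0 : ℝ) 1) :
    evalFun u x = rep u x := by
  rw [evalFun_apply, projIcc_of_mem zero_le_one hx]

/-- The Sobolev embedding `H^{m+1} ⊂ C⁰`. -/
def evalC (m : ℕ) : H (m + 1) →L[ℝ] (ℝ →ᵇ ℝ) :=
  LinearMap.mkContinuous
    { toFun := evalFun
      map_add' := by
        intro u w
        ext x
        have hx := (projIcc (0 : ℝ) 1 zero_le_one x).2
        rw [BoundedContinuousFunction.add_apply, evalFun_apply, evalFun_apply, evalFun_apply]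
        refine rep_eq (F := fun y => rep u y + rep w y) _
          ((perAC_rep u).continuousOn.add (perAC_rep w).continuousOn) ?_ hx
        filter_upwards [fn_add u w, fn_ae_rep u, fn_ae_rep w] with y h1 h2 h3
        rw [h1, h2, h3]
      map_smul' := by
        intro c u
        ext x
        have hx := (projIcc (0 : ℝ) 1 zero_le_one x).2
        rw [BoundedContinuousFunction.smul_apply, evalFun_apply, evalFun_apply]
        refine rep_eq (F := fun y => c * rep u y) _
          (continuousOn_const.mul (perAC_rep u).continuousOn) ?_ hx
        filter_upwards [fn_smul c u, fn_ae_rep u] with y h1 h2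
        rw [h1, h2] }
    2 (fun u => (BoundedContinuousFunction.norm_le (by positivity)).2 fun x =>
      abs_rep_le' u (projIcc (0 : ℝ) 1 zero_le_one x).2)

theorem coe_evalC {m : ℕ} (u : H (m + 1)) : evalC m u = evalFun u := rfl

theorem evalC_apply_of_mem {m : ℕ} (u : H (m + 1)) {x : ℝ} (hx : x ∈ Icc (0 : ℝ) 1) :
    evalC m u x = rep u x := by
  rw [coe_evalC]; exact evalFun_of_mem u hx

theorem perAC_evalC {m : ℕ} (u : H (m + 1)) : PerAC 1 (evalC m u) (fn (dx u)) :=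
  (perAC_rep u).congr_left fun _ hx => (evalC_apply_of_mem u hx).symm

theorem fn_ae_evalC {m : ℕ} (u : H (m + 1)) : fn u =ᵐ[circleMeasure] evalC m u := by
  filter_upwards [fn_ae_rep u, ae_restrict_mem measurableSet_Ioc] with x h1 h2
  rw [h1, evalC_apply_of_mem u (Ioc_subset_Icc_self h2)]

theorem evalC_constH (m : ℕ) (c : ℝ) (x : ℝ) : evalC m (constH (m + 1) c) x = c := by
  rw [coe_evalC, evalFun_apply]
  exact rep_eq _ (F := fun _ => c) continuousOn_const (fn_constH _ c)
    (projIcc (0 : ℝ) 1 zero_le_one x).2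

/-! ### The mean-zero antiderivative as a continuous linear map -/

theorem dx_dxInv {m : ℕ} (v : H0 m) : dx (dxInv v : H (m + 1)) = (v : H m) := by
  apply H_ext_toL2; rfl

theorem dx_mem_H0 {m : ℕ} (u : H (m + 1)) : dx u ∈ H0 m :=
  (isWeakDeriv_dx u).integral_eq_zero

/-- The derivative as a continuous linear map into the functions of mean zero. -/
def dxL0 (m : ℕ) : H (m + 1) →L[ℝ] H0 m := (dxL m).codRestrict (H0 m) dx_mem_H0

theorem eq_const_of_dx_eq_zero {m : ℕ} {u : H (m + 1)} (h : dx u = 0) :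
    u = constH (m + 1) (∫ x, fn u x ∂circleMeasure) := by
  have hw := isWeakDeriv_dx u
  rw [h] at hw
  obtain ⟨c, -, hc⟩ := IsWeakDeriv.ae_const (Or.inl rfl) (f := toL2 u) hw
  have hc' : fn u =ᵐ[circleMeasure] fun _ => c := hc
  apply H_ext_fn
  rw [integral_congr_ae hc']
  refine hc'.trans ?_
  refine Filter.EventuallyEq.trans ?_ (fn_constH _ _).symm
  simp

theorem H0_ext_dx {m : ℕ} {u w : H0 (m + 1)} (h : dx (u : H (m + 1)) = dx (w : H (m + 1))) :
    u = w := by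
  have h1 : dx ((u - w : H0 (m + 1)) : H (m + 1)) = 0 := by
    rw [Submodule.coe_sub, ← dxL_apply, map_sub, dxL_apply, dxL_apply, h, sub_self]
  have h2 := eq_const_of_dx_eq_zero h1
  have h3 : ∫ x, fn ((u - w : H0 (m + 1)) : H (m + 1)) x ∂circleMeasure = 0 := (u - w).2
  rw [h3, constH_eq_smul, zero_smul] at h2
  exact sub_eq_zero.1 (Subtype.ext h2)

theorem abs_primFn_le (v : L2 ℝ) {x : ℝ} (hx : x ∈ Ioc (0 : ℝ) 1) : |primFn v x| ≤ 2 * ‖v‖ := by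
  have key : ∀ y ∈ Ioc (0 : ℝ) 1, ‖∫ z in (0 : ℝ)..y, v z‖ ≤ ‖v‖ := by
    intro y hy
    refine intervalIntegral.norm_integral_le_integral_norm_uIoc.trans ?_
    refine le_trans (setIntegral_mono_set (integrable_of_L2 v).norm
      (Filter.Eventually.of_forall fun _ => norm_nonneg _) ?_) (L2_integral_norm_le v)
    refine LE.le.eventuallyLE (show uIoc 0 y ≤ Ioc 0 1 from fun z hz => ?_)
    rw [uIoc_of_le hy.1.le] at hz
    exact ⟨hz.1, hz.2.trans hy.2⟩
  have h2 : ‖∫ s, (∫ y in (0 : ℝ)..s, v y) ∂circleMeasure‖ ≤ ‖v‖ := by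
    have := norm_integral_le_of_norm_le_const (μ := circleMeasure)
      (f := fun s => ∫ y in (0 : ℝ)..s, v y) (C := ‖v‖)
      (by filter_upwards [ae_restrict_mem measurableSet_Ioc] with y hy using key y hy)
    simpa using this
  have h1 := key x hx
  rw [Real.norm_eq_abs] at h1 h2
  unfold primFn
  refine (abs_sub _ _).trans ?_
  linarith

theorem norm_primFn_le (v : L2 ℝ) : ‖(memLp_primFn v).toLp (primFn v)‖ ≤ 2 * ‖v‖ := by
  have h := Lp.norm_le_of_ae_bound (μ := circleMeasure) (p := 2)
    (f := (memLp_primFn v).toLp (primFn v)) (C := 2 * ‖v‖) (by positivity) (by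
      filter_upwards [(memLp_primFn v).coeFn_toLp, ae_restrict_mem measurableSet_Ioc] with x h1 h2
      rw [h1]; exact abs_primFn_le v h2)
  have h1 : measureUnivNNReal circleMeasure = 1 := by simp [measureUnivNNReal]
  rwa [h1, NNReal.coe_one, Real.one_rpow, one_mul] at h

theorem dxInv_add {m : ℕ} (v w : H0 m) : dxInv (v + w) = dxInv v + dxInv w := by
  apply H0_ext_dx
  rw [dx_dxInv, Submodule.coe_add, Submodule.coe_add, ← dxL_apply, map_add, dxL_apply, dxL_apply,
    dx_dxInv, dx_dxInv]

theorem dxInv_smul {m : ℕ} (c : ℝ) (v : H0 m) : dxInv (c • v) = c • dxInv v := by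
  apply H0_ext_dx
  rw [dx_dxInv, Submodule.coe_smul, Submodule.coe_smul, ← dxL_apply, map_smul, dxL_apply, dx_dxInv]

/-- The mean-zero antiderivative as a continuous linear map. -/
def dxInvL (m : ℕ) : H0 m →L[ℝ] H0 (m + 1) where
  toFun := dxInv
  map_add' := dxInv_add
  map_smul' := dxInv_smul
  cont := by
    refine Continuous.subtype_mk (Continuous.subtype_mk ?_ _) _
    refine (PiLp.continuous_toLp 2 _).comp (continuous_pi fun i => ?_)
    refine Fin.cases ?_ (fun j => ?_) i
    · let T : H0 m →ₗ[ℝ] L2 ℝ :=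
        { toFun := fun v => toL2 (dxInv v : H (m + 1))
          map_add' := fun v w => by rw [dxInv_add]; rfl
          map_smul' := fun c v => by rw [dxInv_smul]; rfl }
      exact (T.mkContinuous 2 fun v => (norm_primFn_le _).trans
        (mul_le_mul_of_nonneg_left (norm_toL2_le (v : H m)) zero_le_two)).continuous
    · exact (PiLp.proj (𝕜 := ℝ) 2 (fun _ : Fin (m + 1) => L2 ℝ) j).continuous.comp
        (continuous_subtype_val.comp continuous_subtype_val)

/-! ### Hyperbolic functions on the Banach algebra of bounded continuous functions -/

theorem exp_apply_bcf (a : ℝ →ᵇ ℝ) (x : ℝ) : NormedSpace.exp a x = Real.exp (a x) := by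
  let ev : (ℝ →ᵇ ℝ) →+* ℝ :=
    { toFun := fun f => f x
      map_one' := rfl
      map_mul' := fun _ _ => rfl
      map_zero' := rfl
      map_add' := fun _ _ => rfl }
  have hc : Continuous ev := (BoundedContinuousFunction.evalCLM ℝ x).continuous
  have h := NormedSpace.map_exp_of_mem_ball (𝕂 := ℝ) ev hc a
    (by rw [NormedSpace.expSeries_radius_eq_top]; exact edist_lt_top _ _)
  rw [← Real.exp_eq_exp_ℝ] at h
  exact h

/-- The hyperbolic sine on bounded continuous functions. -/
def sinhC (a : ℝ →ᵇ ℝ) : ℝ →ᵇ ℝ := (1 / 2 : ℝ) • (NormedSpace.exp a - NormedSpace.exp (-a))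

/-- The hyperbolic cosine on bounded continuous functions. -/
def coshC (a : ℝ →ᵇ ℝ) : ℝ →ᵇ ℝ := (1 / 2 : ℝ) • (NormedSpace.exp a + NormedSpace.exp (-a))

theorem sinhC_apply (a : ℝ →ᵇ ℝ) (x : ℝ) : sinhC a x = Real.sinh (a x) := by
  rw [sinhC, BoundedContinuousFunction.smul_apply, BoundedContinuousFunction.sub_apply,
    exp_apply_bcf, exp_apply_bcf, BoundedContinuousFunction.neg_apply, Real.sinh_eq, smul_eq_mul]
  ring

theorem coshC_apply (a : ℝ →ᵇ ℝ) (x : ℝ) : coshC a x = Real.cosh (a x) := by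
  rw [coshC, BoundedContinuousFunction.smul_apply, BoundedContinuousFunction.add_apply,
    exp_apply_bcf, exp_apply_bcf, BoundedContinuousFunction.neg_apply, Real.cosh_eq, smul_eq_mul]
  ring

theorem analyticAt_exp_neg (a : ℝ →ᵇ ℝ) :
    AnalyticAt ℝ (fun b : ℝ →ᵇ ℝ => NormedSpace.exp (-b)) a :=
  (NormedSpace.exp_analytic (𝕂 := ℝ) (-a)).comp_of_eq analyticAt_id.neg rfl

theorem analyticAt_sinhC (a : ℝ →ᵇ ℝ) : AnalyticAt ℝ sinhC a :=
  (analyticAt_const (v := (1 / 2 : ℝ))).fun_smul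
    ((NormedSpace.exp_analytic (𝕂 := ℝ) a).fun_sub (analyticAt_exp_neg a))

theorem analyticAt_coshC (a : ℝ →ᵇ ℝ) : AnalyticAt ℝ coshC a :=
  (analyticAt_const (v := (1 / 2 : ℝ))).fun_smul
    ((NormedSpace.exp_analytic (𝕂 := ℝ) a).fun_add (analyticAt_exp_neg a))

theorem hasFDerivAt_exp_neg (a : ℝ →ᵇ ℝ) :
    HasFDerivAt (fun b : ℝ →ᵇ ℝ => NormedSpace.exp (-b))
      (-(NormedSpace.exp (-a) • (1 : (ℝ →ᵇ ℝ) →L[ℝ] (ℝ →ᵇ ℝ)))) a := by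
  have h := (hasFDerivAt_exp (𝕂 := ℝ) (x := -a)).comp a (hasFDerivAt_id (𝕜 := ℝ) a).fun_neg
  refine h.congr_fderiv ?_
  ext b x
  simp

theorem hasFDerivAt_sinhC (a : ℝ →ᵇ ℝ) :
    HasFDerivAt sinhC (coshC a • (1 : (ℝ →ᵇ ℝ) →L[ℝ] (ℝ →ᵇ ℝ))) a := by
  have h := ((hasFDerivAt_exp (𝕂 := ℝ) (x := a)).sub (hasFDerivAt_exp_neg a)).const_smul (1 / 2 : ℝ)
  refine h.congr_fderiv ?_
  ext b x
  simp [coshC]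
  ring

theorem hasFDerivAt_coshC (a : ℝ →ᵇ ℝ) :
    HasFDerivAt coshC (sinhC a • (1 : (ℝ →ᵇ ℝ) →L[ℝ] (ℝ →ᵇ ℝ))) a := by
  have h := ((hasFDerivAt_exp (𝕂 := ℝ) (x := a)).add (hasFDerivAt_exp_neg a)).const_smul (1 / 2 : ℝ)
  refine h.congr_fderiv ?_
  ext b x
  simp [sinhC]
  ring

theorem integrable_bcf (a : ℝ →ᵇ ℝ) : Integrable a circleMeasure := a.integrable _

/-- Integration over the circle as a continuous linear functional. -/
def integC : (ℝ →ᵇ ℝ) →L[ℝ] ℝ :=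
  LinearMap.mkContinuous
    { toFun := fun a => ∫ x, a x ∂circleMeasure
      map_add' := fun a b => integral_add (integrable_bcf a) (integrable_bcf b)
      map_smul' := fun c a => integral_const_mul c _ }
    1 (fun a => by
      have := norm_integral_le_of_norm_le_const (μ := circleMeasure) (f := a) (C := ‖a‖)
        (Filter.Eventually.of_forall a.norm_coe_le_norm)
      simpa using this)

theorem integC_apply (a : ℝ →ᵇ ℝ) : integC a = ∫ x, a x ∂circleMeasure := rfl

section

/-- Shortcut for instance search: the norm on `H^m`. -/
local instance instNormedAddCommGroupH (m : ℕ) : NormedAddCommGroup (H m) :=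
  Submodule.normedAddCommGroup _

/-- Shortcut for instance search: `H^m` as a real normed space. -/
local instance instNormedSpaceH (m : ℕ) : NormedSpace ℝ (H m) := Submodule.normedSpace _

/-! ### The algebra property of the Sobolev spaces -/

theorem exists_H_of_perAC {k : ℕ} {F G : ℝ → ℝ} (h : PerAC 1 F G) (w : H k)
    (hw : fn w =ᵐ[circleMeasure] G) : ∃ u : H (k + 1), fn u =ᵐ[circleMeasure] F ∧ dx u = w := by
  obtain ⟨u, h1, h2⟩ := exists_H_succ (h.memLp_fun.toLp F) w
    (h.isWeakDeriv (by norm_num) h.memLp_fun.coeFn_toLp hw)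
  refine ⟨u, ?_, h2⟩
  unfold fn
  rw [h1]
  exact h.memLp_fun.coeFn_toLp

/-- `H⁰ = L²`. -/
def ofL2 (f : L2 ℝ) : H 0 := ⟨WithLp.toLp 2 fun _ => f, fun i => i.elim0⟩

theorem fn_ofL2 (f : L2 ℝ) : fn (ofL2 f) = f := rfl

/-- The inclusion `H^{k+1} ⊂ H^k`. -/
theorem exists_H_restrict {k : ℕ} (u : H (k + 1)) :
    ∃ w : H k, fn w =ᵐ[circleMeasure] fn u := by
  induction k with
  | zero => exact ⟨ofL2 (toL2 u), Filter.EventuallyEq.rfl⟩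
  | succ n ih =>
    obtain ⟨w, hw⟩ := ih (dx u)
    obtain ⟨z, hz, -⟩ := exists_H_of_perAC (perAC_rep u) w hw
    exact ⟨z, hz.trans (fn_ae_rep u).symm⟩

/-- Induction step for products, by the Leibniz rule. -/
theorem exists_H_mul_aux {k : ℕ}
    (P : ∀ (f : H k) (g : H (k + 1)), ∃ w : H k, fn w =ᵐ[circleMeasure] fun x => fn f x * fn g x)
    (f g : H (k + 1)) : ∃ w : H (k + 1), fn w =ᵐ[circleMeasure] fun x => fn f x * fn g x := by
  obtain ⟨w1, h1⟩ := P (dx f) g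
  obtain ⟨w2, h2⟩ := P (dx g) f
  have hp := ((perAC_rep f).mul (perAC_rep g)).of_eq (one_mul 1)
  obtain ⟨z, hz, -⟩ := exists_H_of_perAC hp (w1 + w2) (by
    filter_upwards [fn_add w1 w2, h1, h2, fn_ae_rep f, fn_ae_rep g] with x a b c d e
    rw [a, b, c, d, e]; ring)
  refine ⟨z, hz.trans ?_⟩
  filter_upwards [fn_ae_rep f, fn_ae_rep g] with x d e
  rw [d, e]

/-- `H^k` is a module over `H^{k+1}`. -/
theorem exists_H_mul_succ (k : ℕ) :
    ∀ (f : H k) (g : H (k + 1)), ∃ w : H k, fn w =ᵐ[circleMeasure] fun x => fn f x * fn g x := by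
  induction k with
  | zero =>
    intro f g
    have hL : MemLp (fun x => fn f x * rep g x) 2 circleMeasure :=
      MemLp.mul' (p := 2) (q := ⊤) (perAC_rep g).memLp_top (fn_memLp f)
    refine ⟨ofL2 (hL.toLp _), ?_⟩
    filter_upwards [hL.coeFn_toLp, fn_ae_rep g] with x h1 h2
    rw [fn_ofL2, h1, h2]
  | succ n ih =>
    intro f g
    obtain ⟨g', hg'⟩ := exists_H_restrict g
    obtain ⟨w, hw⟩ := exists_H_mul_aux ih f g'
    refine ⟨w, hw.trans ?_⟩
    filter_upwards [hg'] with x hx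
    rw [hx]

/-- `H^{k+1}` is closed under products. -/
theorem exists_H_mul {k : ℕ} (f g : H (k + 1)) :
    ∃ w : H (k + 1), fn w =ᵐ[circleMeasure] fun x => fn f x * fn g x :=
  exists_H_mul_aux (exists_H_mul_succ k) f g

/-- `H^{k+1}` is closed under composition with the exponential. -/
theorem exists_H_exp {k : ℕ} (u : H (k + 1)) :
    ∃ w : H (k + 1), fn w =ᵐ[circleMeasure] fun x => Real.exp (fn u x) := by
  have hp := (perAC_rep u).exp
  have he : rep u =ᵐ[circleMeasure] fn u := (fn_ae_rep u).symm
  have fin : ∀ z : H k, (fn z =ᵐ[circleMeasure] fun x => fn (dx u) x * Real.exp (rep u x)) →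
      ∃ w : H (k + 1), fn w =ᵐ[circleMeasure] fun x => Real.exp (fn u x) := by
    intro z hz
    obtain ⟨w, hw, -⟩ := exists_H_of_perAC hp z hz
    refine ⟨w, hw.trans ?_⟩
    filter_upwards [he] with x hx
    rw [hx]
  induction k with
  | zero =>
    refine fin (ofL2 (hp.memLp.toLp _)) ?_
    rw [fn_ofL2]
    exact hp.memLp.coeFn_toLp
  | succ n ih =>
    obtain ⟨u', hu'⟩ := exists_H_restrict u
    obtain ⟨E, hE⟩ := ih u' (perAC_rep u').exp (fn_ae_rep u').symm (fun z hz => by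
      obtain ⟨w, hw, -⟩ := exists_H_of_perAC (perAC_rep u').exp z hz
      refine ⟨w, hw.trans ?_⟩
      filter_upwards [fn_ae_rep u'] with x hx
      rw [hx])
    obtain ⟨z, hz⟩ := exists_H_mul (dx u) E
    refine fin z ?_
    filter_upwards [hz, hE, hu', he] with x h1 h2 h3 h4
    rw [h1, h2, h3, h4]

theorem exists_H_sinh {k : ℕ} (u : H (k + 1)) (c : ℝ) :
    ∃ w : H (k + 1), fn w =ᵐ[circleMeasure] fun x => c * Real.sinh (fn u x) := by
  obtain ⟨p, hp⟩ := exists_H_exp u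
  obtain ⟨q, hq⟩ := exists_H_exp ((-1 : ℝ) • u)
  refine ⟨(c / 2) • (p + (-1 : ℝ) • q), ?_⟩
  filter_upwards [fn_smul (c / 2) (p + (-1 : ℝ) • q), fn_add p ((-1 : ℝ) • q), fn_smul (-1) q,
    fn_smul (-1) u, hp, hq] with x h1 h2 h3 h4 h5 h6
  rw [h1, h2, h3, h5, h6, h4, Real.sinh_eq, neg_one_mul (fn u x)]
  ring

/-! ### Integrals of hyperbolic functions -/

theorem integC_exp_pos (a : ℝ →ᵇ ℝ) : 0 < integC (NormedSpace.exp a) := by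
  rw [integC_apply]
  have hi := integrable_bcf (NormedSpace.exp a)
  have e : ⇑(NormedSpace.exp a) = fun x => Real.exp (a x) := funext (exp_apply_bcf a)
  rw [e] at hi ⊢
  exact integral_exp_pos hi

theorem integC_coshC (a : ℝ →ᵇ ℝ) :
    integC (coshC a) = (1 / 2) * (integC (NormedSpace.exp a) + integC (NormedSpace.exp (-a))) := by
  rw [coshC, map_smul, map_add, smul_eq_mul]

theorem integC_sinhC (a : ℝ →ᵇ ℝ) :
    integC (sinhC a) = (1 / 2) * (integC (NormedSpace.exp a) - integC (NormedSpace.exp (-a))) := by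
  rw [sinhC, map_smul, map_sub, smul_eq_mul]

theorem integC_coshC_pos (a : ℝ →ᵇ ℝ) : 0 < integC (coshC a) := by
  have h1 := integC_exp_pos a
  have h2 := integC_exp_pos (-a)
  rw [integC_coshC]; positivity

/-- The argument of `artanh` in the definition of `c_sh` is in the domain of `artanh`. -/
theorem ratio_mem_Ioo (a : ℝ →ᵇ ℝ) : integC (sinhC a) / integC (coshC a) ∈ Ioo (-1 : ℝ) 1 := by
  have h1 := integC_exp_pos a
  have h2 := integC_exp_pos (-a)
  have h3 := integC_coshC_pos a
  refine ⟨?_, ?_⟩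
  · rw [lt_div_iff₀ h3, integC_coshC, integC_sinhC]; linarith
  · rw [div_lt_iff₀ h3, integC_coshC, integC_sinhC]; linarith

theorem integral_sinh_add_const (a : ℝ →ᵇ ℝ) (c : ℝ) :
    ∫ x, Real.sinh (a x + c) ∂circleMeasure
      = Real.cosh c * integC (sinhC a) + Real.sinh c * integC (coshC a) := by
  rw [integC_apply, integC_apply, ← integral_const_mul, ← integral_const_mul, ← integral_add]
  · refine integral_congr_ae (Filter.Eventually.of_forall fun x => ?_)
    simp only [sinhC_apply, coshC_apply, Real.sinh_add]; ring
  · exact (integrable_bcf _).const_mul _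
  · exact (integrable_bcf _).const_mul _

/-! ### The constant `c_sh` and the map `Ψ` -/

/-- `v ↦ 2 ∂ₓ⁻¹ v`, with values in the continuous functions. -/
def twoInvC (m : ℕ) : H0 m →L[ℝ] (ℝ →ᵇ ℝ) :=
  (evalC m).comp ((2 : ℝ) • (H0 (m + 1)).subtypeL.comp (dxInvL m))

theorem twoInvC_apply {m : ℕ} (v : H0 m) :
    twoInvC m v = (2 : ℝ) • evalC m (dxInv v : H (m + 1)) := by
  change evalC m ((2 : ℝ) • (dxInv v : H (m + 1))) = _
  rw [map_smul]

theorem twoInvC_ae {m : ℕ} (v : H0 m) :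
    (fun x => 2 * fn0 (dxInv v) x) =ᵐ[circleMeasure] twoInvC m v := by
  filter_upwards [fn_ae_evalC (dxInv v : H (m + 1))] with x hx
  rw [twoInvC_apply, BoundedContinuousFunction.smul_apply, ← hx, smul_eq_mul, fn0]

theorem csh_eq {m : ℕ} (v : H0 m) :
    csh v = -Real.artanh (integC (sinhC (twoInvC m v)) / integC (coshC (twoInvC m v))) := by
  unfold csh
  rw [integC_apply, integC_apply]
  congr 3
  · apply integral_congr_ae
    filter_upwards [twoInvC_ae v] with x hx
    rw [hx, sinhC_apply]
  · apply integral_congr_ae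
    filter_upwards [twoInvC_ae v] with x hx
    rw [hx, coshC_apply]

theorem analyticAt_artanh {x : ℝ} (hx : x ∈ Ioo (-1 : ℝ) 1) : AnalyticAt ℝ Real.artanh x := by
  have h1 : AnalyticAt ℝ (fun y : ℝ => 1 / 2 * Real.log ((1 + y) / (1 - y))) x := by
    have hd : AnalyticAt ℝ (fun y : ℝ => (1 + y) / (1 - y)) x :=
      (analyticAt_const.add analyticAt_id).div (analyticAt_const.sub analyticAt_id)
        (by have := hx.2; change 1 - x ≠ 0; linarith)
    refine analyticAt_const.mul (hd.log ?_)
    exact div_pos (by linarith [hx.1]) (by linarith [hx.2])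
  refine h1.congr ?_
  filter_upwards [Ioo_mem_nhds hx.1 hx.2] with y hy
  rw [Real.artanh_eq_half_log (Ioo_subset_Icc_self hy)]

theorem analyticAt_csh {m : ℕ} (v : H0 m) : AnalyticAt ℝ (csh : H0 m → ℝ) v := by
  have e : (csh : H0 m → ℝ) = fun v => -Real.artanh
      (integC (sinhC (twoInvC m v)) / integC (coshC (twoInvC m v))) := funext csh_eq
  rw [e]
  have h1 : AnalyticAt ℝ (fun v : H0 m => integC (sinhC (twoInvC m v))) v :=
    (integC.analyticAt _).comp ((analyticAt_sinhC _).comp ((twoInvC m).analyticAt v))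
  have h2 : AnalyticAt ℝ (fun v : H0 m => integC (coshC (twoInvC m v))) v :=
    (integC.analyticAt _).comp ((analyticAt_coshC _).comp ((twoInvC m).analyticAt v))
  have h3 := h1.fun_div h2 (integC_coshC_pos _).ne'
  exact (AnalyticAt.comp_of_eq (analyticAt_artanh (ratio_mem_Ioo (twoInvC m v))) h3 rfl).fun_neg

theorem Psi_eq {m : ℕ} (v : H0 m) :
    Psi v = ((2 : ℝ) • (H0 (m + 1)).subtypeL.comp (dxInvL m)) v + constL (m + 1) (csh v) := by
  rw [constL_apply]; rfl

theorem analyticAt_Psi {m : ℕ} (v : H0 m) : AnalyticAt ℝ (Psi : H0 m → H (m + 1)) v := by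
  rw [show (Psi : H0 m → H (m + 1)) = fun v => _ + _ from funext Psi_eq]
  exact (((2 : ℝ) • (H0 (m + 1)).subtypeL.comp (dxInvL m)).analyticAt v).fun_add
    (((constL (m + 1)).analyticAt _).comp (analyticAt_csh v))

/-- The derivative of `Ψ`. -/
def PsiDeriv {m : ℕ} (v : H0 m) : H0 m →L[ℝ] H (m + 1) :=
  (2 : ℝ) • (H0 (m + 1)).subtypeL.comp (dxInvL m) + (constL (m + 1)).comp (fderiv ℝ csh v)

theorem hasFDerivAt_Psi {m : ℕ} (v : H0 m) : HasFDerivAt Psi (PsiDeriv v) v := by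
  rw [show (Psi : H0 m → H (m + 1)) = fun v => _ + _ from funext Psi_eq]
  exact ((2 : ℝ) • (H0 (m + 1)).subtypeL.comp (dxInvL m)).hasFDerivAt.fun_add
    ((constL (m + 1)).hasFDerivAt.comp v (analyticAt_csh v).differentiableAt.hasFDerivAt)

theorem PsiDeriv_apply {m : ℕ} (v h : H0 m) : PsiDeriv v h
    = (2 : ℝ) • (dxInv h : H (m + 1)) + constH (m + 1) (fderiv ℝ csh v h) := by
  rw [← constL_apply]; rfl

theorem continuous_fderiv_csh {m : ℕ} : Continuous (fderiv ℝ (csh : H0 m → ℝ)) := by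
  have h : ContDiff ℝ 1 (csh : H0 m → ℝ) :=
    contDiff_iff_contDiffAt.2 fun v => (analyticAt_csh v).contDiffAt
  exact h.continuous_fderiv (by simp)

theorem dx_two_dxInv_add {m : ℕ} (v : H0 m) (c : ℝ) :
    dx ((2 : ℝ) • (dxInv v : H (m + 1)) + constH (m + 1) c) = (2 : ℝ) • (v : H m) := by
  rw [← dxL_apply, map_add, map_smul, dxL_apply, dxL_apply, dx_dxInv, dx_constH, add_zero]

theorem dx_Psi {m : ℕ} (v : H0 m) : dx (Psi v) = (2 : ℝ) • (v : H m) := dx_two_dxInv_add v _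

theorem half_dxL0_Psi {m : ℕ} (v : H0 m) : ((1 / 2 : ℝ) • dxL0 m) (Psi v) = v := by
  apply Subtype.ext
  change (1 / 2 : ℝ) • dx (Psi v) = (v : H m)
  rw [dx_Psi, smul_smul]; norm_num

theorem evalC_Psi {m : ℕ} (v : H0 m) (x : ℝ) : evalC m (Psi v) x = twoInvC m v x + csh v := by
  rw [Psi, map_add, BoundedContinuousFunction.add_apply, evalC_constH, map_smul, twoInvC_apply]

theorem fn_Psi {m : ℕ} (v : H0 m) :
    fn (Psi v) =ᵐ[circleMeasure] fun x => 2 * fn0 (dxInv v) x + csh v := by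
  filter_upwards [fn_ae_evalC (Psi v), twoInvC_ae v] with x h1 h2
  rw [h1, evalC_Psi, ← h2]

theorem mem_Msinh_iff {m : ℕ} (u : H (m + 1)) :
    u ∈ Msinh (m + 1) ↔ integC (sinhC (evalC m u)) = 0 := by
  have e : (fun x => Real.sinh (fn u x)) =ᵐ[circleMeasure] sinhC (evalC m u) := by
    filter_upwards [fn_ae_evalC u] with x hx
    rw [hx, sinhC_apply]
  change (_ ∧ _) ↔ _
  rw [integral_congr_ae e, integC_apply, and_iff_right]
  exact (integrable_bcf _).congr e.symm

/-- The constant `c_sh(v)` is chosen such that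
`∫ sinh (2 ∂ₓ⁻¹ v + c) = cosh c ∫ sinh (2 ∂ₓ⁻¹ v) + sinh c ∫ cosh (2 ∂ₓ⁻¹ v)` vanishes. -/
theorem Psi_mem_Msinh {m : ℕ} (v : H0 m) : Psi v ∈ Msinh (m + 1) := by
  rw [mem_Msinh_iff, integC_apply]
  simp only [sinhC_apply, evalC_Psi]
  rw [integral_sinh_add_const]
  have hC := integC_coshC_pos (twoInvC m v)
  have ht := Real.tanh_artanh (ratio_mem_Ioo (twoInvC m v))
  rw [csh_eq, Real.cosh_neg, Real.sinh_neg]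
  set c := Real.artanh (integC (sinhC (twoInvC m v)) / integC (coshC (twoInvC m v)))
  rw [Real.tanh_eq_sinh_div_cosh, div_eq_div_iff (Real.cosh_pos c).ne' hC.ne'] at ht
  linarith

/-- `M_sinh` is the zero set of `u ↦ ∫ sinh u`, whose derivative in the direction of the constant
function `1` is `∫ cosh u > 0`. -/
theorem isAnalyticHypersurface_Msinh (m : ℕ) : IsAnalyticHypersurface (Msinh (m + 1)) := by
  intro u _hu
  have hd := (integC.hasFDerivAt (x := sinhC (evalC m u))).comp u
    ((hasFDerivAt_sinhC (evalC m u)).comp u (evalC m).hasFDerivAt)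
  refine ⟨univ, isOpen_univ, mem_univ _, fun u => integC (sinhC (evalC m u)), ?_, ?_, ?_⟩
  · intro w _
    exact (integC.analyticAt _).comp ((analyticAt_sinhC _).comp ((evalC m).analyticAt w))
  · intro h0
    have h1 := hd.fderiv
    have h2 : fderiv ℝ (fun u => integC (sinhC (evalC m u))) u (constH (m + 1) 1) = 0 := by
      rw [h0]; rfl
    have h3 : fderiv ℝ (fun u => integC (sinhC (evalC m u))) u (constH (m + 1) 1)
        = integC (coshC (evalC m u)) := by
      rw [show fderiv ℝ (fun u => integC (sinhC (evalC m u))) u = _ from h1]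
      change integC (coshC (evalC m u) * evalC m (constH (m + 1) 1)) = _
      congr 1
      ext x
      rw [BoundedContinuousFunction.mul_apply, evalC_constH, mul_one]
    exact (integC_coshC_pos (evalC m u)).ne' (h3.symm.trans h2)
  · ext w
    simp only [inter_univ, mem_univ, true_and]
    exact mem_Msinh_iff w

/-- The inverse of `Ψ` is `u ↦ ½ ∂ₓ u`: if `∂ₓ u = 2 v` then `u` and `Ψ(v)` differ by a constant `d`,
and `∫ sinh (Ψ(v) + d) = sinh d ∫ cosh Ψ(v)` forces `d = 0`. -/
theorem bijOn_Psi (m : ℕ) : BijOn (Psi : H0 m → H (m + 1)) univ (Msinh (m + 1)) := by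
  refine ⟨fun v _ => Psi_mem_Msinh v, fun v _ w _ h => ?_, fun u hu => ?_⟩
  · rw [← half_dxL0_Psi v, ← half_dxL0_Psi w, h]
  · refine ⟨((1 / 2 : ℝ) • dxL0 m) u, mem_univ _, ?_⟩
    set v := ((1 / 2 : ℝ) • dxL0 m) u with hv
    have hdx : dx (u - Psi v) = 0 := by
      rw [← dxL_apply, map_sub, dxL_apply, dxL_apply, dx_Psi, hv]
      change dx u - (2 : ℝ) • ((1 / 2 : ℝ) • dx u) = 0
      rw [smul_smul]; norm_num
    have hc := eq_const_of_dx_eq_zero hdx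
    set d := ∫ x, fn (u - Psi v) x ∂circleMeasure
    have hu' : u = Psi v + constH (m + 1) d := by rw [← hc]; abel
    have h1 := (mem_Msinh_iff u).1 hu
    have h2 := (mem_Msinh_iff _).1 (Psi_mem_Msinh v)
    rw [hu', integC_apply] at h1
    simp only [sinhC_apply, map_add, BoundedContinuousFunction.add_apply, evalC_constH] at h1
    rw [integral_sinh_add_const, h2, mul_zero, zero_add] at h1
    have h3 : Real.sinh d = 0 :=
      (mul_eq_zero.1 h1).resolve_right (integC_coshC_pos _).ne'
    rw [Real.sinh_eq_zero] at h3
    rw [hu', h3, constH_eq_smul, zero_smul, add_zero]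

theorem isAnalyticDiffeoOnto_Psi (m : ℕ) :
    IsAnalyticDiffeoOnto (Psi : H0 m → H (m + 1)) (Msinh (m + 1)) :=
  ⟨isAnalyticHypersurface_Msinh m, fun v _ => analyticAt_Psi v, bijOn_Psi m, fun _ _ =>
    ⟨univ, isOpen_univ, mem_univ _, ((1 / 2 : ℝ) • dxL0 m),
      fun w _ => ((1 / 2 : ℝ) • dxL0 m).analyticAt w, fun v _ => half_dxL0_Psi v⟩⟩

/-- `½ sinh (Ψ(v))` is in `H^{m+1}` as this space is closed under the exponential, and it has mean
zero as `Ψ(v) ∈ M_sinh`. -/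
theorem exists_reduced_rhs {m : ℕ} (v : H0 m) : ∃ X : H0 (m + 1),
    fn0 X =ᵐ[circleMeasure] fun x => 1 / 2 * Real.sinh (2 * fn0 (dxInv v) x + csh v) := by
  obtain ⟨w, hw⟩ := exists_H_sinh (Psi v) (1 / 2)
  refine ⟨⟨w, ?_⟩, ?_⟩
  · change ∫ x, fn w x ∂circleMeasure = 0
    rw [integral_congr_ae hw, integral_const_mul, (Psi_mem_Msinh v).2, mul_zero]
  · refine hw.trans ?_
    filter_upwards [fn_Psi v] with x hx
    rw [hx]

/-! ### Correspondence of solutions -/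

theorem isC1Curve_Psi {m : ℕ} {J : Set ℝ} {v v' : ℝ → H0 m} (h : IsC1Curve J v v') :
    IsC1Curve J (fun t => Psi (v t)) (fun t => PsiDeriv (v t) (v' t)) := by
  have hv : ContinuousOn v J := fun t ht => (h.2 t ht).continuousWithinAt
  refine ⟨?_, fun t ht => (hasFDerivAt_Psi (v t)).comp_hasDerivWithinAt t (h.2 t ht)⟩
  have h1 : ContinuousOn (fun t => fderiv ℝ csh (v t) (v' t)) J :=
    (continuous_fderiv_csh.comp_continuousOn hv).clm_apply h.1
  exact (((2 : ℝ) • (H0 (m + 1)).subtypeL.comp (dxInvL m)).continuous.comp_continuousOn h.1).add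
    ((constL (m + 1)).continuous.comp_continuousOn h1)

theorem fn_dx_PsiDeriv {m : ℕ} (v h : H0 m) :
    fn (dx (PsiDeriv v h)) =ᵐ[circleMeasure] fun x => 2 * fn0 h x := by
  rw [PsiDeriv_apply, dx_two_dxInv_add]
  exact fn_smul 2 (h : H m)

theorem solvesSinhGordon_iff {m : ℕ} (J : Set ℝ) (v : ℝ → H0 m) :
    SolvesSinhGordon J (fun t => Psi (v t)) ↔ SolvesReduced J v := by
  constructor
  · rintro ⟨u', ⟨hc, hd⟩, h⟩
    refine ⟨fun t => ((1 / 2 : ℝ) • dxL0 m) (u' t),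
      ⟨((1 / 2 : ℝ) • dxL0 m).continuous.comp_continuousOn hc, fun t ht => ?_⟩, fun t ht => ?_⟩
    · have := ((1 / 2 : ℝ) • dxL0 m).hasFDerivAt.comp_hasDerivWithinAt t (hd t ht)
      refine this.congr_of_mem (fun s _ => ?_) ht
      exact (half_dxL0_Psi (v s)).symm
    · have e : fn0 (((1 / 2 : ℝ) • dxL0 m) (u' t)) =ᵐ[circleMeasure]
          fun x => 1 / 2 * fn (dx (u' t)) x := fn_smul (1 / 2) (dx (u' t))
      filter_upwards [e, (h t ht).2, fn_Psi (v t)] with x h1 h2 h3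
      rw [h1, h2, h3]
  · rintro ⟨v', hC, h⟩
    refine ⟨_, isC1Curve_Psi hC, fun t ht => ⟨Psi_mem_Msinh _, ?_⟩⟩
    filter_upwards [fn_dx_PsiDeriv (v t) (v' t), h t ht, fn_Psi (v t)] with x h1 h2 h3
    rw [h1, h2, h3]; ring

/-! ### The Hamiltonian and its gradient -/

theorem Hsh_eq {m : ℕ} (v : H0 m) : Hsh v = -(1 / 4) * integC (coshC (evalC m (Psi v))) := by
  unfold Hsh
  rw [integC_apply]
  congr 1
  apply integral_congr_ae
  filter_upwards [fn_Psi v, fn_ae_evalC (Psi v)] with x h1 h2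
  rw [coshC_apply, ← h1, h2]

theorem contDiff_Hsh (m : ℕ) : ContDiff ℝ 1 (Hsh : H0 m → ℝ) := by
  refine contDiff_iff_contDiffAt.2 fun v => AnalyticAt.contDiffAt ?_
  rw [show (Hsh : H0 m → ℝ) = fun v => _ * _ from funext Hsh_eq]
  exact analyticAt_const.fun_mul ((integC.analyticAt _).comp ((analyticAt_coshC _).comp
    (((evalC m).analyticAt _).comp (analyticAt_Psi v))))

/-- The `L²`-gradient of `H_sh` is a mean-zero antiderivative of `½ sinh(Ψ(v))`. -/
theorem exists_gradient_Hsh {m : ℕ} (v : H0 m) : ∃ g : H0 1, IsL2Gradient Hsh v g ∧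
    fn (dx (g : H 1)) =ᵐ[circleMeasure]
      fun x => 1 / 2 * Real.sinh (2 * fn0 (dxInv v) x + csh v) := by
  obtain ⟨X, hX⟩ := exists_reduced_rhs v
  let X0 : H0 0 := ⟨ofL2 (toL2 (X : H (m + 1))), X.2⟩
  have hdg : dx (dxInv X0 : H 1) = (X0 : H 0) := dx_dxInv X0
  have hdg' : fn (dx (dxInv X0 : H 1)) =ᵐ[circleMeasure]
      fun x => 1 / 2 * Real.sinh (2 * fn0 (dxInv v) x + csh v) := by rw [hdg]; exact hX
  have hsinh : fn (dx (dxInv X0 : H 1)) =ᵐ[circleMeasure]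
      fun x => 1 / 2 * sinhC (evalC m (Psi v)) x := by
    filter_upwards [hdg', fn_Psi v, fn_ae_evalC (Psi v)] with x h1 h2 h3
    rw [h1, sinhC_apply, ← h2, h3]
  refine ⟨dxInv X0, ?_, hdg'⟩
  have hd := ((integC.hasFDerivAt (x := coshC (evalC m (Psi v)))).comp v
    ((hasFDerivAt_coshC (evalC m (Psi v))).comp v
      ((evalC m).hasFDerivAt.comp v (hasFDerivAt_Psi v)))).const_smul (-(1 / 4) : ℝ)
  refine ⟨_, hd.congr_of_eventuallyEq (Filter.Eventually.of_forall Hsh_eq), fun h => ?_⟩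
  change -(1 / 4) * integC (sinhC (evalC m (Psi v)) * evalC m (PsiDeriv v h)) = _
  set s := sinhC (evalC m (Psi v)) with hs
  have hs0 : integC s = 0 := (mem_Msinh_iff _).1 (Psi_mem_Msinh v)
  have e1 : integC (s * evalC m (PsiDeriv v h)) = 2 * integC (s * evalC m (dxInv h : H (m + 1))) := by
    have : s * evalC m (PsiDeriv v h)
        = (2 : ℝ) • (s * evalC m (dxInv h : H (m + 1))) + (fderiv ℝ csh v h) • s := by
      ext x
      rw [PsiDeriv_apply, map_add, map_smul]
      simp only [BoundedContinuousFunction.mul_apply, BoundedContinuousFunction.add_apply,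
        BoundedContinuousFunction.smul_apply, evalC_constH, smul_eq_mul]
      ring
    rw [this, map_add, map_smul, map_smul, hs0, smul_zero, add_zero, smul_eq_mul]
  have hibp := (((perAC_evalC (dxInv X0 : H 1)).mul
    (perAC_evalC (dxInv h : H (m + 1)))).of_eq (one_mul 1)).integral_eq_zero
  rw [dx_dxInv h] at hibp
  have i1 : Integrable (fun x => fn0 (dxInv X0) x * fn0 h x) circleMeasure :=
    (fn_memLp _).integrable_mul (fn_memLp _)
  have e2 : ∫ x, (fn (dx (dxInv X0 : H 1)) x * evalC m (dxInv h : H (m + 1)) x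
      + evalC 0 (dxInv X0 : H 1) x * fn (h : H m) x) ∂circleMeasure
      = ∫ x, (1 / 2 * (s * evalC m (dxInv h : H (m + 1))) x
        + fn0 (dxInv X0) x * fn0 h x) ∂circleMeasure := by
    apply integral_congr_ae
    filter_upwards [hsinh, fn_ae_evalC (dxInv X0 : H 1)] with x h1 h2
    rw [h1, ← h2, BoundedContinuousFunction.mul_apply, fn0, fn0]; ring
  rw [e2, integral_add ((integrable_bcf _).const_mul _) i1, integral_const_mul,
    ← integC_apply] at hibp
  rw [e1]
  linarith

/-! ### Uniqueness of `L²`-gradients -/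

/-- Smooth periodic functions are in `H^m`. -/
theorem exists_H_of_contDiff {ψ : ℝ → ℝ} (m : ℕ) (hψ : ContDiff ℝ ∞ ψ) (hp : ∀ x, ψ (x + 1) = ψ x) :
    ∃ w : H m, fn w =ᵐ[circleMeasure] ψ := by
  induction m generalizing ψ with
  | zero =>
    have hL := (acPair_of_contDiff hψ).memLp_fun
    exact ⟨ofL2 (hL.toLp ψ), hL.coeFn_toLp⟩
  | succ n ih =>
    have hd : ∀ x, deriv ψ (x + 1) = deriv ψ x := fun x => by
      rw [← deriv_comp_add_const, show (fun x => ψ (x + 1)) = ψ from funext hp]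
    obtain ⟨w, hw⟩ := ih (ψ := deriv ψ) (by
      have h2 : ContDiff ℝ (∞ + 1) ψ := hψ
      exact (contDiff_succ_iff_deriv.1 h2).2.2) hd
    have hP : PerAC 1 ψ (deriv ψ) :=
      ⟨acPair_of_contDiff hψ, by rw [one_smul, ← hp 0, zero_add]⟩
    obtain ⟨u, hu, -⟩ := exists_H_of_perAC hP w hw
    exact ⟨u, hu⟩

/-- Mean-zero `L²`-gradients are unique, as the derivatives of smooth periodic functions are smooth
functions of mean zero, so that the difference of two gradients has weak derivative zero. -/
theorem IsL2Gradient.unique {m : ℕ} {F : H0 m → ℝ} {v : H0 m} {g g' : H0 1}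
    (h : IsL2Gradient F v g) (h' : IsL2Gradient F v g') : g = g' := by
  obtain ⟨A, hA, hA'⟩ := h
  obtain ⟨B, hB, hB'⟩ := h'
  obtain rfl := hA.unique hB
  have hw : IsWeakDeriv 1 (toL2 ((g - g' : H0 1) : H 1)) 0 := by
    intro φ hφ hp
    have hp' : ∀ x, φ (x + 1) = φ x := fun x => by rw [hp, one_mul]
    have hd : ∀ x, deriv φ (x + 1) = deriv φ x := fun x => by
      rw [← deriv_comp_add_const, show (fun x => φ (x + 1)) = φ from funext hp']
    obtain ⟨w, hw⟩ := exists_H_of_contDiff (ψ := deriv φ) m (by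
      have h2 : ContDiff ℝ (∞ + 1) φ := hφ
      exact (contDiff_succ_iff_deriv.1 h2).2.2) hd
    have hw0 : w ∈ H0 m := by
      change ∫ x, fn w x ∂circleMeasure = 0
      rw [integral_congr_ae hw, integral_deriv_of_periodic hφ hp]
    have e := (hA' ⟨w, hw0⟩).symm.trans (hB' ⟨w, hw0⟩)
    have i1 : Integrable (fun x => fn0 g x * fn0 (⟨w, hw0⟩ : H0 m) x) circleMeasure :=
      (fn_memLp _).integrable_mul (fn_memLp _)
    have i2 : Integrable (fun x => fn0 g' x * fn0 (⟨w, hw0⟩ : H0 m) x) circleMeasure :=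
      (fn_memLp _).integrable_mul (fn_memLp _)
    have l : ∫ x, deriv φ x • (toL2 ((g - g' : H0 1) : H 1)) x ∂circleMeasure
        = ∫ x, (fn0 g x * fn0 (⟨w, hw0⟩ : H0 m) x - fn0 g' x * fn0 (⟨w, hw0⟩ : H0 m) x)
          ∂circleMeasure := by
      apply integral_congr_ae
      have hs : fn ((g - g' : H0 1) : H 1) =ᵐ[circleMeasure] fun x => fn0 g x - fn0 g' x :=
        Lp.coeFn_sub (toL2 (g : H 1)) (toL2 (g' : H 1))
      filter_upwards [hs, hw] with x h1 h2
      change deriv φ x • fn ((g - g' : H0 1) : H 1) x = _ * fn w x - _ * fn w x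
      rw [h1, h2, smul_eq_mul]; ring
    have r : ∫ x, φ x • (0 : L2 ℝ) x ∂circleMeasure = 0 := by
      rw [integral_eq_zero_of_ae]
      filter_upwards [Lp.coeFn_zero ℝ 2 circleMeasure] with x hx
      rw [hx]; simp
    rw [l, integral_sub i1 i2, e, sub_self, r, neg_zero]
  have hdx : dx ((g - g' : H0 1) : H 1) = 0 := by
    apply H_ext_toL2
    exact IsWeakDeriv.unique (Or.inl rfl) (isWeakDeriv_dx _) hw
  exact sub_eq_zero.1 (H0_ext_dx (w := 0) (hdx.trans (map_zero (dxL 0)).symm))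

theorem isAdmissible_Hsh (m : ℕ) : IsAdmissible (Hsh : H0 m → ℝ) :=
  ⟨contDiff_Hsh m, fun v => (exists_gradient_Hsh v).imp fun _ h => h.1⟩

theorem IsAdmissible.l2Gradient_spec {m : ℕ} {F : H0 m → ℝ} (hF : IsAdmissible F) (v : H0 m) :
    IsL2Gradient F v (l2Gradient F v) := by
  unfold l2Gradient
  rw [dif_pos (hF.2 v)]
  exact (hF.2 v).choose_spec

theorem hamVectorField_Hsh {m : ℕ} (v : H0 m) : fn (hamVectorField Hsh v) =ᵐ[circleMeasure]
    fun x => 1 / 2 * Real.sinh (2 * fn0 (dxInv v) x + csh v) := by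
  obtain ⟨g, hg, hg'⟩ := exists_gradient_Hsh v
  unfold hamVectorField
  rw [((isAdmissible_Hsh m).l2Gradient_spec v).unique hg]
  exact hg'

theorem solvesHamiltonian_Hsh_iff {m : ℕ} (J : Set ℝ) (v : ℝ → H0 m) :
    SolvesHamiltonian Hsh J v ↔ SolvesReduced J v := by
  refine exists_congr fun v' => and_congr_right fun _ => forall₂_congr fun t _ => ?_
  exact ⟨fun h => h.trans (hamVectorField_Hsh _), fun h => h.trans (hamVectorField_Hsh _).symm⟩

theorem hasDerivWithinAt_gardner {m : ℕ} {J : Set ℝ} {v : ℝ → H0 m} (hv : SolvesReduced J v)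
    {F : H0 m → ℝ} (hF : IsAdmissible F) {t : ℝ} (ht : t ∈ J) :
    HasDerivWithinAt (fun s => F (v s)) (gardner F Hsh (v t)) J t := by
  obtain ⟨v', ⟨-, hd⟩, h⟩ := (solvesHamiltonian_Hsh_iff J v).2 hv
  obtain ⟨A, hA, hA'⟩ := hF.l2Gradient_spec (v t)
  have := hA.comp_hasDerivWithinAt t (hd t ht)
  refine this.congr_deriv ?_
  rw [hA', gardner]
  apply integral_congr_ae
  filter_upwards [h t ht] with x hx
  rw [hx]

end

/-! ### Linear ordinary differential equations and Lax pairs in Banach spaces -/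

theorem exists_linear_ode {X : Type*} [NormedAddCommGroup X] [NormedSpace ℝ X] [CompleteSpace X]
    {B : ℝ → X →L[ℝ] X} (hB : Continuous B) (s : ℝ) (x₀ : X) :
    ∃ ε > 0, ∃ α : ℝ → X, α s = x₀ ∧ ∀ t ∈ Icc (s - ε) (s + ε),
      HasDerivWithinAt α (B t (α t)) (Icc (s - ε) (s + ε)) t := by
  obtain ⟨C, hC⟩ := (isCompact_Icc (a := s - 1) (b := s + 1)).exists_bound_of_continuousOn
    hB.continuousOn
  have hC0 : 0 ≤ C := (norm_nonneg _).trans (hC s ⟨by linarith, by linarith⟩)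
  set M : ℝ := C * (‖x₀‖ + 1) with hM
  have hM0 : 0 ≤ M := by positivity
  set ε : ℝ := 1 / (M + 1) with hε
  have hε0 : 0 < ε := by positivity
  have hε1 : ε ≤ 1 := by
    rw [hε, div_le_one (by positivity)]; linarith
  have hMε : M * ε ≤ 1 := by
    rw [hε, mul_one_div, div_le_one (by positivity)]; linarith
  have hsub : ∀ t ∈ Icc (s - ε) (s + ε), ‖B t‖ ≤ C := fun t ht =>
    hC t ⟨by linarith [ht.1], by linarith [ht.2]⟩
  have hs : s ∈ Icc (s - ε) (s + ε) := ⟨by linarith, by linarith⟩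
  have hPL : IsPicardLindelof (fun t x => B t x) (tmin := s - ε) (tmax := s + ε) ⟨s, hs⟩ x₀
      1 0 ⟨M, hM0⟩ ⟨C, hC0⟩ := by
    refine ⟨fun t ht => ?_, fun x _ => (hB.clm_apply continuous_const).continuousOn,
      fun t ht x hx => ?_, ?_⟩
    · refine ((B t).lipschitz.weaken ?_).lipschitzOnWith
      exact hsub t ht
    · have hx' : ‖x‖ ≤ ‖x₀‖ + 1 := by
        have h1 : ‖x - x₀‖ ≤ 1 := by simpa [dist_eq_norm] using hx
        have h2 := norm_add_le (x - x₀) x₀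
        rw [sub_add_cancel] at h2
        linarith
      exact (B t).le_of_opNorm_le_of_le (hsub t ht) hx'
    · change M * max (s + ε - s) (s - (s - ε)) ≤ 1 - 0
      rw [add_sub_cancel_left, sub_sub_cancel, max_self, sub_zero]
      exact hMε
  obtain ⟨α, h1, h2⟩ := hPL.exists_eq_forall_mem_Icc_hasDerivWithinAt₀
  exact ⟨ε, hε0, α, h1, h2⟩

section Lax

variable {E F : Type*} [NormedAddCommGroup E] [NormedSpace ℂ E]
  [NormedAddCommGroup F] [NormedSpace ℂ F] [NormedSpace ℝ F] [IsScalarTower ℝ ℂ F]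

theorem hasDerivWithinAt_clm_comp {G : Type*} [NormedAddCommGroup G] [NormedSpace ℂ G]
    [NormedSpace ℝ G] [IsScalarTower ℝ ℂ G] {c : ℝ → F →L[ℂ] G} {d : ℝ → E →L[ℂ] F} {c' : F →L[ℂ] G}
    {d' : E →L[ℂ] F} {S : Set ℝ} {t : ℝ} (hc : HasDerivWithinAt c c' S t)
    (hd : HasDerivWithinAt d d' S t) :
    HasDerivWithinAt (fun t => (c t).comp (d t)) (c'.comp (d t) + (c t).comp d') S t := by
  have hb := ((isBoundedBilinearMap_comp (𝕜 := ℂ) (E := E) (F := F) (G := G)).hasFDerivAt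
    (c t, d t)).restrictScalars ℝ
  have h := hb.comp_hasDerivWithinAt t (hc.prodMk hd)
  refine h.congr_deriv ?_
  simp [add_comm]

variable [NormedSpace ℝ E] [IsScalarTower ℝ ℂ E]

/-- Local form of `exists_lax_intertwining`. -/
theorem eventually_lax_intertwining [CompleteSpace E] [CompleteSpace F] {I : Set ℝ}
    (hI : Convex ℝ I) {P P' : ℝ → E →L[ℂ] F} {TE : ℝ → E →L[ℂ] E} {TF : ℝ → F →L[ℂ] F}
    (hTE : Continuous TE) (hTF : Continuous TF)
    (hP : ∀ t ∈ I, HasDerivWithinAt P (P' t) I t)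
    (hLax : ∀ t ∈ I, P' t + (P t).comp (TE t) = (TF t).comp (P t)) {s : ℝ} (hs : s ∈ I) :
    ∀ᶠ t in 𝓝[I] s, ∃ (U : E ≃L[ℂ] E) (V : F ≃L[ℂ] F), ∀ y, P t (U y) = V (P s y) := by
  -- `U' = T_E U` and `V' = -V T_F`, so that `(V P U)' = 0`.
  obtain ⟨ε₁, hε₁, U, hU0, hU⟩ := exists_linear_ode (X := E →L[ℂ] E)
    (B := fun t => (ContinuousLinearMap.compL ℂ E E E (TE t)).restrictScalars ℝ)
    ((ContinuousLinearMap.restrictScalarsL ℂ (E →L[ℂ] E) (E →L[ℂ] E) ℝ ℝ).continuous.comp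
      ((ContinuousLinearMap.compL ℂ E E E).continuous.comp hTE)) s 1
  obtain ⟨ε₂, hε₂, V, hV0, hV⟩ := exists_linear_ode (X := F →L[ℂ] F)
    (B := fun t => -((ContinuousLinearMap.compL ℂ F F F).flip (TF t)).restrictScalars ℝ)
    ((ContinuousLinearMap.restrictScalarsL ℂ (F →L[ℂ] F) (F →L[ℂ] F) ℝ ℝ).continuous.comp
      ((ContinuousLinearMap.compL ℂ F F F).flip.continuous.comp hTF)).neg s 1
  set K : Set ℝ := I ∩ (Icc (s - ε₁) (s + ε₁) ∩ Icc (s - ε₂) (s + ε₂)) with hK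
  have hKc : Convex ℝ K := hI.inter ((convex_Icc _ _).inter (convex_Icc _ _))
  have hsK : s ∈ K := ⟨hs, ⟨by linarith, by linarith⟩, ⟨by linarith, by linarith⟩⟩
  have hKnhds : K ∈ 𝓝[I] s := by
    refine Filter.inter_mem self_mem_nhdsWithin (mem_nhdsWithin_of_mem_nhds ?_)
    exact Filter.inter_mem (Icc_mem_nhds (by linarith) (by linarith))
      (Icc_mem_nhds (by linarith) (by linarith))
  have hUK : ∀ t ∈ K, HasDerivWithinAt U ((TE t).comp (U t)) K t := fun t ht =>
    (hU t ht.2.1).mono fun x hx => hx.2.1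
  have hVK : ∀ t ∈ K, HasDerivWithinAt V (-(V t).comp (TF t)) K t := fun t ht =>
    (hV t ht.2.2).mono fun x hx => hx.2.2
  have hPK : ∀ t ∈ K, HasDerivWithinAt P (P' t) K t := fun t ht =>
    (hP t ht.1).mono inter_subset_left
  have hconst : ∀ t ∈ K, (V t).comp ((P t).comp (U t)) = P s := by
    intro t ht
    have hder : ∀ t ∈ K, HasDerivWithinAt (fun t => (V t).comp ((P t).comp (U t))) 0 K t := by
      intro t ht
      have h := hasDerivWithinAt_clm_comp (hVK t ht)
        (hasDerivWithinAt_clm_comp (hPK t ht) (hUK t ht))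
      refine h.congr_deriv ?_
      have e := hLax t ht.1
      have e2 : (P' t).comp (U t) + (P t).comp ((TE t).comp (U t))
          = (TF t).comp ((P t).comp (U t)) := by
        rw [← ContinuousLinearMap.comp_assoc, ← ContinuousLinearMap.add_comp, e,
          ContinuousLinearMap.comp_assoc]
      rw [e2, ContinuousLinearMap.neg_comp, ContinuousLinearMap.comp_assoc, neg_add_cancel]
    have h := hKc.norm_image_sub_le_of_norm_hasDerivWithin_le (C := 0) hder
      (fun x _ => by simp) hsK ht
    rw [zero_mul, norm_le_zero_iff, sub_eq_zero] at h
    rw [h, hU0, hV0]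
    rfl
  have hUu : ∀ᶠ t in 𝓝[K] s, IsUnit (U t) := by
    have hc := (hUK s hsK).continuousWithinAt
    refine hc.eventually (?_ : ∀ᶠ u in 𝓝 (U s), IsUnit u)
    rw [hU0]
    exact Units.isOpen.mem_nhds isUnit_one
  have hVu : ∀ᶠ t in 𝓝[K] s, IsUnit (V t) := by
    have hc := (hVK s hsK).continuousWithinAt
    refine hc.eventually (?_ : ∀ᶠ u in 𝓝 (V s), IsUnit u)
    rw [hV0]
    exact Units.isOpen.mem_nhds isUnit_one
  have hle : 𝓝[I] s ≤ 𝓝[K] s := nhdsWithin_le_of_mem hKnhds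
  filter_upwards [hle hUu, hle hVu, hKnhds] with t hu hv ht
  obtain ⟨u, hu⟩ := hu
  obtain ⟨w, hw⟩ := hv
  refine ⟨ContinuousLinearEquiv.ofUnit u, (ContinuousLinearEquiv.ofUnit w).symm, fun y => ?_⟩
  rw [ContinuousLinearEquiv.eq_symm_apply]
  have h := congrArg (fun A : E →L[ℂ] F => A y) (hconst t ht)
  rw [← hu, ← hw] at h
  exact h

/-- A Lax equation `P' = T_F P - P T_E` with bounded `T_E` and `T_F` makes all the operators `P t`
equivalent. -/
theorem exists_lax_intertwining [CompleteSpace E] [CompleteSpace F] {J : Set ℝ}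
    (hJ : J.OrdConnected) {P P' : ℝ → E →L[ℂ] F} {TE : ℝ → E →L[ℂ] E} {TF : ℝ → F →L[ℂ] F}
    (hTE : ContinuousOn TE J) (hTF : ContinuousOn TF J)
    (hP : ∀ t ∈ J, HasDerivWithinAt P (P' t) J t)
    (hLax : ∀ t ∈ J, P' t + (P t).comp (TE t) = (TF t).comp (P t))
    {s t : ℝ} (hs : s ∈ J) (ht : t ∈ J) :
    ∃ (U : E ≃L[ℂ] E) (V : F ≃L[ℂ] F), ∀ y, P t (U y) = V (P s y) := by
  have hIJ : Icc (min s t) (max s t) ⊆ J := hJ.uIcc_subset hs ht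
  set I := Icc (min s t) (max s t) with hI
  have hle : min s t ≤ max s t := min_le_max
  have hsI : s ∈ I := ⟨min_le_left _ _, le_max_left _ _⟩
  have htI : t ∈ I := ⟨min_le_right _ _, le_max_right _ _⟩
  have e : ∀ x ∈ I, (projIcc (min s t) (max s t) hle x : ℝ) = x := fun x hx => by
    rw [projIcc_of_mem hle hx]
  refine isPreconnected_Icc.induction₂ (s := I)
    (fun s t => ∃ (U : E ≃L[ℂ] E) (V : F ≃L[ℂ] F), ∀ y, P t (U y) = V (P s y)) ?_ ?_ ?_ hsI htI
  · intro x hx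
    refine eventually_lax_intertwining (convex_Icc _ _)
      (TE := fun x => TE (projIcc (min s t) (max s t) hle x))
      (TF := fun x => TF (projIcc (min s t) (max s t) hle x)) ?_ ?_
      (fun y hy => (hP y (hIJ hy)).mono hIJ) (fun y hy => ?_) hx
    · exact (hTE.mono hIJ).comp_continuous (continuous_subtype_val.comp continuous_projIcc)
        fun x => (projIcc (min s t) (max s t) hle x).2
    · exact (hTF.mono hIJ).comp_continuous (continuous_subtype_val.comp continuous_projIcc)
        fun x => (projIcc (min s t) (max s t) hle x).2
    · simp only [e y hy]
      exact hLax y (hIJ hy)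
  · rintro x y z - - - ⟨U, V, h⟩ ⟨U', V', h'⟩
    exact ⟨U.trans U', V.trans V', fun w => by simp [h', h]⟩
  · rintro x y - - ⟨U, V, h⟩
    refine ⟨U.symm, V.symm, fun w => ?_⟩
    rw [ContinuousLinearEquiv.eq_symm_apply, ← h, ContinuousLinearEquiv.apply_symm_apply]

end Lax

/-! ### Multiplication operators on `L²` -/

theorem memLp_bcf_mul (a : ℝ →ᵇ ℝ) (f : L2 ℂ) :
    MemLp (fun x => (a x : ℂ) * f x) 2 circleMeasure := by
  refine (Lp.memLp f).of_le_mul (c := ‖a‖) ?_ (Filter.Eventually.of_forall fun x => ?_)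
  · exact (Complex.continuous_ofReal.comp a.continuous).aestronglyMeasurable.mul
      (Lp.aestronglyMeasurable f)
  · rw [norm_mul, Complex.norm_real]
    exact mul_le_mul_of_nonneg_right (a.norm_coe_le_norm x) (norm_nonneg _)

/-- Multiplication of an `L²` function by a bounded continuous function. -/
def mulFun (a : ℝ →ᵇ ℝ) (f : L2 ℂ) : L2 ℂ := (memLp_bcf_mul a f).toLp _

theorem mulFun_ae (a : ℝ →ᵇ ℝ) (f : L2 ℂ) :
    mulFun a f =ᵐ[circleMeasure] fun x => (a x : ℂ) * f x := (memLp_bcf_mul a f).coeFn_toLp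

theorem norm_mulFun_le (a : ℝ →ᵇ ℝ) (f : L2 ℂ) : ‖mulFun a f‖ ≤ ‖a‖ * ‖f‖ := by
  refine Lp.norm_le_mul_norm_of_ae_le_mul ?_
  filter_upwards [mulFun_ae a f] with x hx
  rw [hx, norm_mul, Complex.norm_real]
  exact mul_le_mul_of_nonneg_right (a.norm_coe_le_norm x) (norm_nonneg _)

/-- Multiplication operators, as a continuous linear map from the bounded continuous functions to
the bounded operators on `L²`. -/
def mulL : (ℝ →ᵇ ℝ) →L[ℝ] (L2 ℂ →L[ℂ] L2 ℂ) :=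
  LinearMap.mkContinuous
    { toFun := fun a => LinearMap.mkContinuous
        { toFun := mulFun a
          map_add' := fun f g => by
            apply Lp.ext
            filter_upwards [mulFun_ae a (f + g), mulFun_ae a f, mulFun_ae a g, Lp.coeFn_add f g,
              Lp.coeFn_add (mulFun a f) (mulFun a g)] with x h1 h2 h3 h4 h5
            rw [h1, h5, Pi.add_apply, h2, h3, h4, Pi.add_apply, mul_add]
          map_smul' := fun c f => by
            apply Lp.ext
            filter_upwards [mulFun_ae a (c • f), mulFun_ae a f, Lp.coeFn_smul c f,
              Lp.coeFn_smul c (mulFun a f)] with x h1 h2 h3 h4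
            rw [RingHom.id_apply, h1, h4, Pi.smul_apply, h2, h3, Pi.smul_apply, smul_eq_mul,
              smul_eq_mul]
            ring }
        ‖a‖ (norm_mulFun_le a)
      map_add' := fun a b => by
        ext1 f
        apply Lp.ext
        filter_upwards [mulFun_ae (a + b) f, mulFun_ae a f, mulFun_ae b f,
          Lp.coeFn_add (mulFun a f) (mulFun b f)] with x h1 h2 h3 h4
        refine h1.trans (Eq.trans ?_ h4.symm)
        rw [Pi.add_apply, h2, h3, BoundedContinuousFunction.add_apply]
        push_cast; ring
      map_smul' := fun c a => by
        ext1 f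
        apply Lp.ext
        filter_upwards [mulFun_ae (c • a) f, mulFun_ae a f,
          Lp.coeFn_smul c (mulFun a f)] with x h1 h2 h3
        refine h1.trans (Eq.trans ?_ h3.symm)
        rw [Pi.smul_apply, h2, BoundedContinuousFunction.smul_apply, Complex.real_smul, smul_eq_mul]
        push_cast; ring }
    1 (fun a => by
      rw [one_mul]
      exact LinearMap.mkContinuous_norm_le _ (norm_nonneg a) (norm_mulFun_le a))

theorem mulL_ae (a : ℝ →ᵇ ℝ) (f : L2 ℂ) :
    mulL a f =ᵐ[circleMeasure] fun x => (a x : ℂ) * f x := mulFun_ae a f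

theorem mulL_mul (a b : ℝ →ᵇ ℝ) (f : L2 ℂ) : mulL (a * b) f = mulL a (mulL b f) := by
  apply Lp.ext
  filter_upwards [mulL_ae (a * b) f, mulL_ae a (mulL b f), mulL_ae b f] with x h1 h2 h3
  rw [h1, h2, h3, BoundedContinuousFunction.mul_apply]
  push_cast; ring

theorem mulL_one (f : L2 ℂ) : mulL 1 f = f := by
  apply Lp.ext
  filter_upwards [mulL_ae 1 f] with x h1
  rw [h1, BoundedContinuousFunction.coe_one, Pi.one_apply, Complex.ofReal_one, one_mul]

theorem exp_neg_mul_exp (a : ℝ →ᵇ ℝ) : NormedSpace.exp (-a) * NormedSpace.exp a = 1 := by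
  ext x
  rw [BoundedContinuousFunction.mul_apply, exp_apply_bcf, exp_apply_bcf,
    BoundedContinuousFunction.neg_apply, ← Real.exp_add, neg_add_cancel, Real.exp_zero,
    BoundedContinuousFunction.coe_one, Pi.one_apply]

theorem mulL_exp_neg_exp (a : ℝ →ᵇ ℝ) (f : L2 ℂ) :
    mulL (NormedSpace.exp (-a)) (mulL (NormedSpace.exp a) f) = f := by
  rw [← mulL_mul, exp_neg_mul_exp, mulL_one]

theorem mulL_exp_exp_neg (a : ℝ →ᵇ ℝ) (f : L2 ℂ) :
    mulL (NormedSpace.exp a) (mulL (NormedSpace.exp (-a)) f) = f := by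
  rw [← mulL_mul, mul_comm, exp_neg_mul_exp, mulL_one]

theorem inner_mulL (a : ℝ →ᵇ ℝ) (f g : L2 ℂ) : inner ℂ (mulL a f) g = inner ℂ f (mulL a g) := by
  rw [L2.inner_def, L2.inner_def]
  apply integral_congr_ae
  filter_upwards [mulL_ae a f, mulL_ae a g] with x h1 h2
  rw [h1, h2, RCLike.inner_apply, RCLike.inner_apply, map_mul, Complex.conj_ofReal]
  ring

theorem eq_zero_of_inner_mulL_exp {a : ℝ →ᵇ ℝ} {f : L2 ℂ}
    (h : inner ℂ f (mulL (NormedSpace.exp a) f) = 0) : f = 0 := by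
  set b : ℝ →ᵇ ℝ := (1 / 2 : ℝ) • a with hb
  have e : NormedSpace.exp a = NormedSpace.exp b * NormedSpace.exp b := by
    ext x
    rw [BoundedContinuousFunction.mul_apply, exp_apply_bcf, exp_apply_bcf, ← Real.exp_add, hb,
      BoundedContinuousFunction.smul_apply, smul_eq_mul]
    congr 1; ring
  rw [e, mulL_mul, ← inner_mulL, inner_self_eq_zero] at h
  rw [← mulL_exp_neg_exp b f, h, map_zero]

/-! ### The divergence form of the Lax operator -/

/-- Integration by parts. -/
theorem IsWeakDeriv.inner_eq {σ : ℝ} (hσ : σ = 1 ∨ σ = -1) {f f' g g' : L2 ℂ}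
    (hf : IsWeakDeriv σ f f') (hg : IsWeakDeriv σ g g') : inner ℂ f' g = -inner ℂ f g' := by
  obtain ⟨F, hF, hfF⟩ := hf.exists_perAC hσ
  obtain ⟨K, hK, hgK⟩ := hg.exists_perAC hσ
  have h := (((hF.clm (Complex.conjCLE : ℂ →L[ℝ] ℂ)).mul hK).of_eq (sigma_sq hσ)).integral_eq_zero
  rw [eq_neg_iff_add_eq_zero, L2.inner_def, L2.inner_def, ← integral_add
    (L2.integrable_inner f' g) (L2.integrable_inner f g'), ← h]
  apply integral_congr_ae
  filter_upwards [hfF, hgK] with x h1 h2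
  rw [RCLike.inner_apply, RCLike.inner_apply, h1, h2]
  simp only [ContinuousLinearEquiv.coe_coe, Complex.conjCLE_apply]
  ring

/-- `-(e^{-a} (e^a f')') = k` with (anti-)periodic boundary conditions, as a first order system. -/
def DivForm (σ : ℝ) (a : ℝ →ᵇ ℝ) (f k : L2 ℂ) : Prop :=
  ∃ g : L2 ℂ, IsWeakDeriv σ f (mulL (NormedSpace.exp (-a)) g) ∧
    IsWeakDeriv σ g (-mulL (NormedSpace.exp a) k)

theorem perAC_exp_ofReal {a : ℝ →ᵇ ℝ} {w : ℝ → ℝ} (ha : PerAC 1 a w) :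
    PerAC 1 (fun x => (NormedSpace.exp a x : ℂ)) (fun x => (w x : ℂ) * (NormedSpace.exp a x : ℂ)) := by
  have h := ha.exp.clm (𝕜' := ℂ) Complex.ofRealCLM
  simpa [exp_apply_bcf] using h

theorem perAC_exp_neg_ofReal {a : ℝ →ᵇ ℝ} {w : ℝ → ℝ} (ha : PerAC 1 a w) :
    PerAC 1 (fun x => (NormedSpace.exp (-a) x : ℂ))
      (fun x => -(w x : ℂ) * (NormedSpace.exp (-a) x : ℂ)) := by
  have h := ((ha.const_smul (-1)).exp).clm (𝕜' := ℂ) Complex.ofRealCLM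
  simpa [exp_apply_bcf] using h

/-- The Lax operator in divergence form: `L_M(v) f = -e^{-a} (e^a f')'` where `a' = 2 v`. -/
theorem mem_laxGraph_iff {m : ℕ} {v : H0 m} {σ : ℝ} (hσ : σ = 1 ∨ σ = -1) {a : ℝ →ᵇ ℝ}
    (ha : PerAC 1 a (fun x => 2 * fn0 v x)) (f k : L2 ℂ) :
    (f, k) ∈ laxGraph v σ ↔ DivForm σ a f k := by
  constructor
  · rintro ⟨f₁, f₂, h1, h2, h3⟩
    refine ⟨mulL (NormedSpace.exp a) f₁, by rw [mulL_exp_neg_exp]; exact h1, ?_⟩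
    obtain ⟨F, hF, hfF⟩ := h2.exists_perAC hσ
    refine ((perAC_exp_ofReal ha).mul hF).of_eq (one_mul σ) |>.isWeakDeriv (sigma_sq hσ) ?_ ?_
    · filter_upwards [mulL_ae (NormedSpace.exp a) f₁, hfF] with x h4 h5
      rw [h4, h5]
    · filter_upwards [Lp.coeFn_neg (mulL (NormedSpace.exp a) k), mulL_ae (NormedSpace.exp a) k,
        h3, hfF] with x h4 h5 h6 h7
      rw [h4, Pi.neg_apply, h5]
      rw [show (k : ℝ → ℂ) x = _ from h6, h7]
      push_cast; ring
  · rintro ⟨g, h1, h2⟩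
    obtain ⟨K, hK, hgK⟩ := h2.exists_perAC hσ
    have hp := ((perAC_exp_neg_ofReal ha).mul hK).of_eq (one_mul σ)
    have hw : IsWeakDeriv σ (mulL (NormedSpace.exp (-a)) g) (hp.memLp.toLp _) := by
      refine hp.isWeakDeriv (sigma_sq hσ) ?_ hp.memLp.coeFn_toLp
      filter_upwards [mulL_ae (NormedSpace.exp (-a)) g, hgK] with x h4 h5
      rw [h4, h5]
    refine ⟨_, _, h1, hw, ?_⟩
    filter_upwards [hp.memLp.coeFn_toLp, Lp.coeFn_neg (mulL (NormedSpace.exp a) k),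
      mulL_ae (NormedSpace.exp a) k, mulL_ae (NormedSpace.exp (-a)) g, hgK] with x h3 h4 h5 h6 h7
    rw [h3, h4, Pi.neg_apply, h5, h6, h7]
    have e : (NormedSpace.exp (-a) x : ℂ) * (NormedSpace.exp a x : ℂ) = 1 := by
      rw [← Complex.ofReal_mul, ← BoundedContinuousFunction.mul_apply, exp_neg_mul_exp]; simp
    change (k : ℝ → ℂ) x = _
    push_cast
    linear_combination (-(k : ℝ → ℂ) x) * e

theorem laxKer_one_iff {m : ℕ} {v : H0 m} {σ : ℝ} {lam : ℂ} {f : L2 ℂ} :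
    f ∈ laxKer v σ lam 1 ↔ (f, lam • f) ∈ laxGraph v σ := by
  constructor
  · rintro ⟨h, hh, hf⟩
    have : h = 0 := hh
    rwa [this, add_zero] at hf
  · intro h
    exact ⟨0, zero_mem _, by rwa [add_zero]⟩

section SelfAdjoint

variable {σ : ℝ} {a : ℝ →ᵇ ℝ}

/-- The quadratic form of `-e^{-a} ∂ₓ e^a ∂ₓ` with respect to the weight `e^a`. -/
theorem divForm_inner (hσ : σ = 1 ∨ σ = -1) {f k g h : L2 ℂ}
    (hg : IsWeakDeriv σ g (-mulL (NormedSpace.exp a) k))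
    (hf : IsWeakDeriv σ f (mulL (NormedSpace.exp (-a)) h)) :
    inner ℂ f (mulL (NormedSpace.exp a) k) = inner ℂ h (mulL (NormedSpace.exp (-a)) g) := by
  have := hf.inner_eq hσ hg
  rw [inner_neg_right, neg_neg] at this
  rw [← this, inner_mulL]

/-- The operator `-e^{-a} ∂ₓ e^a ∂ₓ` is symmetric with respect to the weight `e^a`; hence it has no
Jordan chains of length two. -/
theorem DivForm.no_jordan_chain (hσ : σ = 1 ∨ σ = -1) {lam : ℂ} {f h : L2 ℂ}
    (hf : DivForm σ a f (lam • f + h)) (hh : DivForm σ a h (lam • h)) : h = 0 := by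
  obtain ⟨gf, f1, f2⟩ := hf
  obtain ⟨gh, h1, h2⟩ := hh
  have e1 := divForm_inner hσ f2 h1
  have e2 := divForm_inner hσ h2 f1
  have e3 := divForm_inner hσ h2 h1
  have s1 : inner ℂ gh (mulL (NormedSpace.exp (-a)) gf)
      = (starRingEnd ℂ) (inner ℂ gf (mulL (NormedSpace.exp (-a)) gh)) := by
    rw [inner_conj_symm, inner_mulL]
  have s2 : (starRingEnd ℂ) (inner ℂ f (mulL (NormedSpace.exp a) h))
      = inner ℂ h (mulL (NormedSpace.exp a) f) := by
    rw [inner_conj_symm, inner_mulL]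
  have s3 : (starRingEnd ℂ) (inner ℂ h (mulL (NormedSpace.exp a) h))
      = inner ℂ h (mulL (NormedSpace.exp a) h) := by
    rw [inner_conj_symm, inner_mulL]
  have s4 : (starRingEnd ℂ) (inner ℂ gh (mulL (NormedSpace.exp (-a)) gh))
      = inner ℂ gh (mulL (NormedSpace.exp (-a)) gh) := by
    rw [inner_conj_symm, inner_mulL]
  rw [map_add, map_smul, inner_add_right, inner_smul_right, s1, ← e2, map_smul, inner_smul_right,
    map_mul, s2] at e1
  rw [map_smul, inner_smul_right] at e3
  apply eq_zero_of_inner_mulL_exp (a := a)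
  rw [← e3, map_mul, s3] at s4
  by_contra hne
  have hl : (starRingEnd ℂ) lam = lam := mul_right_cancel₀ hne s4
  rw [hl] at e1
  exact hne (by linear_combination e1)

theorem divForm_zero_iff (hσ : σ = 1 ∨ σ = -1) {f : L2 ℂ} :
    DivForm σ a f 0 ↔ IsWeakDeriv σ f 0 := by
  constructor
  · rintro ⟨g, h1, h2⟩
    have e := divForm_inner hσ h2 h1
    rw [map_zero, inner_zero_right] at e
    have hg := eq_zero_of_inner_mulL_exp e.symm
    rwa [hg, map_zero] at h1
  · intro h
    refine ⟨0, by rwa [map_zero], ?_⟩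
    rw [map_zero, neg_zero]
    exact isWeakDeriv_zero σ

end SelfAdjoint

/-- All generalized eigenfunctions of the Lax operator are eigenfunctions. -/
theorem iSup_laxKer {m : ℕ} {v : H0 m} {σ : ℝ} (hσ : σ = 1 ∨ σ = -1) {a : ℝ →ᵇ ℝ}
    (ha : PerAC 1 a (fun x => 2 * fn0 v x)) (lam : ℂ) :
    (⨆ k : ℕ, laxKer v σ lam k) = laxKer v σ lam 1 := by
  refine le_antisymm (iSup_le fun k => ?_) (le_iSup (laxKer v σ lam) 1)
  cases k with
  | zero => exact bot_le
  | succ n =>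
    induction n with
    | zero => exact le_rfl
    | succ n ih =>
      rintro f ⟨h, hh, hf⟩
      have h1 := laxKer_one_iff.1 (ih hh)
      rw [mem_laxGraph_iff hσ ha] at h1 hf
      rw [hf.no_jordan_chain hσ h1, add_zero] at hf
      rw [laxKer_one_iff, mem_laxGraph_iff hσ ha]
      exact hf

theorem laxMultiplicity_eq {m : ℕ} {v : H0 m} {σ : ℝ} (hσ : σ = 1 ∨ σ = -1) {a : ℝ →ᵇ ℝ}
    (ha : PerAC 1 a (fun x => 2 * fn0 v x)) (lam : ℂ) :
    laxMultiplicity v σ lam = Module.rank ℂ (laxKer v σ lam 1) := by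
  rw [laxMultiplicity, iSup_laxKer hσ ha]

/-- Anti-periodic functions, and periodic functions of mean zero, have antiderivatives. -/
theorem exists_isWeakDeriv {σ : ℝ} (hσ : σ = 1 ∨ σ = -1) (g : L2 ℂ)
    (h1 : σ = 1 → ∫ x, g x ∂circleMeasure = 0) : ∃ f : L2 ℂ, IsWeakDeriv σ f g := by
  obtain ⟨F, hF⟩ := exists_perAC hσ (Lp.memLp g) h1
  exact ⟨hF.memLp_fun.toLp F,
    hF.isWeakDeriv (sigma_sq hσ) hF.memLp_fun.coeFn_toLp Filter.EventuallyEq.rfl⟩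

/-! ### The eigenvalue zero -/

/-- The eigenspace of the eigenvalue zero does not depend on the potential. -/
theorem laxKer_zero_iff {m : ℕ} {v : H0 m} {σ : ℝ} (hσ : σ = 1 ∨ σ = -1) {a : ℝ →ᵇ ℝ}
    (ha : PerAC 1 a (fun x => 2 * fn0 v x)) {f : L2 ℂ} :
    f ∈ laxKer v σ 0 1 ↔ IsWeakDeriv σ f 0 := by
  rw [laxKer_one_iff, mem_laxGraph_iff hσ ha, zero_smul, divForm_zero_iff hσ]

/-- Zero is a periodic eigenvalue, with the constant functions as eigenfunctions. -/
theorem zero_mem_laxSpectrum_periodic {m : ℕ} {v : H0 m} {a : ℝ →ᵇ ℝ}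
    (ha : PerAC 1 a (fun x => 2 * fn0 v x)) : (0 : ℂ) ∈ laxSpectrum v 1 := by
  intro H
  obtain ⟨f, -, hu⟩ := H 0
  have hone : IsWeakDeriv 1 (Lp.const 2 circleMeasure (1 : ℂ) : L2 ℂ) 0 :=
    (PerAC.const (σ := 1) (1 : ℂ) (by simp)).isWeakDeriv (by norm_num)
      (Lp.coeFn_const (p := 2) (μ := circleMeasure) (1 : ℂ)) (Lp.coeFn_zero _ _ _)
  have key : ∀ g : L2 ℂ, IsWeakDeriv 1 g 0 → g = f := fun g hg => hu g (by
    change (g, (0 : ℂ) • g + 0) ∈ laxGraph v 1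
    rw [zero_smul, add_zero, mem_laxGraph_iff (Or.inl rfl) ha, divForm_zero_iff (Or.inl rfl)]
    exact hg)
  have e := (key _ hone).trans (key 0 (isWeakDeriv_zero 1)).symm
  have e2 : (fun _ : ℝ => (1 : ℂ)) =ᵐ[circleMeasure] fun _ => 0 :=
    (Lp.coeFn_const (p := 2) (μ := circleMeasure) (1 : ℂ)).symm.trans
      (by rw [e]; exact Lp.coeFn_zero ℂ 2 circleMeasure)
  obtain ⟨x, hx⟩ := e2.exists
  exact one_ne_zero hx

/-- Zero is not in the anti-periodic spectrum, as anti-periodic functions have unique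
anti-periodic antiderivatives. -/
theorem zero_notMem_laxSpectrum_antiperiodic {m : ℕ} {v : H0 m} {a : ℝ →ᵇ ℝ}
    (ha : PerAC 1 a (fun x => 2 * fn0 v x)) : (0 : ℂ) ∉ laxSpectrum v (-1) := by
  have hσ : (-1 : ℝ) = 1 ∨ (-1 : ℝ) = -1 := Or.inr rfl
  refine not_not_intro fun h => ?_
  obtain ⟨g, hg⟩ := exists_isWeakDeriv hσ (-mulL (NormedSpace.exp a) h) (by norm_num)
  obtain ⟨f, hf⟩ := exists_isWeakDeriv hσ (mulL (NormedSpace.exp (-a)) g) (by norm_num)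
  refine ⟨f, ?_, fun f' hf' => ?_⟩
  · simp only [zero_smul, zero_add]
    rw [mem_laxGraph_iff hσ ha]
    exact ⟨g, hf, hg⟩
  · simp only [zero_smul, zero_add] at hf'
    rw [mem_laxGraph_iff hσ ha] at hf'
    obtain ⟨g', h1, h2⟩ := hf'
    have uniq : ∀ {p q r : L2 ℂ}, IsWeakDeriv (-1) p r → IsWeakDeriv (-1) q r → p = q := by
      intro p q r hp hq
      have hd : IsWeakDeriv (-1) (p - q) 0 := by
        have := hp.add (hq.smul (-1))
        simpa [sub_eq_add_neg] using this
      obtain ⟨c, hc, hc'⟩ := hd.ae_const hσ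
      have hc0 : c = 0 := by
        rw [neg_one_smul] at hc
        exact self_eq_neg.1 hc
      rw [← sub_eq_zero]
      apply Lp.ext
      refine hc'.trans ?_
      rw [hc0]
      exact (Lp.coeFn_zero ℂ 2 circleMeasure).symm
    obtain rfl := uniq h2 hg
    exact uniq h1 hf

/-! ### The Lax pair of the sinh-Gordon equation in abstract form -/

section FirstOrderSystem

variable {X L : Type*} [NormedAddCommGroup X] [NormedSpace ℂ X] [NormedAddCommGroup L]
  [NormedSpace ℂ L]

/-- The operator `(p, q) ↦ (δ p - B π q, δ q + λ A π p)`. -/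
def firstOrderSystem (π δ : X →L[ℂ] L) (lam : ℂ) (A B : L →L[ℂ] L) : (X × X) →L[ℂ] (L × L) :=
  (ContinuousLinearMap.inl ℂ L L).comp (δ.comp (ContinuousLinearMap.fst ℂ X X)
      - B.comp (π.comp (ContinuousLinearMap.snd ℂ X X)))
    + (ContinuousLinearMap.inr ℂ L L).comp (δ.comp (ContinuousLinearMap.snd ℂ X X)
      + A.comp (lam • π.comp (ContinuousLinearMap.fst ℂ X X)))

theorem firstOrderSystem_apply (π δ : X →L[ℂ] L) (lam : ℂ) (A B : L →L[ℂ] L) (y : X × X) :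
    firstOrderSystem π δ lam A B y = (δ y.1 - B (π y.2), δ y.2 + lam • A (π y.1)) := by
  simp [firstOrderSystem]

/-- The bounded generator of the evolution of the eigenfunctions under the sinh-Gordon flow; `M` is
multiplication by the time derivative of the solution. -/
def laxGen (lam : ℂ) (M : X →L[ℂ] X) : (X × X) →L[ℂ] (X × X) :=
  (ContinuousLinearMap.inl ℂ X X).comp
      (-((1 / 2 : ℂ) • M.comp (ContinuousLinearMap.fst ℂ X X))
        - (1 / (4 * lam)) • ContinuousLinearMap.snd ℂ X X)
    + (ContinuousLinearMap.inr ℂ X X).comp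
      ((1 / 4 : ℂ) • ContinuousLinearMap.fst ℂ X X
        + (1 / 2 : ℂ) • M.comp (ContinuousLinearMap.snd ℂ X X))

theorem laxGen_apply (lam : ℂ) (M : X →L[ℂ] X) (y : X × X) : laxGen lam M y =
    (-((1 / 2 : ℂ) • M y.1) - (1 / (4 * lam)) • y.2, (1 / 4 : ℂ) • y.1 + (1 / 2 : ℂ) • M y.2) := by
  simp [laxGen]

theorem continuous_laxGen (lam : ℂ) : Continuous (laxGen lam : (X →L[ℂ] X) → _) := by
  unfold laxGen
  fun_prop

/-- The operators `laxGen` form a Lax pair with the first order system: with `π` the inclusion of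
`H¹` into `L²`, `δ` the derivative, `A` and `B` multiplication by `e^u` and `e^{-u}`, and `M` and
`N` multiplication by `u_t`, the last hypothesis is the sinh-Gordon equation `u_{tx} = sinh u`. -/
theorem exists_firstOrderSystem_intertwining [NormedSpace ℝ L] [IsScalarTower ℝ ℂ L]
    [CompleteSpace X] [CompleteSpace L] {π δ : X →L[ℂ] L} {lam : ℂ} (hlam : lam ≠ 0) {J : Set ℝ}
    (hJ : J.OrdConnected) {A B N : ℝ → L →L[ℂ] L} {M : ℝ → X →L[ℂ] X}
    (hM : ContinuousOn M J) (hN : ContinuousOn N J)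
    (hA : ∀ t ∈ J, HasDerivWithinAt A ((A t).comp (N t)) J t)
    (hB : ∀ t ∈ J, HasDerivWithinAt B (-(B t).comp (N t)) J t)
    (hAN : ∀ t ∈ J, ∀ x, A t (N t x) = N t (A t x))
    (hBN : ∀ t ∈ J, ∀ x, B t (N t x) = N t (B t x))
    (hπ : ∀ t ∈ J, ∀ p, π (M t p) = N t (π p))
    (hδ : ∀ t ∈ J, ∀ p, δ (M t p) = (1 / 2 : ℂ) • (A t (π p) - B t (π p)) + N t (δ p))
    {s t : ℝ} (hs : s ∈ J) (ht : t ∈ J) :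
    ∃ (U : (X × X) ≃L[ℂ] (X × X)) (V : (L × L) ≃L[ℂ] (L × L)), ∀ y,
      firstOrderSystem π δ lam (A t) (B t) (U y) = V (firstOrderSystem π δ lam (A s) (B s) y) := by
  refine exists_lax_intertwining hJ (TE := fun t => laxGen lam (M t)) (TF := fun t => laxGen lam (N t))
    (P := fun t => firstOrderSystem π δ lam (A t) (B t))
    (P' := fun t => firstOrderSystem π 0 lam ((A t).comp (N t)) (-(B t).comp (N t)))
    ((continuous_laxGen lam).comp_continuousOn hM) ((continuous_laxGen lam).comp_continuousOn hN)
    (fun t ht => ?_) (fun t ht => ?_) hs ht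
  · have h1 := hasDerivWithinAt_clm_comp (hasDerivWithinAt_const t J (ContinuousLinearMap.inl ℂ L L))
      ((hasDerivWithinAt_const t J (δ.comp (ContinuousLinearMap.fst ℂ X X))).sub
        (hasDerivWithinAt_clm_comp (hB t ht)
          (hasDerivWithinAt_const t J (π.comp (ContinuousLinearMap.snd ℂ X X)))))
    have h2 := hasDerivWithinAt_clm_comp (hasDerivWithinAt_const t J (ContinuousLinearMap.inr ℂ L L))
      ((hasDerivWithinAt_const t J (δ.comp (ContinuousLinearMap.snd ℂ X X))).add
        (hasDerivWithinAt_clm_comp (hA t ht)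
          (hasDerivWithinAt_const t J (lam • π.comp (ContinuousLinearMap.fst ℂ X X)))))
    refine (h1.add h2).congr_deriv ?_
    simp [firstOrderSystem]
  · have hl : lam * (1 / (4 * lam)) = 1 / 4 := by field_simp
    refine ContinuousLinearMap.ext fun y => ?_
    rw [add_apply, ContinuousLinearMap.comp_apply,
      ContinuousLinearMap.comp_apply, firstOrderSystem_apply, firstOrderSystem_apply,
      firstOrderSystem_apply, laxGen_apply, laxGen_apply]
    set μ := 1 / (4 * lam)
    simp only [map_add, map_sub, map_neg, map_smul, hπ t ht, hδ t ht,
      ContinuousLinearMap.comp_apply, neg_apply, zero_apply, hAN t ht, hBN t ht]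
    refine Prod.ext ?_ ?_
    · simp only [Prod.fst_add, smul_add, smul_smul, mul_comm μ lam, hl]
      module
    · simp only [Prod.snd_add, smul_add, smul_sub, smul_smul, hl]
      module

end FirstOrderSystem

/-! ### The Lax pair of the sinh-Gordon equation -/

/-- The space `H¹` of complex (anti-)periodic functions, as the graph of the weak derivative. -/
def graphD (σ : ℝ) : Submodule ℂ (L2 ℂ × L2 ℂ) where
  carrier := {p | IsWeakDeriv σ p.1 p.2}
  zero_mem' := isWeakDeriv_zero σ
  add_mem' := fun h h' => IsWeakDeriv.add h h'
  smul_mem' := fun c _ h => IsWeakDeriv.smul c h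

theorem isClosed_graphD (σ : ℝ) : IsClosed (graphD σ : Set (L2 ℂ × L2 ℂ)) := by
  have e : (graphD σ : Set (L2 ℂ × L2 ℂ)) = ⋂ (φ : ℝ → ℝ) (_ : ContDiff ℝ ∞ φ)
      (_ : ∀ x, φ (x + 1) = σ * φ x), {p | ∫ x, deriv φ x • p.1 x ∂circleMeasure
        = -∫ x, φ x • p.2 x ∂circleMeasure} := by
    ext p
    simp only [mem_iInter, mem_ofPred_eq]
    rfl
  rw [e]
  refine isClosed_iInter fun φ => isClosed_iInter fun hφ => isClosed_iInter fun _ => ?_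
  exact isClosed_eq
    ((continuous_integral_smul (hφ.continuous_deriv (by simp))).comp continuous_fst)
    ((continuous_integral_smul hφ.continuous).comp continuous_snd).neg

instance (σ : ℝ) : CompleteSpace (graphD σ) := (isClosed_graphD σ).completeSpace_coe

section

variable {σ : ℝ} {m : ℕ}

theorem ae_norm_le_of_graphD (hσ : σ = 1 ∨ σ = -1) (p : graphD σ) :
    ∀ᵐ x ∂circleMeasure, ‖(p : L2 ℂ × L2 ℂ).1 x‖ ≤ 2 * ‖p‖ := by
  obtain ⟨F, hF, hfF⟩ := IsWeakDeriv.exists_perAC hσ p.2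
  filter_upwards [hfF, ae_restrict_mem measurableSet_Ioc] with x h1 h2
  rw [h1]
  refine (hF.norm_le hfF Filter.EventuallyEq.rfl (Ioc_subset_Icc_self h2)).trans ?_
  have h3 : ‖(p : L2 ℂ × L2 ℂ).1‖ ≤ ‖p‖ := norm_fst_le (p : L2 ℂ × L2 ℂ)
  have h4 : ‖(p : L2 ℂ × L2 ℂ).2‖ ≤ ‖p‖ := norm_snd_le (p : L2 ℂ × L2 ℂ)
  linarith

theorem memLp_mul_graphD (hσ : σ = 1 ∨ σ = -1) (w : L2 ℝ) (p : graphD σ) :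
    MemLp (fun x => (w x : ℂ) * (p : L2 ℂ × L2 ℂ).1 x) 2 circleMeasure := by
  refine (Lp.memLp w).of_le_mul (c := 2 * ‖p‖) ?_ ?_
  · exact (Complex.continuous_ofReal.comp_aestronglyMeasurable (Lp.aestronglyMeasurable w)).mul
      (Lp.aestronglyMeasurable _)
  · filter_upwards [ae_norm_le_of_graphD hσ p] with x hx
    rw [norm_mul, Complex.norm_real, mul_comm]
    exact mul_le_mul_of_nonneg_right hx (norm_nonneg _)

/-- The product of a real `L²` function and a complex (anti-)periodic `H¹` function. -/
def mulGraphD (hσ : σ = 1 ∨ σ = -1) (w : L2 ℝ) (p : graphD σ) : L2 ℂ :=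
  (memLp_mul_graphD hσ w p).toLp _

theorem mulGraphD_ae (hσ : σ = 1 ∨ σ = -1) (w : L2 ℝ) (p : graphD σ) :
    mulGraphD hσ w p =ᵐ[circleMeasure] fun x => (w x : ℂ) * (p : L2 ℂ × L2 ℂ).1 x :=
  (memLp_mul_graphD hσ w p).coeFn_toLp

theorem norm_mulGraphD_le (hσ : σ = 1 ∨ σ = -1) (w : L2 ℝ) (p : graphD σ) :
    ‖mulGraphD hσ w p‖ ≤ 2 * ‖p‖ * ‖w‖ := by
  refine Lp.norm_le_mul_norm_of_ae_le_mul ?_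
  filter_upwards [mulGraphD_ae hσ w p, ae_norm_le_of_graphD hσ p] with x hx h2
  rw [hx, norm_mul, Complex.norm_real, mul_comm]
  exact mul_le_mul_of_nonneg_right h2 (norm_nonneg _)

/-- Multiplication of complex (anti-)periodic `H¹` functions by an element of `H^{m+1}`. -/
def multFun (hσ : σ = 1 ∨ σ = -1) (b : H (m + 1)) (p : graphD σ) : graphD σ :=
  ⟨(mulL (evalC m b) (p : L2 ℂ × L2 ℂ).1,
    mulGraphD hσ (toL2 (dx b)) p + mulL (evalC m b) (p : L2 ℂ × L2 ℂ).2), by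
    obtain ⟨F, hF, hfF⟩ := IsWeakDeriv.exists_perAC hσ p.2
    have h := (((perAC_evalC b).clm (𝕜' := ℂ) Complex.ofRealCLM).mul hF).of_eq (one_mul σ)
    refine h.isWeakDeriv (sigma_sq hσ) ?_ ?_
    · filter_upwards [mulL_ae (evalC m b) (p : L2 ℂ × L2 ℂ).1, hfF] with x h1 h2
      rw [h1, h2]; rfl
    · filter_upwards [Lp.coeFn_add (mulGraphD hσ (toL2 (dx b)) p)
        (mulL (evalC m b) (p : L2 ℂ × L2 ℂ).2), mulGraphD_ae hσ (toL2 (dx b)) p,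
        mulL_ae (evalC m b) (p : L2 ℂ × L2 ℂ).2, hfF] with x h1 h2 h3 h4
      rw [h1, Pi.add_apply, h2, h3, h4]; rfl⟩

theorem norm_evalC_le (b : H (m + 1)) : ‖evalC m b‖ ≤ 2 * ‖b‖ :=
  (BoundedContinuousFunction.norm_le (by positivity)).2 fun x =>
    abs_rep_le' b (projIcc (0 : ℝ) 1 zero_le_one x).2

theorem norm_multFun_le (hσ : σ = 1 ∨ σ = -1) (b : H (m + 1)) (p : graphD σ) :
    ‖multFun hσ b p‖ ≤ 4 * ‖b‖ * ‖p‖ := by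
  have h1 : ‖(p : L2 ℂ × L2 ℂ).1‖ ≤ ‖p‖ := norm_fst_le (p : L2 ℂ × L2 ℂ)
  have h2 : ‖(p : L2 ℂ × L2 ℂ).2‖ ≤ ‖p‖ := norm_snd_le (p : L2 ℂ × L2 ℂ)
  have key : ∀ f : L2 ℂ, ‖f‖ ≤ ‖p‖ → ‖mulL (evalC m b) f‖ ≤ 2 * ‖b‖ * ‖p‖ := fun f hf =>
    (norm_mulFun_le _ _).trans (mul_le_mul (norm_evalC_le b) hf (norm_nonneg _) (by positivity))
  have h3 : 0 ≤ ‖b‖ * ‖p‖ := by positivity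
  refine max_le ((key _ h1).trans (by linarith)) ((norm_add_le _ _).trans ?_)
  have h4 := norm_mulGraphD_le hσ (toL2 (dx b)) p
  have h5 := key _ h2
  have h6 : 2 * ‖p‖ * ‖toL2 (dx b)‖ ≤ 2 * ‖p‖ * ‖b‖ :=
    mul_le_mul_of_nonneg_left (norm_dx_le b) (by positivity)
  linarith

/-- Multiplication by a fixed element of `H^{m+1}`, as a bounded operator on complex
(anti-)periodic `H¹` functions. -/
def multOp (hσ : σ = 1 ∨ σ = -1) (b : H (m + 1)) : graphD σ →L[ℂ] graphD σ :=
  LinearMap.mkContinuous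
    { toFun := multFun hσ b
      map_add' := fun p q => by
        refine Subtype.ext (Prod.ext (map_add (mulL (evalC m b)) _ _) ?_)
        change mulGraphD hσ (toL2 (dx b)) (p + q) + mulL (evalC m b) (_ + _) = (_ + _) + (_ + _)
        rw [map_add, add_add_add_comm]
        congr 1
        apply Lp.ext
        filter_upwards [mulGraphD_ae hσ (toL2 (dx b)) (p + q),
          mulGraphD_ae hσ (toL2 (dx b)) p, mulGraphD_ae hσ (toL2 (dx b)) q,
          Lp.coeFn_add (p : L2 ℂ × L2 ℂ).1 (q : L2 ℂ × L2 ℂ).1,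
          Lp.coeFn_add (mulGraphD hσ (toL2 (dx b)) p) (mulGraphD hσ (toL2 (dx b)) q)]
          with x h1 h2 h3 h4 h5
        rw [h1, h5, Pi.add_apply, h2, h3, Submodule.coe_add, Prod.fst_add, h4, Pi.add_apply,
          mul_add]
      map_smul' := fun c p => by
        refine Subtype.ext (Prod.ext ((mulL (evalC m b)).map_smul c _) ?_)
        change mulGraphD hσ (toL2 (dx b)) (c • p) + mulL (evalC m b) (c • _) = c • (_ + _)
        rw [map_smul, smul_add]
        congr 1
        apply Lp.ext
        filter_upwards [mulGraphD_ae hσ (toL2 (dx b)) (c • p),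
          mulGraphD_ae hσ (toL2 (dx b)) p, Lp.coeFn_smul c (p : L2 ℂ × L2 ℂ).1,
          Lp.coeFn_smul c (mulGraphD hσ (toL2 (dx b)) p)] with x h1 h2 h3 h4
        rw [h1, h4, Pi.smul_apply, h2, Submodule.coe_smul, Prod.smul_fst, h3, Pi.smul_apply,
          smul_eq_mul, smul_eq_mul]
        ring }
    (4 * ‖b‖) (norm_multFun_le hσ b)

/-- Multiplication of complex (anti-)periodic `H¹` functions by elements of `H^{m+1}`, as a
continuous linear map into the bounded operators. -/
def multH (hσ : σ = 1 ∨ σ = -1) (m : ℕ) : H (m + 1) →L[ℝ] (graphD σ →L[ℂ] graphD σ) :=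
  LinearMap.mkContinuous
    { toFun := multOp hσ
      map_add' := fun b c => by
        refine ContinuousLinearMap.ext fun p => Subtype.ext (Prod.ext ?_ ?_)
        · change mulL (evalC m (b + c)) _ = mulL (evalC m b) _ + mulL (evalC m c) _
          rw [map_add, map_add]; rfl
        · change mulGraphD hσ (toL2 (dx (b + c))) p + mulL (evalC m (b + c)) _
            = (_ + mulL (evalC m b) _) + (_ + mulL (evalC m c) _)
          rw [map_add, map_add, add_add_add_comm]
          congr 1
          apply Lp.ext
          filter_upwards [mulGraphD_ae hσ (toL2 (dx (b + c))) p, mulGraphD_ae hσ (toL2 (dx b)) p,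
            mulGraphD_ae hσ (toL2 (dx c)) p, Lp.coeFn_add (toL2 (dx b)) (toL2 (dx c)),
            Lp.coeFn_add (mulGraphD hσ (toL2 (dx b)) p) (mulGraphD hσ (toL2 (dx c)) p)]
            with x h1 h2 h3 h4 h5
          have h4' : toL2 (dx (b + c)) x = _ := h4
          rw [h1, h5, Pi.add_apply, h2, h3, h4', Pi.add_apply]
          push_cast; ring
      map_smul' := fun r b => by
        refine ContinuousLinearMap.ext fun p => Subtype.ext (Prod.ext ?_ ?_)
        · change mulL (evalC m (r • b)) _ = r • mulL (evalC m b) _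
          rw [map_smul, map_smul]; rfl
        · change mulGraphD hσ (toL2 (dx (r • b))) p + mulL (evalC m (r • b)) _
            = r • (_ + mulL (evalC m b) _)
          rw [map_smul, map_smul, smul_add]
          congr 1
          apply Lp.ext
          filter_upwards [mulGraphD_ae hσ (toL2 (dx (r • b))) p, mulGraphD_ae hσ (toL2 (dx b)) p,
            Lp.coeFn_smul r (toL2 (dx b)), Lp.coeFn_smul r (mulGraphD hσ (toL2 (dx b)) p)]
            with x h1 h2 h3 h4
          have h3' : toL2 (dx (r • b)) x = _ := h3
          rw [h1, h4, Pi.smul_apply, h2, h3', Pi.smul_apply, Complex.real_smul, smul_eq_mul]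
          push_cast; ring }
    4 (fun b => LinearMap.mkContinuous_norm_le _ (by positivity) (norm_multFun_le hσ b))

theorem multH_fst (hσ : σ = 1 ∨ σ = -1) (b : H (m + 1)) (p : graphD σ) :
    (multH hσ m b p : L2 ℂ × L2 ℂ).1 = mulL (evalC m b) (p : L2 ℂ × L2 ℂ).1 := rfl

theorem multH_snd (hσ : σ = 1 ∨ σ = -1) (b : H (m + 1)) {c : ℝ →ᵇ ℝ}
    (hc : fn (dx b) =ᵐ[circleMeasure] c) (p : graphD σ) :
    (multH hσ m b p : L2 ℂ × L2 ℂ).2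
      = mulL c (p : L2 ℂ × L2 ℂ).1 + mulL (evalC m b) (p : L2 ℂ × L2 ℂ).2 := by
  change mulGraphD hσ (toL2 (dx b)) p + mulL (evalC m b) _ = _
  congr 1
  apply Lp.ext
  filter_upwards [mulGraphD_ae hσ (toL2 (dx b)) p, mulL_ae c (p : L2 ℂ × L2 ℂ).1, hc] with x h1 h2 h3
  rw [h1, h2, ← h3]; rfl

/-- The function component `H¹ → L²`. -/
def graphFst (σ : ℝ) : graphD σ →L[ℂ] L2 ℂ :=
  (ContinuousLinearMap.fst ℂ (L2 ℂ) (L2 ℂ)).comp (graphD σ).subtypeL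

/-- The weak derivative `H¹ → L²`. -/
def graphSnd (σ : ℝ) : graphD σ →L[ℂ] L2 ℂ :=
  (ContinuousLinearMap.snd ℂ (L2 ℂ) (L2 ℂ)).comp (graphD σ).subtypeL

/-- The first order system `(f, g) ↦ (f' - e^{-a} g, g' + λ e^a f)` equivalent to the eigenvalue
equation of the Lax operator in divergence form. -/
def laxOp (σ : ℝ) (lam : ℂ) (a : ℝ →ᵇ ℝ) : (graphD σ × graphD σ) →L[ℂ] (L2 ℂ × L2 ℂ) :=
  firstOrderSystem (graphFst σ) (graphSnd σ) lam (mulL (NormedSpace.exp a))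
    (mulL (NormedSpace.exp (-a)))

theorem laxOp_apply (lam : ℂ) (a : ℝ →ᵇ ℝ) (y : graphD σ × graphD σ) :
    laxOp σ lam a y = (graphSnd σ y.1 - mulL (NormedSpace.exp (-a)) (graphFst σ y.2),
      graphSnd σ y.2 + lam • mulL (NormedSpace.exp a) (graphFst σ y.1)) :=
  firstOrderSystem_apply _ _ _ _ _ _

theorem mulL_comm (a b : ℝ →ᵇ ℝ) (f : L2 ℂ) : mulL a (mulL b f) = mulL b (mulL a f) := by
  rw [← mulL_mul, mul_comm, mulL_mul]

theorem mulL_sinhC (a : ℝ →ᵇ ℝ) (f : L2 ℂ) : mulL (sinhC a) f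
    = (1 / 2 : ℂ) • (mulL (NormedSpace.exp a) f - mulL (NormedSpace.exp (-a)) f) := by
  apply Lp.ext
  filter_upwards [mulL_ae (sinhC a) f, mulL_ae (NormedSpace.exp a) f,
    mulL_ae (NormedSpace.exp (-a)) f,
    Lp.coeFn_smul (1 / 2 : ℂ) (mulL (NormedSpace.exp a) f - mulL (NormedSpace.exp (-a)) f),
    Lp.coeFn_sub (mulL (NormedSpace.exp a) f) (mulL (NormedSpace.exp (-a)) f)] with x h1 h2 h3 h4 h5
  rw [h1, h4, Pi.smul_apply, h5, Pi.sub_apply, h2, h3, sinhC, BoundedContinuousFunction.smul_apply,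
    BoundedContinuousFunction.sub_apply, smul_eq_mul, smul_eq_mul]
  push_cast
  ring

/-- Along a curve `u` in `H^{m+1}` with `u_{xt} = sinh u`, all the operators `laxOp` are
equivalent. -/
theorem exists_laxOp_intertwining (hσ : σ = 1 ∨ σ = -1) {lam : ℂ} (hlam : lam ≠ 0) {J : Set ℝ}
    (hJ : J.OrdConnected) {u u' : ℝ → H (m + 1)} (hu : IsC1Curve J u u')
    (heq : ∀ t ∈ J, fn (dx (u' t)) =ᵐ[circleMeasure] sinhC (evalC m (u t)))
    {s t : ℝ} (hs : s ∈ J) (ht : t ∈ J) :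
    ∃ (U : (graphD σ × graphD σ) ≃L[ℂ] (graphD σ × graphD σ))
      (V : (L2 ℂ × L2 ℂ) ≃L[ℂ] (L2 ℂ × L2 ℂ)),
      ∀ y, laxOp σ lam (evalC m (u t)) (U y) = V (laxOp σ lam (evalC m (u s)) y) := by
  have hE : ∀ t ∈ J, HasDerivWithinAt (fun t => evalC m (u t)) (evalC m (u' t)) J t := fun t ht =>
    (evalC m).hasFDerivAt.comp_hasDerivWithinAt t (hu.2 t ht)
  refine exists_firstOrderSystem_intertwining hlam hJ (M := fun t => multH hσ m (u' t))
    (N := fun t => mulL (evalC m (u' t)))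
    (A := fun t => mulL (NormedSpace.exp (evalC m (u t))))
    (B := fun t => mulL (NormedSpace.exp (-(evalC m (u t))))) ?_ ?_ ?_ ?_ ?_ ?_ ?_ ?_ hs ht
  · exact (multH hσ m).continuous.comp_continuousOn hu.1
  · exact (mulL.continuous.comp (evalC m).continuous).comp_continuousOn hu.1
  · intro t ht
    have h := mulL.hasFDerivAt.comp_hasDerivWithinAt t
      ((hasFDerivAt_exp (𝕂 := ℝ) (x := evalC m (u t))).comp_hasDerivWithinAt t (hE t ht))
    refine h.congr_deriv (ContinuousLinearMap.ext fun f => ?_)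
    exact mulL_mul _ _ f
  · intro t ht
    have h := mulL.hasFDerivAt.comp_hasDerivWithinAt t
      ((hasFDerivAt_exp_neg (evalC m (u t))).comp_hasDerivWithinAt t (hE t ht))
    refine h.congr_deriv (ContinuousLinearMap.ext fun f => ?_)
    change mulL (-(NormedSpace.exp (-(evalC m (u t))) * evalC m (u' t))) f = -_
    rw [map_neg]
    exact congrArg Neg.neg (mulL_mul _ _ f)
  · exact fun t _ f => mulL_comm _ _ f
  · exact fun t _ f => mulL_comm _ _ f
  · exact fun t _ p => multH_fst hσ (u' t) p
  · intro t ht p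
    rw [← mulL_sinhC]
    exact multH_snd hσ (u' t) (heq t ht) p

end

/-! ### The Lax spectrum in terms of the first order system -/

section

variable {σ : ℝ} {m : ℕ} {v : H0 m} {a : ℝ →ᵇ ℝ} {lam : ℂ}

theorem graphFst_injective (hσ : σ = 1 ∨ σ = -1) : Injective (graphFst σ) := by
  intro p q h
  have hp : IsWeakDeriv σ (graphFst σ p) (graphSnd σ p) := p.2
  have hq : IsWeakDeriv σ (graphFst σ q) (graphSnd σ q) := q.2
  rw [h] at hp
  exact Subtype.ext (Prod.ext h (hp.unique hσ hq))

/-- If the first equation `f' = e^{-a} g` holds with `f = 0`, then `g = 0`. -/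
theorem eq_zero_of_laxOp (hσ : σ = 1 ∨ σ = -1) {y : graphD σ × graphD σ}
    (h1 : graphFst σ y.1 = 0) (h2 : (laxOp σ lam a y).1 = 0) : y = 0 := by
  have h3 : y.1 = 0 := graphFst_injective hσ (by rw [h1, map_zero])
  rw [laxOp_apply, h3] at h2
  have h4 : mulL (NormedSpace.exp (-a)) (graphFst σ y.2) = 0 := by simpa using h2
  refine Prod.ext h3 (graphFst_injective hσ ?_)
  rw [← mulL_exp_exp_neg a (graphFst σ y.2), h4, map_zero, Prod.snd_zero, map_zero]

theorem mem_laxGraph_iff_laxOp (hσ : σ = 1 ∨ σ = -1) (ha : PerAC 1 a (fun x => 2 * fn0 v x))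
    (f h : L2 ℂ) : (f, lam • f + h) ∈ laxGraph v σ ↔
      ∃ y : graphD σ × graphD σ, graphFst σ y.1 = f ∧
        laxOp σ lam a y = (0, -mulL (NormedSpace.exp a) h) := by
  rw [mem_laxGraph_iff hσ ha]
  constructor
  · rintro ⟨g, h1, h2⟩
    refine ⟨(⟨(_, _), h1⟩, ⟨(_, _), h2⟩), rfl, ?_⟩
    rw [laxOp_apply]
    change (mulL (NormedSpace.exp (-a)) g - mulL (NormedSpace.exp (-a)) g,
      -mulL (NormedSpace.exp a) (lam • f + h) + lam • mulL (NormedSpace.exp a) f) = _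
    rw [sub_self, map_add, map_smul]
    congr 1
    abel
  · rintro ⟨⟨p, q⟩, rfl, h2⟩
    rw [laxOp_apply, Prod.mk.injEq, sub_eq_zero] at h2
    refine ⟨graphFst σ q, ?_, ?_⟩
    · rw [← h2.1]; exact p.2
    · have e : -mulL (NormedSpace.exp a) (lam • graphFst σ p + h) = graphSnd σ q := by
        rw [map_add, map_smul, neg_add, ← h2.2]
        abel
      rw [e]; exact q.2

/-- The first equation of the first order system can be solved. In the periodic case the
solvability condition is met by adding a constant to `g`. -/
theorem exists_laxOp_fst (hσ : σ = 1 ∨ σ = -1) (p : L2 ℂ) :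
    ∃ y : graphD σ × graphD σ, (laxOp σ lam a y).1 = p := by
  obtain ⟨g, hg, hi⟩ : ∃ g : L2 ℂ, IsWeakDeriv σ g 0 ∧
      (σ = 1 → ∫ x, (p + mulL (NormedSpace.exp (-a)) g : L2 ℂ) x ∂circleMeasure = 0) := by
    rcases hσ with rfl | rfl
    · set I : ℝ := ∫ x, NormedSpace.exp (-a) x ∂circleMeasure with hI
      have hI0 : 0 < I := integC_exp_pos (-a)
      set k : ℂ := -(∫ x, p x ∂circleMeasure) / I with hk
      refine ⟨Lp.const 2 circleMeasure k, (PerAC.const (σ := 1) k (by simp)).isWeakDeriv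
        (by norm_num) (Lp.coeFn_const (p := 2) (μ := circleMeasure) k) (Lp.coeFn_zero _ _ _),
        fun _ => ?_⟩
      rw [integral_congr_ae (Lp.coeFn_add _ _)]
      change ∫ x, (p x + mulL (NormedSpace.exp (-a)) _ x) ∂circleMeasure = 0
      rw [integral_add (integrable_of_L2 p) (integrable_of_L2 _)]
      have e2 : ∫ x, mulL (NormedSpace.exp (-a)) (Lp.const 2 circleMeasure k : L2 ℂ) x
          ∂circleMeasure = I * k := by
        rw [hI, ← integral_complex_ofReal, ← integral_mul_const]
        apply integral_congr_ae
        filter_upwards [mulL_ae (NormedSpace.exp (-a)) (Lp.const 2 circleMeasure k : L2 ℂ),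
          Lp.coeFn_const (p := 2) (μ := circleMeasure) k] with x h1 h2
        rw [h1, h2, const_apply]
      have hI1 : (I : ℂ) ≠ 0 := Complex.ofReal_ne_zero.2 hI0.ne'
      rw [e2, hk, mul_div_cancel₀ _ hI1, add_neg_cancel]
    · exact ⟨0, isWeakDeriv_zero _, by norm_num⟩
  obtain ⟨f, hf⟩ := exists_isWeakDeriv hσ _ hi
  refine ⟨(⟨(_, _), hf⟩, ⟨(_, _), hg⟩), ?_⟩
  rw [laxOp_apply]
  exact add_sub_cancel_right _ _

/-- The resolvent equation of the Lax operator is the first order system with right-hand side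
`(0, q)`; the first component of a general right-hand side is removed by `exists_laxOp_fst`. -/
theorem notMem_laxSpectrum_iff (hσ : σ = 1 ∨ σ = -1) (ha : PerAC 1 a (fun x => 2 * fn0 v x)) :
    lam ∉ laxSpectrum v σ ↔ Bijective (laxOp σ lam a) := by
  have hs : lam ∉ laxSpectrum v σ ↔ ∀ h : L2 ℂ, ∃! f : L2 ℂ, (f, lam • f + h) ∈ laxGraph v σ :=
    not_not
  simp only [hs, mem_laxGraph_iff_laxOp hσ ha]
  constructor
  · refine fun H => ⟨(injective_iff_map_eq_zero _).2 fun y hy => ?_, fun ⟨p, q⟩ => ?_⟩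
    · refine eq_zero_of_laxOp hσ ?_ (congrArg Prod.fst hy)
      obtain ⟨f, -, hu⟩ := H 0
      have h0 : ((0 : L2 ℂ), -mulL (NormedSpace.exp a) (0 : L2 ℂ)) = 0 := by simp
      rw [hu _ ⟨y, rfl, by rw [hy, h0]⟩]
      exact (hu 0 ⟨0, by simp, by rw [map_zero, h0]⟩).symm
    · obtain ⟨y₀, hy₀⟩ := exists_laxOp_fst (lam := lam) (a := a) hσ p
      obtain ⟨f, ⟨y₁, -, hy₁⟩, -⟩ := H (-mulL (NormedSpace.exp (-a)) (q - (laxOp σ lam a y₀).2))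
      rw [map_neg, neg_neg, mulL_exp_exp_neg] at hy₁
      refine ⟨y₀ + y₁, ?_⟩
      rw [map_add, hy₁]
      refine Prod.ext ?_ (add_sub_cancel _ _)
      rw [Prod.fst_add, hy₀, add_zero]
  · rintro ⟨hi, hsurj⟩ h
    obtain ⟨y, hy⟩ := hsurj (0, -mulL (NormedSpace.exp a) h)
    refine ⟨graphFst σ y.1, ⟨y, rfl, hy⟩, ?_⟩
    rintro f ⟨z, rfl, hz⟩
    rw [hi (hz.trans hy.symm)]

/-- The map `(p, q) ↦ p` identifies the kernel of the first order system with the eigenspace. -/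
theorem rank_laxKer_eq (hσ : σ = 1 ∨ σ = -1) (ha : PerAC 1 a (fun x => 2 * fn0 v x)) :
    Module.rank ℂ (laxKer v σ lam 1) = Module.rank ℂ (LinearMap.ker (laxOp σ lam a).toLinearMap) := by
  set K := LinearMap.ker (laxOp σ lam a).toLinearMap with hK
  let T : K →ₗ[ℂ] L2 ℂ := ((graphFst σ).comp
    (ContinuousLinearMap.fst ℂ (graphD σ) (graphD σ))).toLinearMap.comp K.subtype
  have hT : Injective T := (injective_iff_map_eq_zero _).2 fun y hy =>
    ZeroMemClass.coe_eq_zero.1 (eq_zero_of_laxOp hσ hy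
      (congrArg Prod.fst (show laxOp σ lam a y = 0 from y.2)))
  have hr : LinearMap.range T = laxKer v σ lam 1 := by
    ext f
    rw [laxKer_one_iff, ← add_zero (lam • f), mem_laxGraph_iff_laxOp hσ ha, map_zero, neg_zero]
    constructor
    · rintro ⟨y, rfl⟩
      exact ⟨y, rfl, y.2⟩
    · rintro ⟨y, rfl, hy⟩
      exact ⟨⟨y, hy⟩, rfl⟩
  rw [← hr]
  exact (LinearEquiv.ofInjective T hT).rank_eq.symm

end

/-! ### Isospectrality of the sinh-Gordon flow -/

/-- The potential of the divergence form is `a = Ψ(v)`. -/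
theorem perAC_evalC_Psi {m : ℕ} (v : H0 m) : PerAC 1 (evalC m (Psi v)) (fun x => 2 * fn0 v x) := by
  refine (perAC_evalC (Psi v)).congr_right ?_
  rw [dx_Psi]
  exact fn_smul 2 (v : H m)

/-- The periodic and the anti-periodic spectrum are invariant. For `λ ≠ 0` this follows from the Lax
pair; the generators of the Lax pair have a pole at `λ = 0`, where the spectral data do not depend
on the potential at all. -/
theorem isospectral {m : ℕ} {J : Set ℝ} {v : ℝ → H0 m} (hJ : J.OrdConnected)
    (hv : SolvesReduced J v) {σ : ℝ} (hσ : σ = 1 ∨ σ = -1) {s t : ℝ} (hs : s ∈ J) (ht : t ∈ J)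
    (lam : ℂ) : (lam ∉ laxSpectrum (v s) σ ↔ lam ∉ laxSpectrum (v t) σ) ∧
      laxMultiplicity (v s) σ lam = laxMultiplicity (v t) σ lam := by
  have has := perAC_evalC_Psi (v s)
  have hat := perAC_evalC_Psi (v t)
  rw [laxMultiplicity_eq hσ has, laxMultiplicity_eq hσ hat]
  rcases eq_or_ne lam 0 with rfl | hlam
  · constructor
    · rcases hσ with rfl | rfl
      · exact iff_of_false (not_not_intro (zero_mem_laxSpectrum_periodic has))
          (not_not_intro (zero_mem_laxSpectrum_periodic hat))
      · exact iff_of_true (zero_notMem_laxSpectrum_antiperiodic has)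
          (zero_notMem_laxSpectrum_antiperiodic hat)
    · have e : laxKer (v s) σ 0 1 = laxKer (v t) σ 0 1 := by
        ext f
        rw [laxKer_zero_iff hσ has, laxKer_zero_iff hσ hat]
      rw [e]
  · obtain ⟨v', hc, heq⟩ := hv
    obtain ⟨U, V, hUV⟩ := exists_laxOp_intertwining hσ hlam hJ (isC1Curve_Psi hc)
      (fun t ht => by
        filter_upwards [fn_dx_PsiDeriv (v t) (v' t), heq t ht, fn_Psi (v t),
          fn_ae_evalC (Psi (v t))] with x h1 h2 h3 h4
        rw [h1, h2, sinhC_apply, ← h4, h3]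
        ring) hs ht
    have hcomp : (laxOp σ lam (evalC m (Psi (v t)))) ∘ U = V ∘ laxOp σ lam (evalC m (Psi (v s))) :=
      funext hUV
    constructor
    · rw [notMem_laxSpectrum_iff hσ has, notMem_laxSpectrum_iff hσ hat,
        ← V.bijective.of_comp_iff', ← hcomp, U.bijective.of_comp_iff]
    · rw [rank_laxKer_eq hσ has, rank_laxKer_eq hσ hat]
      have hk : LinearMap.ker (laxOp σ lam (evalC m (Psi (v t)))).toLinearMap
          = (LinearMap.ker (laxOp σ lam (evalC m (Psi (v s)))).toLinearMap).map
            (U.toLinearEquiv : _ →ₗ[ℂ] _) := by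
        ext y
        rw [Submodule.mem_map]
        constructor
        · intro hy
          refine ⟨U.symm y, ?_, U.apply_symm_apply y⟩
          have h := hUV (U.symm y)
          rw [U.apply_symm_apply, show laxOp σ lam (evalC m (Psi (v t))) y = 0 from hy] at h
          exact (V.map_eq_zero_iff.1 h.symm)
        · rintro ⟨z, hz, rfl⟩
          change laxOp σ lam (evalC m (Psi (v t))) (U z) = 0
          rw [hUV, show laxOp σ lam (evalC m (Psi (v s))) z = 0 from hz, map_zero]
      rw [hk]
      exact (LinearEquiv.rank_map_eq U.toLinearEquiv _).symm

theorem inPoissonAlgebraMKdV_Hsh (m : ℕ) : InPoissonAlgebraMKdV (Hsh : H0 m → ℝ) := by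
  refine ⟨isAdmissible_Hsh m, fun J v hJ hv σ hσ s hs t ht => ?_⟩
  have hv := (solvesHamiltonian_Hsh_iff J v).1 hv
  exact ⟨Set.ext fun lam => not_iff_not.1 (isospectral hJ hv hσ hs ht lam).1,
    fun lam => (isospectral hJ hv hσ hs ht lam).2⟩

end

end SinhGordon

theorem theorem1 (m : ℕ) :
    (IsAnalyticDiffeoOnto (Psi : H0 m → H (m + 1))
        (Msinh (m + 1)) ∧
      (∀ (J : Set ℝ) (v : ℝ → H0 m), J.OrdConnected → J.Nontrivial →
        (SolvesSinhGordon J (fun t => Psi (v t)) ↔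
          SolvesReduced J v)) ∧
      (∀ v : H0 m, ∃ X : H0 (m + 1),
        fn0 X =ᵐ[circleMeasure]
          fun x => 1 / 2 * Real.sinh (2 * fn0 (dxInv v) x + csh v))) ∧
    (IsAdmissible (Hsh : H0 m → ℝ) ∧
      (∀ v : H0 m,
        fn (hamVectorField Hsh v) =ᵐ[circleMeasure]
          fun x => 1 / 2 * Real.sinh (2 * fn0 (dxInv v) x + csh v)) ∧
      (∀ (J : Set ℝ) (v : ℝ → H0 m), J.OrdConnected → J.Nontrivial →
        SolvesReduced J v →
        ∀ F : H0 m → ℝ, IsAdmissible F → ∀ t ∈ J,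
          HasDerivWithinAt (fun s => F (v s))
            (gardner F Hsh (v t)) J t)) ∧
    InPoissonAlgebraMKdV (Hsh : H0 m → ℝ) :=
  ⟨⟨isAnalyticDiffeoOnto_Psi m, fun J v _ _ => solvesSinhGordon_iff J v, exists_reduced_rhs⟩,
    ⟨isAdmissible_Hsh m, hamVectorField_Hsh,
      fun _ _ _ _ hv _ hF _ ht => hasDerivWithinAt_gardner hv hF ht⟩,
    inPoissonAlgebraMKdV_Hsh m⟩
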